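/- Let $\bar M$ be a compact smooth $3$-manifold with boundary $\partial M$ and interior $M$, let $\rho:\bar M\to[0,\infty)$ be a smooth defining function ($\rho^{-1}(0)=\partial M$, $d\rho\ne0$ on $\partial M$), and let $g=\rho^{-2}\bar g$ be a smoothly conformally compact asymptotically hyperbolic metric on $M$: $\bar g$ is a smooth Riemannian metric on $\bar M$ with $|d\rho|_{\bar g}=1$ on $\partial M$. Let $E$ be a tensor bundle over $\bar M$: the bundle of tensors of some fixed contravariant and covariant rank, or a subbundle of it given by an $O(3)$-invariant condition on the components in orthonormal frames. Let $r$ be its weight (covariant rank minus contravariant rank). Function spaces. For $k\in\mathbb N_0$, $t\in\mathbb R$, $C^k_t(M)$ is the space of $C^k$ tensor fields $u$ on $M$ with $|\nabla^j u|_g\le C\rho^t$ for $j\le k$; equivalently, the components of $u$ in coordinates smooth up to $\partial M$ satisfy $|\partial^\alpha u|\le C\rho^{t-r-|\alpha|}$ for $|\alpha|\le k$, uniformly on compact subsets of the chart. Put $\mathcal B_\delta(M)=\bigcap_{k\ge0,\,t<\delta}C^k_t(M)$. A smooth section $u$ of $E$ (or $E\otimes\mathbb C$) over $M$ is polyhomogeneous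 if there are $s_i\in\mathbb C$ with $\operatorname{Re}s_i$ non-decreasing and tending to $+\infty$, $p_i\in\mathbb N_0$, and smooth sections $\bar u_{ip}$ ($0\le p\le p_i$) of $E\otimes\mathbb C$ along $\partial M$, extended smoothly to $\bar M$, such that for each $k\in\mathbb N_0$ there is $N_k$ with $$u-\sum_{i=0}^{N_k}\sum_{p=0}^{p_i}\rho^{s_i-r}(\log\rho)^p\,\bar u_{ip}\in\mathcal B_k(M).$$ $\mathcal B^{\rm phg}_\delta(M)$ is the set of polyhomogeneous sections in $\mathcal B_\delta(M)$, and $C^\infty(\bar M)$ is the set of tensor fields on $M$ that extend smoothly to $\bar M$. Operator. Let $\mathcal P=\mathcal P[g]$ be a second-order linear elliptic operator acting on sections of $E$ over $M$ that is formally self-adjoint with respect to $g$ and geometric: in every coordinate frame the components of $\mathcal Pu$ are linear in the components of $u$ and their partial derivatives, with coefficients that are universal polynomials in the components of $g$, their partial derivatives and $(\det g_{ij})^{-1/2}$, the coefficients of the $j$-th derivatives of $u$ involving at most $2-j$ derivatives of $g$. For $s\in\mathbb C$ the indicial map $I_s(\mathcal P)$ of $E\otimes\mathbb C|_{\partial M}$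 is $I_s(\mathcal P)\bar u=\rho^{-s}\mathcal P(\rho^s\bar u)|_{\rho=0}$, and the characteristic exponents of $\mathcal P$ are those $s\in\mathbb C$ for which $I_s(\mathcal P)$ has a nontrivial kernel at some point of $\partial M$. Suppose that $I_s(\mathcal P)=p(s)A$, where $p$ is a polynomial all of whose complex roots are simple and are integers, and $A$ is an isomorphism of $E\otimes\mathbb C|_{\partial M}$ independent of $s$. Proposition. Let $\mu$ be the highest characteristic exponent of $\mathcal P$, and suppose $\delta>\mu\ge0$. If $u\in\mathcal B^{\rm phg}_{\mu+r}(M)$ satisfies $\mathcal Pu\in C^\infty(\bar M)$ and $\mathcal Pu\in\mathcal B_{\delta+r}(M)$, then $u$ extends to a smooth tensor field on $\bar M$. -/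

import Mathlib

open Set Filter Topology MeasureTheory
open scoped Manifold ContDiff ComplexConjugate

namespace AsympHyp

noncomputable section

/-! ### Three-dimensional manifolds with boundary and tensors

`M` always denotes a smooth three-dimensional manifold with boundary (the compact manifold usually
written `M̄`); its interior `int M` is the complete, noncompact manifold on which the
asymptotically hyperbolic metric lives. -/

/-- The model vector space `ℝ³`. -/
abbrev E3 : Type := EuclideanSpace ℝ (Fin 3)

/-- The model half space `{y ∈ ℝ³ : 0 ≤ y₀}`. -/
abbrev H3 : Type := EuclideanHalfSpace 3

/-- Arrays of components of tensors of contravariant rank `a` and covariant rank `b`. -/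
abbrev Comp (a b : ℕ) (𝕜 : Type) : Type := (Fin a → Fin 3) → (Fin b → Fin 3) → 𝕜

/-- The action of a `3 × 3` matrix `R` on component arrays,
`(R f)^{i}_{j} = ∑ R_{i₁ k₁} ⋯ R_{i_a k_a} R_{j₁ l₁} ⋯ R_{j_b l_b} f^{k}_{l}`. For orthogonal
matrices this is the change of components between orthonormal frames. -/
def rotate {a b : ℕ} (R : Matrix (Fin 3) (Fin 3) ℝ) (f : Comp a b ℝ) : Comp a b ℝ :=
  fun i j => ∑ k : Fin a → Fin 3, ∑ l : Fin b → Fin 3,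
    (∏ t, R (i t) (k t)) * (∏ t, R (j t) (l t)) * f k l

/-- A type of tensor bundle: the subbundle of the bundle of tensors of contravariant rank `a` and
covariant rank `b` that is cut out by an `O(3)`-invariant subspace `V` of component arrays with
respect to orthonormal frames. For `V = ⊤` this is the full bundle of tensors of that rank; other
choices give symmetric tensors, trace-free tensors, differential forms, etc. -/
structure TensorType where
  /-- the contravariant rank -/
  a : ℕ
  /-- the covariant rank -/
  b : ℕ
  /-- the allowed components in orthonormal frames -/
  V : Submodule ℝ (Comp a b ℝ)
  invariant : ∀ R ∈ Matrix.orthogonalGroup (Fin 3) ℝ, ∀ f ∈ V, rotate R f ∈ V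

/-- The weight of a tensor bundle: covariant rank less contravariant rank. -/
def TensorType.weight (B : TensorType) : ℝ := (B.b : ℝ) - (B.a : ℝ)

variable {M : Type*} [TopologicalSpace M] [ChartedSpace H3 M]

/-- Complexified tensors of contravariant rank `a` and covariant rank `b` at `x`: real-multilinear
complex-valued functions of `a` covectors and `b` vectors. -/
abbrev TensorAt (a b : ℕ) (x : M) : Type :=
  MultilinearMap ℝ (fun _ : Fin a => Module.Dual ℝ (TangentSpace (𝓡∂ 3) x))
    (MultilinearMap ℝ (fun _ : Fin b => TangentSpace (𝓡∂ 3) x) ℂ)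

variable (M) in
/-- Tensor fields (without any regularity). Fields on the interior of `M` are represented by
arbitrary extensions to `M`; their values on the boundary are never used. -/
abbrev TensorField (a b : ℕ) : Type _ := ∀ x : M, TensorAt a b x

/-- The components of a tensor with respect to covectors `θ i` and vectors `v i`. -/
def components {a b : ℕ} {x : M} (θ : Fin 3 → Module.Dual ℝ (TangentSpace (𝓡∂ 3) x))
    (v : Fin 3 → TangentSpace (𝓡∂ 3) x) : TensorAt a b x →ₗ[ℂ] Comp a b ℂ where
  toFun T := fun i j => T (fun t => θ (i t)) (fun t => v (j t))
  map_add' _ _ := rfl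
  map_smul' _ _ := rfl

/-- The differential of the chart `e` at `x`, as a linear map from the tangent space to `ℝ³`. -/
def chartDiff (e : OpenPartialHomeomorph M H3) (x : M) : TangentSpace (𝓡∂ 3) x →L[ℝ] E3 :=
  mfderiv (𝓡∂ 3) 𝓘(ℝ, E3) (e.extend (𝓡∂ 3)) x

/-- The coordinate vector `∂/∂yᵢ` of the chart `e`, at a point `x` of its domain. -/
def coordVector (e : OpenPartialHomeomorph M H3) (x : M) (i : Fin 3) : TangentSpace (𝓡∂ 3) x :=
  (chartDiff e x).inverse (EuclideanSpace.single i (1 : ℝ))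

/-- The coordinate covector `dyᵢ` of the chart `e`, at a point `x` of its domain. -/
def coordCovector (e : OpenPartialHomeomorph M H3) (x : M) (i : Fin 3) :
    Module.Dual ℝ (TangentSpace (𝓡∂ 3) x) :=
  ((EuclideanSpace.proj i : E3 →L[ℝ] ℝ).comp (chartDiff e x)).toLinearMap

/-- The components of a tensor at `x` in the coordinate frame of the chart `e`. -/
def coordComp {a b : ℕ} (e : OpenPartialHomeomorph M H3) (x : M) :
    TensorAt a b x →ₗ[ℂ] Comp a b ℂ :=
  components (coordCovector e x) (coordVector e x)

/-- The component functions of a tensor field as functions of the coordinates of the chart `e`. -/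
def coordRep {a b : ℕ} (e : OpenPartialHomeomorph M H3) (u : TensorField M a b) :
    E3 → Comp a b ℂ :=
  fun y => coordComp e ((e.extend (𝓡∂ 3)).symm y) (u ((e.extend (𝓡∂ 3)).symm y))

variable (M) in
/-- The smooth charts of `M`. -/
abbrev smoothCharts : Set (OpenPartialHomeomorph M H3) :=
  IsManifold.maximalAtlas (𝓡∂ 3) ∞ M

variable (M) in
/-- The interior of `M`. -/
abbrev int : Set M := (𝓡∂ 3).interior M

variable (M) in
/-- The boundary of `M`. -/
abbrev bdry : Set M := (𝓡∂ 3).boundary M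

/-- The tensor field `u` is of class `C^n` on `s` (with `s = int M` or `s = M`): its components in
every smooth chart are. -/
def IsOfClassOn {a b : ℕ} (n : ℕ∞) (s : Set M) (u : TensorField M a b) : Prop :=
  ∀ e ∈ smoothCharts M,
    ContMDiffOn (𝓡∂ 3) 𝓘(ℝ, Comp a b ℂ) n (fun x => coordComp e x (u x)) (e.source ∩ s)

/-- The field `u` on `int M` extends to a smooth tensor field on all of `M`, including the
boundary. -/
def ExtendsSmoothly {a b : ℕ} (u : TensorField M a b) : Prop :=
  ∃ v : TensorField M a b, IsOfClassOn ⊤ univ v ∧ ∀ x ∈ int M, v x = u x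

/-! ### Asymptotically hyperbolic metrics -/

/-- Defining functions of the boundary: smooth functions `ρ : M → [0, ∞)` with
`ρ⁻¹(0) = ∂M` and `dρ ≠ 0` along `∂M`. -/
structure IsDefiningFunction (ρ : M → ℝ) : Prop where
  smooth : ContMDiff (𝓡∂ 3) 𝓘(ℝ, ℝ) ∞ ρ
  nonneg : ∀ x, 0 ≤ ρ x
  zero_iff : ∀ x, ρ x = 0 ↔ x ∈ bdry M
  deriv_ne_zero : ∀ x ∈ bdry M, mfderiv (𝓡∂ 3) 𝓘(ℝ, ℝ) ρ x ≠ 0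

variable (M) in
/-- Riemannian metrics on `M` that are smooth up to the boundary. -/
abbrev SmoothMetric [IsManifold (𝓡∂ 3) ∞ M] : Type _ :=
  Bundle.ContMDiffRiemannianMetric (𝓡∂ 3) ∞ E3 (fun x : M => TangentSpace (𝓡∂ 3) x)

variable [IsManifold (𝓡∂ 3) ∞ M]

/-- For a defining function `ρ` and a smooth metric `gbar` on `M`, the metric `ρ⁻² gbar` on
`int M` is asymptotically hyperbolic, i.e. `|dρ|² = 1` along `∂M` with respect to `gbar`. Here
`grad` is the `gbar`-gradient of `ρ`. Every smoothly conformally compact asymptotically hyperbolic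
metric `g` on `int M` is of this form, with `gbar` the extension of `ρ² g`. -/
def IsAsymptoticallyHyperbolic (ρ : M → ℝ) (gbar : SmoothMetric M) : Prop :=
  ∀ q ∈ bdry M, ∃ grad : TangentSpace (𝓡∂ 3) q,
    (∀ v : TangentSpace (𝓡∂ 3) q, gbar.inner q grad v = mfderiv (𝓡∂ 3) 𝓘(ℝ, ℝ) ρ q v) ∧
    gbar.inner q grad grad = 1

/-- The matrix of components `g_{ij}` of the metric `g = ρ⁻² gbar` in the chart `e`. -/
def metricMatrix (ρ : M → ℝ) (gbar : SmoothMetric M) (e : OpenPartialHomeomorph M H3) (x : M) :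
    Matrix (Fin 3) (Fin 3) ℝ :=
  fun i j => (ρ x ^ 2)⁻¹ * gbar.inner x (coordVector e x i) (coordVector e x j)

/-! ### Sections of tensor bundles -/

/-- The fibre `E_x ⊗ ℂ` of the (complexified) tensor bundle of type `B`: the tensors whose
components in every `gbar`-orthonormal frame lie in `V ⊗ ℂ`. (Frames orthonormal for
`g = ρ⁻² gbar` give the same bundle, since they differ by a factor.) -/
def TensorType.fibre (B : TensorType) (gbar : SmoothMetric M) (x : M) :
    Submodule ℂ (TensorAt B.a B.b x) :=
  ⨅ (f : Module.Basis (Fin 3) ℝ (TangentSpace (𝓡∂ 3) x))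
    (_ : ∀ i j, gbar.inner x (f i) (f j) = if i = j then 1 else 0),
    (Submodule.span ℂ ((fun c : Comp B.a B.b ℝ => fun i j => (c i j : ℂ)) '' (B.V : Set _))).comap
      (components (fun i => f.coord i) (fun i => f i))

/-- Smooth sections over `s` (with `s = int M` or `s = M`) of the tensor bundle of type `B`. -/
structure IsSection (B : TensorType) (gbar : SmoothMetric M) (s : Set M)
    (u : TensorField M B.a B.b) : Prop where
  smooth : IsOfClassOn ⊤ s u
  mem : ∀ x ∈ s, u x ∈ B.fibre gbar x

/-! ### Weighted spaces and polyhomogeneity -/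

/-- The weighted space `C^k_t` of tensor fields on `int M`, `M` compact. For an asymptotically
hyperbolic metric `g`, the bound `|∇ʲu|_g ≤ C ρ^t` on the covariant derivatives of orders `j ≤ k`
of a field of weight `r` amounts to the bounds `|∂ʲu| ≤ C ρ^(t - r - j)` on the components in
coordinates that are smooth up to the boundary, uniformly on compact sets of such charts. -/
structure InWeighted (B : TensorType) (ρ : M → ℝ) (k : ℕ) (t : ℝ) (u : TensorField M B.a B.b) :
    Prop where
  regular : IsOfClassOn k (int M) u
  bound : ∀ e ∈ smoothCharts M, ∀ K : Set M, IsCompact K → K ⊆ e.source →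
    ∃ C : ℝ, ∀ x ∈ K ∩ int M, ∀ j ≤ k,
      ‖iteratedFDeriv ℝ j (coordRep e u) (e.extend (𝓡∂ 3) x)‖ ≤ C * ρ x ^ (t - B.weight - j)

/-- The space `𝓑_δ`, the intersection of the spaces `C^k_t` over all `k ≥ 0` and `t < δ`. -/
def InB (B : TensorType) (ρ : M → ℝ) (δ : ℝ) (u : TensorField M B.a B.b) : Prop :=
  ∀ k : ℕ, ∀ t < δ, InWeighted B ρ k t u

/-- The function `ρ^s (log ρ)^p`. -/
def powLog (ρ : M → ℝ) (s : ℂ) (p : ℕ) (x : M) : ℂ :=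
  (ρ x : ℂ) ^ s * ((Real.log (ρ x) : ℝ) : ℂ) ^ p

/-- Polyhomogeneous sections `u ∼ ∑ᵢ ∑_{p ≤ pᵢ} ρ^(sᵢ - r) (log ρ)^p ū_{ip}` over `int M` of a
tensor bundle of weight `r`. The coefficients `ū_{ip}` are sections along the boundary, smoothly
extended to `M`; changing the extension only changes later terms of the expansion, so the class
does not depend on how the sections are extended. -/
structure IsPolyhomogeneous (B : TensorType) (ρ : M → ℝ) (gbar : SmoothMetric M)
    (u : TensorField M B.a B.b) : Prop where
  isSection : IsSection B gbar (int M) u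
  expansion : ∃ (s : ℕ → ℂ) (p : ℕ → ℕ) (ubar : ℕ → ℕ → TensorField M B.a B.b),
    Monotone (fun i => (s i).re) ∧ Tendsto (fun i => (s i).re) atTop atTop ∧
    (∀ i, ∀ q ≤ p i, IsSection B gbar univ (ubar i q)) ∧
    ∀ k : ℕ, ∃ N : ℕ, InB B ρ k (fun x => u x -
      ∑ i ∈ Finset.range (N + 1), ∑ q ∈ Finset.range (p i + 1),
        powLog ρ (s i - (B.weight : ℂ)) q x • ubar i q x)

/-! ### Geometric operators -/

/-- Variables for the metric jet of order `n` in coordinates: `none` stands for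
`(det g_{ij})^(-1/2)` and `some (⟨m, κ⟩, i, j)` for `∂_{κ 0} ⋯ ∂_{κ (m-1)} g_{ij}`, `m ≤ n`. -/
abbrev JetVar (n : ℕ) : Type := Option ((Σ m : Fin (n + 1), (Fin m → Fin 3)) × Fin 3 × Fin 3)

/-- The iterated partial derivative `∂_{κ 0} ⋯ ∂_{κ (m-1)} F` at `y`. -/
def partialDeriv {F : Type*} [NormedAddCommGroup F] [NormedSpace ℝ F] {m : ℕ} (κ : Fin m → Fin 3)
    (f : E3 → F) (y : E3) : F :=
  iteratedFDeriv ℝ m f y (fun t => EuclideanSpace.single (κ t) (1 : ℝ))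

/-- The values of the jet variables for the metric `g = ρ⁻² gbar` at `x`, in the chart `e`. -/
def metricJet (ρ : M → ℝ) (gbar : SmoothMetric M) (e : OpenPartialHomeomorph M H3) (x : M)
    (n : ℕ) : JetVar n → ℝ
  | none => (Real.sqrt (metricMatrix ρ gbar e x).det)⁻¹
  | some (⟨_, κ⟩, i, j) =>
      partialDeriv κ (fun y => metricMatrix ρ gbar e ((e.extend (𝓡∂ 3)).symm y) i j)
        (e.extend (𝓡∂ 3) x)

/-- `P` is a geometric linear differential operator of order `l` arising from the metric
`g = ρ⁻² gbar`, acting on sections of the tensor bundle of type `B` over `int M`: in all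
coordinate frames, the components of `P u` are linear in the components of `u` and their
derivatives of order at most `l`, the coefficients being given by the same (universal) real
polynomials in the components of `g`, their partial derivatives and `(det g_{ij})^(-1/2)`, where
the coefficients of the `m`-th derivatives of `u` involve no more than `l - m` derivatives of
`g`. -/
def IsGeometric (B : TensorType) (ρ : M → ℝ) (gbar : SmoothMetric M) (l : ℕ)
    (P : TensorField M B.a B.b → TensorField M B.a B.b) : Prop :=
  ∃ c : ∀ m : Fin (l + 1), (Fin m → Fin 3) →
      (Fin B.a → Fin 3) → (Fin B.b → Fin 3) → (Fin B.a → Fin 3) → (Fin B.b → Fin 3) →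
      MvPolynomial (JetVar (l - m)) ℝ,
    ∀ u, IsSection B gbar (int M) u → ∀ e ∈ smoothCharts M, ∀ x ∈ e.source ∩ int M, ∀ i j,
      coordComp e x (P u x) i j =
        ∑ m : Fin (l + 1), ∑ κ : Fin m → Fin 3, ∑ i', ∑ j',
          ((MvPolynomial.eval (metricJet ρ gbar e x (l - m)) (c m κ i j i' j') : ℝ) : ℂ) *
            partialDeriv κ (coordRep e u) (e.extend (𝓡∂ 3) x) i' j'

/-- Ellipticity of a second-order operator `P` on `int M`: the principal symbol
`u(x) ↦ ½ P(φ² u)(x)`, where `φ(x) = 0`, is injective for all covectors `dφ_x ≠ 0`. -/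
def IsElliptic (B : TensorType) (gbar : SmoothMetric M)
    (P : TensorField M B.a B.b → TensorField M B.a B.b) : Prop :=
  ∀ x ∈ int M, ∀ φ : M → ℝ, ContMDiff (𝓡∂ 3) 𝓘(ℝ, ℝ) ∞ φ → φ x = 0 →
    mfderiv (𝓡∂ 3) 𝓘(ℝ, ℝ) φ x ≠ 0 →
    ∀ u, IsSection B gbar (int M) u → u x ≠ 0 →
      P (fun z => ((φ z : ℂ) ^ 2) • u z) x ≠ 0

/-- The (Hermitian) inner product `⟨S, T⟩_g` of two tensors given by their components in a
coordinate frame in which the metric has the matrix `G`. -/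
def compInner {a b : ℕ} (G : Matrix (Fin 3) (Fin 3) ℝ) (S T : Comp a b ℂ) : ℂ :=
  ∑ i, ∑ i', ∑ j, ∑ j',
    (((∏ t, G (i t) (i' t)) * (∏ t, G⁻¹ (j t) (j' t)) : ℝ) : ℂ) * S i j * conj (T i' j')

/-- The integral `∫ ⟨u, v⟩_g dV_g` for fields supported in the domain of the chart `e`. -/
def chartPairing {a b : ℕ} (ρ : M → ℝ) (gbar : SmoothMetric M) (e : OpenPartialHomeomorph M H3)
    (u v : TensorField M a b) : ℂ :=
  ∫ y in (e.extend (𝓡∂ 3)).target,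
    compInner (metricMatrix ρ gbar e ((e.extend (𝓡∂ 3)).symm y)) (coordRep e u y) (coordRep e v y)
      * (Real.sqrt (metricMatrix ρ gbar e ((e.extend (𝓡∂ 3)).symm y)).det : ℂ)

/-- `P` is formally self-adjoint with respect to `g = ρ⁻² gbar`: `∫ ⟨P u, v⟩ = ∫ ⟨u, P v⟩` for
smooth sections with compact support in `int M`. As `P` is a differential operator, it is enough
to consider sections supported in one chart. -/
def IsFormallySelfAdjoint (B : TensorType) (ρ : M → ℝ) (gbar : SmoothMetric M)
    (P : TensorField M B.a B.b → TensorField M B.a B.b) : Prop :=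
  ∀ e ∈ smoothCharts M, ∀ K : Set M, IsCompact K → K ⊆ e.source ∩ int M →
    ∀ u v, IsSection B gbar (int M) u → IsSection B gbar (int M) v →
      (∀ x ∉ K, u x = 0) → (∀ x ∉ K, v x = 0) →
      chartPairing ρ gbar e (P u) v = chartPairing ρ gbar e u (P v)

/-- Second-order linear elliptic, geometric and formally self-adjoint operators `P = P[g]`,
`g = ρ⁻² gbar`, acting on sections over `int M` of the tensor bundle of type `B`. -/
structure IsEllipticGeometric (B : TensorType) (ρ : M → ℝ) (gbar : SmoothMetric M)
    (P : TensorField M B.a B.b → TensorField M B.a B.b) : Prop where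
  mapsTo : ∀ u, IsSection B gbar (int M) u → IsSection B gbar (int M) (P u)
  geometric : IsGeometric B ρ gbar 2 P
  elliptic : IsElliptic B gbar P
  selfAdjoint : IsFormallySelfAdjoint B ρ gbar P

/-! ### The indicial map -/

/-- `I_s(P) ū = T` at the boundary point `q`, where
`I_s(P) ū = ρ^(-s) P(ρ^s ū)` restricted to `ρ = 0`. -/
def IndicialValue {B : TensorType} (ρ : M → ℝ) (P : TensorField M B.a B.b → TensorField M B.a B.b)
    (s : ℂ) (ubar : TensorField M B.a B.b) (q : M) (T : TensorAt B.a B.b q) : Prop :=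
  ∀ e ∈ smoothCharts M, q ∈ e.source →
    Tendsto (fun x => coordComp e x
        (((ρ x : ℂ) ^ (-s)) • P (fun z => ((ρ z : ℂ) ^ s) • ubar z) x))
      (𝓝[int M] q) (𝓝 (coordComp e q T))

/-- The characteristic exponents of `P`: those `s ∈ ℂ` for which `I_s(P)` has a nontrivial kernel
at some point of `∂M`. -/
def charExponents (B : TensorType) (ρ : M → ℝ) (gbar : SmoothMetric M)
    (P : TensorField M B.a B.b → TensorField M B.a B.b) : Set ℂ :=
  {s | ∃ q ∈ bdry M, ∃ ubar, IsSection B gbar univ ubar ∧ ubar q ≠ 0 ∧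
    IndicialValue ρ P s ubar q 0}

/-- The indicial map `I_s(P)` is the product of a polynomial `p(s)`, all of whose complex roots
are simple and integers, and an isomorphism (independent of `s`) of the bundle over `∂M`. -/
def HasSimpleIntegerIndicialMap (B : TensorType) (ρ : M → ℝ) (gbar : SmoothMetric M)
    (P : TensorField M B.a B.b → TensorField M B.a B.b) : Prop :=
  ∃ p : Polynomial ℂ,
    (∀ s : ℂ, p.IsRoot s → (∃ n : ℤ, s = n) ∧ p.rootMultiplicity s = 1) ∧
    ∃ A : ∀ q : M, B.fibre gbar q ≃ₗ[ℂ] B.fibre gbar q,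
      ∀ s : ℂ, ∀ q ∈ bdry M, ∀ ubar, ∀ h : IsSection B gbar univ ubar,
        IndicialValue ρ P s ubar q
          (p.eval s • (A q ⟨ubar q, h.mem q (mem_univ q)⟩ : TensorAt B.a B.b q))

end

end AsympHyp

set_option linter.unusedSectionVars false

namespace AsympHyp

/-! ### Asymptotic independence of powers and logarithms -/

/-! The highest exponent μ is a root of the indicial polynomial p, hence an integer n ≥ 0. In
components the weight drops out of the exponents, and u is, up to a remainder of any prescribed
order, a finite sum of terms ρ^σ (log ρ)^q c with c a section smooth up to the boundary. It is kept
in the form u = ρ^n v + Σ ρ^σ (log ρ)^q c_{σq} + w (`HasExpansion`), with v smooth, and the sum is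
emptied from the bottom. A term of lowest Re σ with σ = n + m (m ∈ ℕ) and q = 0 is absorbed into v
(`HasExpansion.move`). For any other lowest term, c vanishes on ∂M, so c = ρ d with d again a smooth
section, and the exponent rises by one (`HasExpansion.shift`). After finitely many steps all
remaining exponents are large (`HasExpansion.exists_le_re`). Thus u agrees with smooth fields to
every order, which makes it smooth up to the boundary (`extendsSmoothly_of_hasOrder`).

The vanishing of c is the heart of the matter. If Re σ < n, it follows from the decay of u and the
asymptotic independence of the functions r^σ (log r)^q (`HasExpansion.coeff_eq_zero_of_lt`). If Re σ
≥ n, P is applied (`HasExpansion.coeff_eq_zero_of_le`). On ρ^σ Q(log ρ) the Euler operator ρ d/dρ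
acts as σ + D on Q, with D = d/dX, so the leading part of P(ρ^σ Q(log ρ) c) is ρ^σ (p(σ + D) Q)(log
ρ) A c. The smooth field P u and the field P(ρ^n v), which is ρ^n times a smooth field, contribute
no logarithms. Hence for each component the polynomial R collecting the values of A c_{σq} satisfies
p(σ + D) R = b with b constant. When p(σ) ≠ 0, R must be constant, and b = 0 unless σ is a natural
number. When p(σ) = 0, maximality forces σ = n. Then b = 0, because P u decays faster than ρ^n and
p(n) = 0, and simplicity of the root forces R' = 0. In every case only σ = n + m without logarithm
can survive.

The form of P(ρ^σ Q(log ρ) c) is obtained without computing coefficients. Those of a geometric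
operator have at most poles in ρ, so this field is ρ^σ Σ_j ((σ + D)^j Q)(log ρ) g_j with g_j
independent of σ and Q and possibly singular (`isLogFamily_localOp`). Existence of the indicial
limit for every σ gives limits of the g_j by Vandermonde interpolation. A function with a pole that
has limits at the boundary is smooth there by Hadamard's lemma (`IsLaurent.exists_extension`).
Comparing polynomials in σ then identifies the boundary values (`IsLogFamily.exists_contDiffOn`). -/

theorem expSum_eq_zero {ι : Type*} (θ : ι → ℝ) (S : Finset ι) (hS : Set.InjOn θ S) :
    ∀ a : ι → ℂ, Tendsto (fun x : ℝ => ∑ i ∈ S, a i * Complex.exp (Complex.I * θ i * x))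
      atTop (𝓝 0) → ∀ i ∈ S, a i = 0 := by
  classical
  induction S using Finset.induction_on with
  | empty => simp
  | insert i₀ S hi₀ ih =>
    intro a h
    have hS' : Set.InjOn θ S := hS.mono (by simp)
    have key : ∀ i ∈ S, a i = 0 := by
      -- Translating the argument by s and subtracting e^{iθ₀s} times the original sum removes the
      -- `i₀` term. The other coefficients are multiplied by a difference of exponentials, so the
      -- induction hypothesis applies.
      have step : ∀ s : ℝ, ∀ i ∈ S,
          a i * (Complex.exp (Complex.I * θ i * s) - Complex.exp (Complex.I * θ i₀ * s)) = 0 := by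
        intro s
        refine ih hS' (fun i => a i *
          (Complex.exp (Complex.I * θ i * s) - Complex.exp (Complex.I * θ i₀ * s))) ?_
        have h1 : Tendsto (fun x : ℝ => x + s) atTop atTop := tendsto_atTop_add_const_right _ s tendsto_id
        have h2 := (h.comp h1).sub (h.const_mul (Complex.exp (Complex.I * θ i₀ * s)))
        simp only [mul_zero, sub_zero] at h2
        refine h2.congr fun x => ?_
        simp only [Function.comp, Finset.mul_sum, ← Finset.sum_sub_distrib]
        rw [Finset.sum_insert hi₀]
        have e : ∀ i, Complex.exp (Complex.I * θ i * ((x + s : ℝ) : ℂ))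
            = Complex.exp (Complex.I * θ i * x) * Complex.exp (Complex.I * θ i * s) := by
          intro i
          rw [← Complex.exp_add]; push_cast; ring_nf
        simp only [e]
        rw [show a i₀ * (Complex.exp (Complex.I * θ i₀ * x) * Complex.exp (Complex.I * θ i₀ * s)) -
          Complex.exp (Complex.I * θ i₀ * s) * (a i₀ * Complex.exp (Complex.I * θ i₀ * x)) = 0 by ring,
          zero_add]
        exact Finset.sum_congr rfl fun i _ => by ring
      intro i hi
      have hne : θ i - θ i₀ ≠ 0 := by
        intro h0
        have : i = i₀ := hS (by simp [hi]) (by simp) (by linarith)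
        exact hi₀ (this ▸ hi)
      -- For this s the phases differ by π, so the two exponentials are opposite and their
      -- difference is nonzero.
      rcases mul_eq_zero.1 (step (Real.pi / (θ i - θ i₀)) i hi) with h0 | h0
      · exact h0
      · exfalso
        rw [sub_eq_zero, Complex.exp_eq_exp_iff_exists_int] at h0
        obtain ⟨n, hn⟩ := h0
        have hn' : (θ i - θ i₀) * (Real.pi / (θ i - θ i₀)) = 2 * n * Real.pi := by
          have := congrArg Complex.im hn
          rw [show Complex.I * θ i * ((Real.pi / (θ i - θ i₀) : ℝ) : ℂ)
              = ((θ i * (Real.pi / (θ i - θ i₀)) : ℝ) : ℂ) * Complex.I by push_cast; ring,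
            show Complex.I * θ i₀ * ((Real.pi / (θ i - θ i₀) : ℝ) : ℂ)
              + n * (2 * Real.pi * Complex.I)
              = ((θ i₀ * (Real.pi / (θ i - θ i₀)) + 2 * n * Real.pi : ℝ) : ℂ) * Complex.I by
                push_cast; ring, Complex.im_ofReal_mul, Complex.im_ofReal_mul] at this
          simp only [Complex.I_im, mul_one] at this
          linarith
        rw [mul_div_cancel₀ _ hne] at hn'
        have h3 : (1 : ℝ) = 2 * n := by
          have := Real.pi_pos
          field_simp at hn'
          linarith
        have h4 : (1 : ℤ) = 2 * n := by exact_mod_cast h3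
        omega
    have h0 : a i₀ = 0 := by
      have h1 : Tendsto (fun x : ℝ => a i₀ * Complex.exp (Complex.I * θ i₀ * x)) atTop (𝓝 0) := by
        refine h.congr fun x => ?_
        rw [Finset.sum_insert hi₀, Finset.sum_eq_zero, add_zero]
        intro i hi
        rw [key i hi, zero_mul]
      have h2 := h1.norm
      have e : ∀ x : ℝ, ‖a i₀ * Complex.exp (Complex.I * θ i₀ * x)‖ = ‖a i₀‖ := by
        intro x
        rw [norm_mul, show Complex.I * θ i₀ * x = ((θ i₀ * x : ℝ) : ℂ) * Complex.I by
          push_cast; ring, Complex.norm_exp_ofReal_mul_I, mul_one]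
      simp only [e, norm_zero] at h2
      exact norm_eq_zero.1 (tendsto_nhds_unique tendsto_const_nhds h2)
    intro i hi
    rcases Finset.mem_insert.1 hi with rfl | hi
    · exact h0
    · exact key i hi

open Polynomial in
theorem tendsto_eval_div_pow (R : ℂ[X]) (d : ℕ) (hd : R.natDegree ≤ d) :
    Tendsto (fun x : ℝ => R.eval (x : ℂ) / (x : ℂ) ^ d) atTop (𝓝 (R.coeff d)) := by
  have h : ∀ᶠ x : ℝ in atTop, ∑ i ∈ Finset.range (d + 1), R.coeff i * ((x : ℂ)⁻¹) ^ (d - i)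
      = R.eval (x : ℂ) / (x : ℂ) ^ d := by
    filter_upwards [eventually_gt_atTop 0] with x hx
    have hx' : (x : ℂ) ≠ 0 := by exact_mod_cast hx.ne'
    rw [R.eval_eq_sum_range' (Nat.lt_succ_of_le hd), Finset.sum_div]
    refine Finset.sum_congr rfl fun i hi => ?_
    have hi' : i ≤ d := Nat.lt_succ_iff.1 (Finset.mem_range.1 hi)
    rw [inv_pow, pow_sub₀ _ hx' hi']
    field_simp
  refine Tendsto.congr' h ?_
  have hz : Tendsto (fun x : ℝ => ((x : ℂ)⁻¹)) atTop (𝓝 0) := by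
    have := (Complex.continuous_ofReal.tendsto 0).comp tendsto_inv_atTop_zero
    simpa [Function.comp_def] using this
  have : Tendsto (fun x : ℝ => ∑ i ∈ Finset.range (d + 1), R.coeff i * ((x : ℂ)⁻¹) ^ (d - i)) atTop
      (𝓝 (∑ i ∈ Finset.range (d + 1), R.coeff i * (0 : ℂ) ^ (d - i))) :=
    tendsto_finsetSum _ fun i _ => (hz.pow _).const_mul _
  convert this using 2
  rw [Finset.sum_range_succ, Finset.sum_eq_zero, zero_add]
  · simp
  · intro i hi
    rw [zero_pow (by have := Finset.mem_range.1 hi; omega), mul_zero]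

-- Division by x^d, for a common degree bound d, leaves a pure exponential sum in the coefficients
-- of x^d, up to o(1). These coefficients vanish by `expSum_eq_zero`, and the degree bound descends.
open Polynomial in
theorem expPoly_eq_zero {ι : Type*} (θ : ι → ℝ) (S : Finset ι) (hS : Set.InjOn θ S) (R : ι → ℂ[X])
    (h : Tendsto (fun x : ℝ => ∑ i ∈ S, Complex.exp (Complex.I * θ i * x) * (R i).eval (x : ℂ))
      atTop (𝓝 0)) : ∀ i ∈ S, R i = 0 := by
  have step : ∀ d : ℕ, (∀ i ∈ S, (R i).natDegree ≤ d) → ∀ i ∈ S, (R i).coeff d = 0 := by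
    intro d hd
    refine expSum_eq_zero θ S hS (fun i => (R i).coeff d) ?_
    have h1 : Tendsto (fun x : ℝ => (∑ i ∈ S, Complex.exp (Complex.I * θ i * x) *
        (R i).eval (x : ℂ)) / (x : ℂ) ^ d) atTop (𝓝 0) := by
      refine squeeze_zero_norm' ?_ (by simpa using h.norm)
      filter_upwards [eventually_ge_atTop 1] with x hx
      rw [norm_div, norm_pow, Complex.norm_real, Real.norm_of_nonneg (by linarith)]
      exact div_le_self (norm_nonneg _) (one_le_pow₀ hx)
    have h2 : Tendsto (fun x : ℝ => ∑ i ∈ S, Complex.exp (Complex.I * θ i * x) *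
        ((R i).coeff d - (R i).eval (x : ℂ) / (x : ℂ) ^ d)) atTop (𝓝 0) := by
      rw [show (0 : ℂ) = ∑ i ∈ S, 0 by simp]
      refine tendsto_finsetSum _ fun i hi => ?_
      have h3 := (tendsto_eval_div_pow (R i) d (hd i hi)).const_sub ((R i).coeff d)
      rw [sub_self] at h3
      refine squeeze_zero_norm (fun x => ?_) (by simpa using h3.norm)
      rw [norm_mul, show Complex.I * θ i * x = ((θ i * x : ℝ) : ℂ) * Complex.I by
          push_cast; ring, Complex.norm_exp_ofReal_mul_I, one_mul]
    have h3 := h1.add h2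
    rw [add_zero] at h3
    refine h3.congr fun x => ?_
    rw [Finset.sum_div, ← Finset.sum_add_distrib]
    exact Finset.sum_congr rfl fun i _ => by ring
  -- The bound is on `degree`, not `natDegree`, so that the case d = 0 already means R = 0.
  have all : ∀ d : ℕ, (∀ i ∈ S, (R i).degree < d) → ∀ i ∈ S, R i = 0 := by
    intro d
    induction d with
    | zero => intro hd i hi; simpa using hd i hi
    | succ d ih =>
      intro hd
      refine ih fun i hi => ?_
      have hle : ∀ i ∈ S, (R i).natDegree ≤ d := fun i hi =>
        by
        rw [natDegree_le_iff_coeff_eq_zero]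
        exact fun m hm => (degree_lt_iff_coeff_zero _ _).1 (hd i hi) m hm
      have := step d hle i hi
      refine (degree_lt_iff_coeff_zero _ _).2 fun m hm => ?_
      rcases hm.eq_or_lt with rfl | hm
      · exact this
      · exact coeff_eq_zero_of_natDegree_lt (lt_of_le_of_lt (hle i hi) hm)
  refine all (S.sup (fun i => (R i).natDegree) + 1) fun i hi => ?_
  refine lt_of_le_of_lt degree_le_natDegree ?_
  exact_mod_cast Nat.lt_succ_of_le (Finset.le_sup (f := fun i => (R i).natDegree) hi)

open Polynomial in
/-- Distinct exponents on a vertical line, with polynomials in the logarithm as coefficients, are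
asymptotically independent. -/
theorem powLog_eq_zero (τ : ℝ) (S : Finset ℂ) (hS : ∀ σ ∈ S, σ.re = τ) (R : ℂ → ℂ[X])
    (h : Tendsto (fun r : ℝ => ((r ^ (-τ) : ℝ) : ℂ) *
      ∑ σ ∈ S, (r : ℂ) ^ σ * (R σ).eval ((Real.log r : ℝ) : ℂ)) (𝓝[>] 0) (𝓝 0)) :
    ∀ σ ∈ S, R σ = 0 := by
  have hinj : Set.InjOn (fun σ : ℂ => -σ.im) S := by
    intro σ hσ σ' hσ' he
    exact Complex.ext ((hS σ hσ).trans (hS σ' hσ').symm) (neg_injective he)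
  -- With r = e^{-x} one has r^{-τ} r^σ = e^{-ix Im σ} and log r = -x, which explains the
  -- frequencies -Im σ and the composition with -X.
  have h1 : Tendsto (fun x : ℝ => Real.exp (-x)) atTop (𝓝[>] 0) :=
    tendsto_nhdsWithin_iff.2 ⟨Real.tendsto_exp_neg_atTop_nhds_zero,
      Eventually.of_forall fun x => Real.exp_pos _⟩
  have h2 := h.comp h1
  have h3 : ∀ σ ∈ S, (R σ).comp (-X) = 0 := by
    refine expPoly_eq_zero (fun σ : ℂ => -σ.im) S hinj (fun σ => (R σ).comp (-X)) ?_
    refine h2.congr fun x => ?_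
    simp only [Function.comp, Finset.mul_sum, Real.log_exp]
    refine Finset.sum_congr rfl fun σ hσ => ?_
    have e1 : ((Real.exp (-x) : ℝ) : ℂ) ^ σ = Complex.exp (-x * σ) := by
      rw [Complex.cpow_def_of_ne_zero (by exact_mod_cast (Real.exp_pos _).ne'),
        ← Complex.ofReal_log (Real.exp_pos _).le, Real.log_exp]
      push_cast; rfl
    have e2 : Real.exp (-x) ^ (-τ) = Real.exp (x * τ) := by
      rw [← Real.exp_mul]; ring_nf
    rw [e1, e2, ← mul_assoc]
    congr 1
    · rw [Complex.ofReal_exp, ← Complex.exp_add]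
      congr 1
      apply Complex.ext <;> simp [hS σ hσ]; ring
    · simp
  intro σ hσ
  have := congrArg (fun p => p.comp (-X)) (h3 σ hσ)
  simpa [comp_assoc] using this

/-! ### Polynomials in the operator `σ + d/dX` -/

open Polynomial in
/-- The operator `Q ↦ σ Q + Q'` on polynomials; `ρ d/dρ` acts on `ρ^σ Q(log ρ)` in this way. -/
noncomputable def eulerOp (σ : ℂ) : Module.End ℂ ℂ[X] := algebraMap ℂ _ σ + derivative

open Polynomial in
theorem eulerOp_apply (σ : ℂ) (Q : ℂ[X]) : eulerOp σ Q = σ • Q + derivative Q := rfl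

open Polynomial in
theorem natDegree_aeval_eulerOp_le (σ : ℂ) (p Q : ℂ[X]) :
    (aeval (eulerOp σ) p Q).natDegree ≤ Q.natDegree := by
  induction p using Polynomial.induction_on' with
  | add p q hp hq =>
    rw [map_add, LinearMap.add_apply]
    exact (natDegree_add_le _ _).trans (max_le hp hq)
  | monomial n a =>
    rw [aeval_monomial, ← Algebra.smul_def, LinearMap.smul_apply]
    refine (natDegree_smul_le _ _).trans ?_
    induction n with
    | zero => simp
    | succ n ih =>
      rw [pow_succ', Module.End.mul_apply, eulerOp_apply]
      refine (natDegree_add_le _ _).trans (max_le ((natDegree_smul_le _ _).trans ih) ?_)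
      exact (natDegree_derivative_le _).trans (by omega)

-- Dividing p by X - σ gives p = p(σ) + (X - σ) p₁ with p₁(σ) = p'(σ), and X - σ evaluates to D at σ
-- + D.
open Polynomial in
theorem exists_aeval_eulerOp (σ : ℂ) (p : ℂ[X]) : ∃ p₁ : ℂ[X], p₁.eval σ = (derivative p).eval σ ∧
    ∀ Q, aeval (eulerOp σ) p Q = p.eval σ • Q + aeval (eulerOp σ) p₁ (derivative Q) := by
  refine ⟨p /ₘ (X - C σ), ?_, fun Q => ?_⟩
  · conv_rhs => rw [← modByMonic_add_div p (X - C σ)]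
    simp [modByMonic_X_sub_C_eq_C_eval]
  · conv_lhs => rw [← modByMonic_add_div p (X - C σ), modByMonic_X_sub_C_eq_C_eval, mul_comm (X - C σ)]
    have h : aeval (eulerOp σ) (X - C σ : ℂ[X]) = (derivative : Module.End ℂ ℂ[X]) := by
      rw [map_sub, aeval_X, aeval_C, eulerOp, add_sub_cancel_left]
    rw [map_add, map_mul, h, aeval_C]
    rfl

-- Since p(σ + D) is p(σ) plus an operator that lowers degrees, it preserves the degree of a
-- nonconstant polynomial when p(σ) ≠ 0. A constant image therefore has a constant preimage. This is
-- the nonresonant case of the main argument.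
open Polynomial in
theorem natDegree_eq_zero_of_aeval_eulerOp {σ : ℂ} {p Q : ℂ[X]} {b : ℂ} (hp : p.eval σ ≠ 0)
    (h : aeval (eulerOp σ) p Q = C b) : Q = C (b / p.eval σ) := by
  obtain ⟨p₁, -, hp₁⟩ := exists_aeval_eulerOp σ p
  have h1 : Q.natDegree = 0 := by
    by_contra hne
    have h2 : p.eval σ • Q = C b - aeval (eulerOp σ) p₁ (derivative Q) := by
      rw [← h, hp₁, add_sub_cancel_right]
    have h3 : (p.eval σ • Q).natDegree = Q.natDegree := natDegree_smul _ hp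
    have h4 : (C b - aeval (eulerOp σ) p₁ (derivative Q)).natDegree ≤ Q.natDegree - 1 := by
      refine (natDegree_sub_le _ _).trans (max_le (by simp) ?_)
      exact (natDegree_aeval_eulerOp_le _ _ _).trans (natDegree_derivative_le _)
    rw [← h2, h3] at h4
    omega
  obtain ⟨a, ha⟩ : ∃ a, Q = C a := ⟨_, eq_C_of_natDegree_eq_zero h1⟩
  subst ha
  have := hp₁ (C a)
  rw [h] at this
  simp only [derivative_C, map_zero, add_zero, smul_C, smul_eq_mul] at this
  rw [C_injective this, mul_div_cancel_left₀ _ hp]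

-- At a simple root p(σ + D) factors as p₁(σ + D) D with p₁(σ) = p'(σ) ≠ 0, so the previous lemma
-- applies to Q' and gives Q' = 0. This is the resonant case of the main argument.
open Polynomial in
theorem natDegree_eq_zero_of_aeval_eulerOp_of_root {σ : ℂ} {p Q : ℂ[X]} (hp : p.eval σ = 0)
    (hp' : (derivative p).eval σ ≠ 0)
    (h : aeval (eulerOp σ) p Q = 0) : ∃ a, Q = C a := by
  obtain ⟨p₁, h1, hp₁⟩ := exists_aeval_eulerOp σ p
  rw [hp₁, hp, zero_smul, zero_add] at h
  have := natDegree_eq_zero_of_aeval_eulerOp (b := 0) (h1 ▸ hp') (by simpa using h)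
  rw [zero_div, C_0] at this
  exact ⟨_, eq_C_of_natDegree_eq_zero (derivative_eq_zero.1 this)⟩

/-! ### Smoothness of averages along rays -/

/-- Differentiation under the integral sign up to the boundary of D. The linear maps `L t` and the
quantification over the target spaces make the statement stable under differentiation: the
derivative is an integral of the same kind with g replaced by its derivative. -/
theorem contDiffOn_integral_comp {D : Set E3} (hconv : Convex ℝ D) (hD : UniqueDiffOn ℝ D)
    {S : ℝ → E3 →L[ℝ] E3} (hS : Continuous S) (hSD : ∀ t ∈ Icc (0 : ℝ) 1, MapsTo (S t) D D) (n : ℕ) :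
    ∀ {F F' : Type} [NormedAddCommGroup F] [NormedSpace ℝ F] [NormedAddCommGroup F']
      [NormedSpace ℝ F'] {L : ℝ → F →L[ℝ] F'}, Continuous L → ∀ {g : E3 → F}, ContDiffOn ℝ n g D →
      ContDiffOn ℝ n (fun y => ∫ t in (0 : ℝ)..1, L t (g (S t y))) D := by
  have hcont : ∀ {F F' : Type} [NormedAddCommGroup F] [NormedSpace ℝ F] [NormedAddCommGroup F']
      [NormedSpace ℝ F'] {L : ℝ → F →L[ℝ] F'}, Continuous L → ∀ {g : E3 → F}, ContinuousOn g D →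
      ContinuousOn (Function.uncurry fun (y : E3) (t : ℝ) => L t (g (S t y))) (D ×ˢ Icc 0 1) := by
    intro F F' _ _ _ _ L hL g hg
    have h1 : ContinuousOn (fun p : E3 × ℝ => g (S p.2 p.1)) (D ×ˢ Icc 0 1) := by
      refine hg.comp ?_ fun p hp => hSD p.2 hp.2 hp.1
      exact ((hS.comp continuous_snd).clm_apply continuous_fst).continuousOn
    exact (hL.comp continuous_snd).continuousOn.clm_apply h1
  have hint : ∀ {F F' : Type} [NormedAddCommGroup F] [NormedSpace ℝ F] [NormedAddCommGroup F']
      [NormedSpace ℝ F'] {L : ℝ → F →L[ℝ] F'}, Continuous L → ∀ {g : E3 → F}, ContinuousOn g D →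
      ∀ y ∈ D, IntervalIntegrable (fun t => L t (g (S t y))) volume 0 1 := by
    intro F F' _ _ _ _ L hL g hg y hy
    refine ContinuousOn.intervalIntegrable ?_
    rw [uIcc_of_le zero_le_one]
    exact (hcont hL hg).comp (f := fun t : ℝ => (y, t)) (by fun_prop) fun t ht => ⟨hy, ht⟩
  have hunif : ∀ {F F' : Type} [NormedAddCommGroup F] [NormedSpace ℝ F] [NormedAddCommGroup F']
      [NormedSpace ℝ F'] {L : ℝ → F →L[ℝ] F'}, Continuous L → ∀ {g : E3 → F}, ContinuousOn g D →
      ∀ y ∈ D, ∀ ε > 0, ∃ v ∈ 𝓝[D] y, ∀ z ∈ v, ∀ t ∈ Icc (0 : ℝ) 1,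
        ‖L t (g (S t z)) - L t (g (S t y))‖ < ε := by
    intro F F' _ _ _ _ L hL g hg y hy ε hε
    obtain ⟨v, hv, h⟩ := isCompact_Icc.mem_uniformity_of_prod (hcont hL hg) hy
      (Metric.dist_mem_uniformity hε)
    refine ⟨v, hv, fun z hz t ht => ?_⟩
    have := h z hz t ht
    rwa [Set.mem_ofPred_eq, dist_eq_norm] at this
  induction n with
  | zero =>
    intro F F' _ _ _ _ L hL g hg
    simp only [Nat.cast_zero, contDiffOn_zero] at hg ⊢
    intro y hy
    refine Metric.continuousWithinAt_iff'.2 fun ε hε => ?_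
    obtain ⟨v, hv, h⟩ := hunif hL hg y hy (ε / 2) (half_pos hε)
    filter_upwards [hv, self_mem_nhdsWithin] with z hz hzD
    rw [dist_eq_norm, ← intervalIntegral.integral_sub (hint hL hg z hzD) (hint hL hg y hy)]
    refine lt_of_le_of_lt (intervalIntegral.norm_integral_le_of_norm_le_const (C := ε / 2)
      fun t ht => (h z hz t ?_).le) (by simpa using hε)
    rw [uIoc_of_le zero_le_one] at ht
    exact Ioc_subset_Icc_self ht
  | succ n ih =>
    intro F F' _ _ _ _ L hL g hg
    have hg' : ContDiffOn ℝ n (fderivWithin ℝ g D) D := hg.fderivWithin hD (by norm_cast)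
    have hgd : DifferentiableOn ℝ g D := hg.differentiableOn (by simp)
    -- By the chain rule the derivative of `L t ∘ g ∘ S t` is T ↦ L t ∘ T ∘ S t applied to the
    -- derivative of g.
    let L' : ℝ → (E3 →L[ℝ] F) →L[ℝ] (E3 →L[ℝ] F') := fun t =>
      (ContinuousLinearMap.compL ℝ E3 F F' (L t)).comp
        ((ContinuousLinearMap.compL ℝ E3 E3 F).flip (S t))
    have hL' : Continuous L' := by
      have h1 : Continuous fun t => ContinuousLinearMap.compL ℝ E3 F F' (L t) :=
        (ContinuousLinearMap.continuous _).comp hL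
      have h2 : Continuous fun t => (ContinuousLinearMap.compL ℝ E3 E3 F).flip (S t) :=
        (ContinuousLinearMap.continuous _).comp hS
      exact h1.clm_comp h2
    push_cast
    rw [contDiffOn_succ_iff_hasFDerivWithinAt_of_uniqueDiffOn hD]
    refine ⟨by simp, fun y => ∫ t in (0 : ℝ)..1, L' t (fderivWithin ℝ g D (S t y)), ih hL' hg', ?_⟩
    intro y hy
    have hderiv : ∀ t ∈ Icc (0 : ℝ) 1, ∀ z ∈ D, HasFDerivWithinAt (fun z => L t (g (S t z)))
        (L' t (fderivWithin ℝ g D (S t z))) D z := by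
      intro t ht z hz
      have h1 := (hgd _ (hSD t ht hz)).hasFDerivWithinAt
      have h2 := h1.comp z (S t).hasFDerivWithinAt (hSD t ht)
      exact (L t).hasFDerivAt.comp_hasFDerivWithinAt z h2
    rw [hasFDerivWithinAt_iff_isLittleO, Asymptotics.isLittleO_iff]
    intro ε hε
    obtain ⟨v, hv, h⟩ := hunif hL' hg'.continuousOn y hy ε hε
    obtain ⟨δ, hδ, hball⟩ := Metric.mem_nhdsWithin_iff.1 hv
    filter_upwards [inter_mem_nhdsWithin D (Metric.ball_mem_nhds y hδ)] with z hz
    rw [ContinuousLinearMap.intervalIntegral_apply (hint hL' hg'.continuousOn y hy),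
      ← intervalIntegral.integral_sub (hint hL hg.continuousOn z hz.1) (hint hL hg.continuousOn y hy),
      ← intervalIntegral.integral_sub]
    · refine (intervalIntegral.norm_integral_le_of_norm_le_const (C := ε * ‖z - y‖) ?_).trans
        (by simp)
      intro t ht
      rw [uIoc_of_le zero_le_one] at ht
      have ht' := Ioc_subset_Icc_self ht
      -- The mean value inequality on the convex set D ∩ ball, with the derivative within ε of its
      -- value at y uniformly in t, replaces dominated convergence.
      refine Convex.norm_image_sub_le_of_norm_hasFDerivWithin_le' (s := D ∩ Metric.ball y δ)
        (f := fun z => L t (g (S t z))) (f' := fun z => L' t (fderivWithin ℝ g D (S t z)))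
        (fun x hx => (hderiv t ht' x hx.1).mono inter_subset_left)
        (fun x hx => (h x (hball ⟨hx.2, hx.1⟩) t ht').le) (hconv.inter (convex_ball _ _))
        ⟨hy, Metric.mem_ball_self hδ⟩ hz
    · exact (hint hL hg.continuousOn z hz.1).sub (hint hL hg.continuousOn y hy)
    · have := hint hL' hg'.continuousOn y hy
      exact ⟨this.1.apply_continuousLinearMap _, this.2.apply_continuousLinearMap _⟩

/-! ### Domains in the half space -/

/-- The inward coordinate `y₀`, as a continuous linear map. -/
noncomputable abbrev coord0 : E3 →L[ℝ] ℝ := EuclideanSpace.proj (0 : Fin 3)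

/-- The inward unit vector. -/
noncomputable abbrev e0 : E3 := EuclideanSpace.single (0 : Fin 3) (1 : ℝ)

/-- The part of a subset of the half space off the boundary. -/
def inn (Ω : Set E3) : Set E3 := Ω ∩ {y | 0 < y 0}

/-- `Ω` is a relatively open subset of the half space, with defining function `r`. -/
structure IsHalfDomain (Ω : Set E3) (r : E3 → ℝ) : Prop where
  exists_open : ∃ O : Set E3, IsOpen O ∧ Ω = O ∩ {y | 0 ≤ y 0}
  smooth : ContDiffOn ℝ ∞ r Ω
  pos : ∀ y ∈ Ω, 0 < y 0 → 0 < r y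
  zero : ∀ y ∈ Ω, y 0 = 0 → r y = 0
  deriv_ne : ∀ y ∈ Ω, y 0 = 0 → fderivWithin ℝ r Ω y ≠ 0

/-- The contraction `(y₀, y') ↦ (t y₀, y')`. -/
noncomputable def shrink (t : ℝ) : E3 →L[ℝ] E3 :=
  ContinuousLinearMap.id ℝ E3 - (1 - t) • coord0.smulRight e0

theorem shrink_apply (t : ℝ) (y : E3) : shrink t y = y - ((1 - t) * y 0) • e0 := by
  simp [shrink, mul_smul]

theorem shrink_apply_zero (t : ℝ) (y : E3) : shrink t y 0 = t * y 0 := by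
  rw [shrink_apply]; simp; ring

theorem shrink_eq_self {t : ℝ} {y : E3} (hy : y 0 = 0) : shrink t y = y := by
  rw [shrink_apply, hy]; simp

theorem continuous_shrink : Continuous shrink := by
  unfold shrink; fun_prop

theorem convex_half : Convex ℝ {y : E3 | 0 ≤ y 0} :=
  (convex_Ici (0 : ℝ)).linear_preimage (coord0 : E3 →ₗ[ℝ] ℝ)

theorem isOpen_halfPos : IsOpen {y : E3 | 0 < y 0} :=
  isOpen_lt continuous_const coord0.continuous

theorem tendsto_add_smul_e0 (y : E3) : Tendsto (fun t : ℝ => y + t • e0) (𝓝[>] 0) (𝓝 y) := by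
  have : Continuous fun t : ℝ => y + t • e0 := by fun_prop
  have h := this.tendsto 0
  simp only [zero_smul, add_zero] at h
  exact h.mono_left nhdsWithin_le_nhds

theorem uniqueDiffOn_half : UniqueDiffOn ℝ {y : E3 | 0 ≤ y 0} := by
  refine uniqueDiffOn_convex convex_half ⟨e0, ?_⟩
  refine interior_maximal (t := {y : E3 | 0 < y 0}) (fun y hy => ?_) isOpen_halfPos ?_
  · exact le_of_lt (show 0 < y 0 from hy)
  · show (0 : ℝ) < e0 0
    simp

namespace IsHalfDomain

variable {Ω : Set E3} {r : E3 → ℝ}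

theorem nonneg (h : IsHalfDomain Ω r) {y : E3} (hy : y ∈ Ω) : 0 ≤ y 0 := by
  obtain ⟨O, -, rfl⟩ := h.exists_open
  exact hy.2

theorem uniqueDiffOn (h : IsHalfDomain Ω r) : UniqueDiffOn ℝ Ω := by
  obtain ⟨O, hO, rfl⟩ := h.exists_open
  rw [inter_comm]
  exact uniqueDiffOn_half.inter hO

theorem isOpen_inn (h : IsHalfDomain Ω r) : IsOpen (inn Ω) := by
  obtain ⟨O, hO, rfl⟩ := h.exists_open
  have : inn (O ∩ {y | 0 ≤ y 0}) = O ∩ {y | 0 < y 0} := by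
    ext y; simp only [inn, mem_inter_iff, mem_ofPred_eq]
    exact ⟨fun hy => ⟨hy.1.1, hy.2⟩, fun hy => ⟨⟨hy.1, hy.2.le⟩, hy.2⟩⟩
  rw [this]
  exact hO.inter isOpen_halfPos

theorem mem_nhds (h : IsHalfDomain Ω r) {y : E3} (hy : y ∈ inn Ω) : Ω ∈ 𝓝 y :=
  mem_of_superset (h.isOpen_inn.mem_nhds hy) inter_subset_left

theorem r_pos (h : IsHalfDomain Ω r) {y : E3} (hy : y ∈ inn Ω) : 0 < r y := h.pos y hy.1 hy.2

theorem contDiffAt {F : Type*} [NormedAddCommGroup F] [NormedSpace ℝ F] (h : IsHalfDomain Ω r)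
    {f : E3 → F} {n : WithTop ℕ∞} (hf : ContDiffOn ℝ n f Ω) {y : E3} (hy : y ∈ inn Ω) :
    ContDiffAt ℝ n f y := hf.contDiffAt (h.mem_nhds hy)

theorem eventually_mem_inn (h : IsHalfDomain Ω r) {y : E3} (hy : y ∈ Ω) :
    ∀ᶠ t in 𝓝[>] (0 : ℝ), y + t • e0 ∈ inn Ω := by
  obtain ⟨O, hO, rfl⟩ := h.exists_open
  filter_upwards [(tendsto_add_smul_e0 y).eventually (hO.mem_nhds hy.1), self_mem_nhdsWithin]
    with t ht ht0
  have : 0 < (y + t • e0) 0 := by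
    have h1 : 0 ≤ y 0 := hy.2
    have h2 : 0 < t := ht0
    simp; linarith
  exact ⟨⟨ht, this.le⟩, this⟩

theorem tendsto_ray (h : IsHalfDomain Ω r) {y : E3} (hy : y ∈ Ω) :
    Tendsto (fun t : ℝ => y + t • e0) (𝓝[>] 0) (𝓝[inn Ω] y) :=
  tendsto_nhdsWithin_iff.2 ⟨tendsto_add_smul_e0 y, h.eventually_mem_inn hy⟩

theorem neBot (h : IsHalfDomain Ω r) {y : E3} (hy : y ∈ Ω) : (𝓝[inn Ω] y).NeBot :=
  (h.tendsto_ray hy).neBot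

/-- Continuous functions on `Ω` agreeing in the interior agree. -/
theorem eqOn_of_eqOn_inn {F : Type*} [TopologicalSpace F] [T2Space F] (h : IsHalfDomain Ω r)
    {y : E3} (hy : y ∈ Ω) {f g : E3 → F} (hf : ContinuousWithinAt f Ω y)
    (hg : ContinuousWithinAt g Ω y) (hfg : f =ᶠ[𝓝[inn Ω] y] g) : f y = g y := by
  have := h.neBot hy
  have hf' : Tendsto f (𝓝[inn Ω] y) (𝓝 (f y)) := hf.mono inter_subset_left
  have hg' : Tendsto g (𝓝[inn Ω] y) (𝓝 (g y)) := hg.mono inter_subset_left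
  exact tendsto_nhds_unique (hf'.congr' hfg) hg'

end IsHalfDomain

/-- Hadamard's lemma near a boundary point. -/
theorem IsHalfDomain.exists_eq_coord0_smul {Ω : Set E3} {r : E3 → ℝ} (h : IsHalfDomain Ω r)
    {F : Type} [NormedAddCommGroup F] [NormedSpace ℝ F] [CompleteSpace F] {f : E3 → F}
    (hf : ContDiffOn ℝ ∞ f Ω) (hf0 : ∀ y ∈ Ω, y 0 = 0 → f y = 0) {y : E3} (hy : y ∈ Ω)
    (hy0 : y 0 = 0) : ∃ U : Set E3, IsOpen U ∧ y ∈ U ∧ ∃ f' : E3 → F,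
      ContDiffOn ℝ ∞ f' (Ω ∩ U) ∧ ∀ z ∈ Ω ∩ U, f z = z 0 • f' z := by
  obtain ⟨O, hO, rfl⟩ := h.exists_open
  obtain ⟨δ, hδ, hball⟩ := Metric.isOpen_iff.1 hO y hy.1
  set D : Set E3 := {z | 0 ≤ z 0} ∩ Metric.ball y δ with hDdef
  have hDΩ : O ∩ {z | 0 ≤ z 0} ∩ Metric.ball y δ = D := by
    ext z; simp only [hDdef, mem_inter_iff, mem_ofPred_eq]
    exact ⟨fun hz => ⟨hz.1.2, hz.2⟩, fun hz => ⟨⟨hball hz.2, hz.1⟩, hz.2⟩⟩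
  have hconv : Convex ℝ D := convex_half.inter (convex_ball _ _)
  have hD : UniqueDiffOn ℝ D := uniqueDiffOn_half.inter Metric.isOpen_ball
  have hSD : ∀ t ∈ Icc (0 : ℝ) 1, MapsTo (shrink t) D D := by
    intro t ht z hz
    refine ⟨?_, ?_⟩
    · rw [mem_ofPred_eq, shrink_apply_zero]; exact mul_nonneg ht.1 hz.1
    -- The ball is preserved because its centre lies on the boundary plane: projection to that plane
    -- fixes the centre and does not increase norms, and `shrink t z` lies between the projection
    -- and z.
    · have h1 : shrink t z ∈ segment ℝ (shrink 0 z) z := by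
        refine ⟨1 - t, t, by linarith [ht.2], ht.1, by ring, ?_⟩
        simp only [shrink_apply]
        module
      refine (convex_ball y δ).segment_subset ?_ hz.2 h1
      have h2 : shrink 0 y = y := shrink_eq_self hy0
      rw [Metric.mem_ball, dist_eq_norm]
      conv_lhs => rw [← h2, ← map_sub]
      refine lt_of_le_of_lt ?_ (mem_ball_iff_norm.1 hz.2)
      rw [EuclideanSpace.norm_eq, EuclideanSpace.norm_eq]
      refine Real.sqrt_le_sqrt (Finset.sum_le_sum fun i _ => ?_)
      by_cases hi : i = 0
      · subst hi; rw [shrink_apply_zero]; simp; positivity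
      · rw [shrink_apply]; simp [hi]
  have hfD : ContDiffOn ℝ ∞ f D := hf.mono (by rw [← hDΩ]; exact inter_subset_left)
  -- The quotient is ∫₀¹ ∂₀f(t y₀, y') dt, by the fundamental theorem of calculus along the
  -- contraction.
  refine ⟨Metric.ball y δ, Metric.isOpen_ball, Metric.mem_ball_self hδ,
    fun z => ∫ t in (0 : ℝ)..1, fderivWithin ℝ f D (shrink t z) e0, ?_, ?_⟩
  · rw [hDΩ, contDiffOn_infty]
    intro n
    exact contDiffOn_integral_comp hconv hD continuous_shrink hSD n
      (L := fun _ => ContinuousLinearMap.apply ℝ F e0) continuous_const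
      (hfD.fderivWithin hD (m := n) (by exact_mod_cast le_top))
  · rw [hDΩ]
    intro z hz
    have hderiv : ∀ t ∈ Icc (0 : ℝ) 1, HasDerivWithinAt (fun t => f (shrink t z))
        (z 0 • fderivWithin ℝ f D (shrink t z) e0) (Icc 0 1) t := by
      intro t ht
      have h1 := ((hfD.differentiableOn (by simp)) _ (hSD t ht hz)).hasFDerivWithinAt
      have h2 : HasDerivWithinAt (fun t => shrink t z) (z 0 • e0) (Icc 0 1) t := by
        have : (fun t => shrink t z) = fun t => (z - z 0 • e0) + t • (z 0 • e0) := by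
          funext t; rw [shrink_apply]; module
        rw [this]
        simpa using ((hasDerivAt_id t).smul_const (z 0 • e0)).hasDerivWithinAt.const_add (z - z 0 • e0)
      have h3 := h1.comp_hasDerivWithinAt t h2 (fun s hs => hSD s hs hz)
      rwa [map_smul] at h3
    have hcont : ContinuousOn (fun t => fderivWithin ℝ f D (shrink t z) e0) (Icc 0 1) := by
      have h1 : ContinuousOn (fderivWithin ℝ f D) D := hfD.continuousOn_fderivWithin hD (by simp)
      refine (h1.comp (f := fun t : ℝ => shrink t z) ?_ fun t ht => hSD t ht hz).clm_apply
        continuousOn_const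
      exact (continuous_shrink.clm_apply continuous_const).continuousOn
    have := intervalIntegral.integral_eq_sub_of_hasDerivAt_of_le zero_le_one
      (fun t ht => (hderiv t ht).continuousWithinAt)
      (fun t ht => (hderiv t (Ioo_subset_Icc_self ht)).hasDerivAt (Icc_mem_nhds ht.1 ht.2))
      (ContinuousOn.intervalIntegrable (by
        rw [uIcc_of_le zero_le_one]; exact continuousOn_const.smul hcont))
    rw [intervalIntegral.integral_smul] at this
    have h0 : f (shrink 0 z) = 0 := by
      have hm := hSD 0 (by simp) hz
      refine hf0 _ ?_ (by rw [shrink_apply_zero, zero_mul])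
      rw [← hDΩ] at hm; exact hm.1
    have h1 : shrink 1 z = z := by rw [shrink_apply]; simp
    rw [h0, h1, sub_zero] at this
    exact this.symm

/-- Near a boundary point, a defining function is a nonvanishing multiple of `y₀`. -/
theorem IsHalfDomain.exists_eq_smul_local {Ω : Set E3} {r : E3 → ℝ} (h : IsHalfDomain Ω r)
    {F : Type} [NormedAddCommGroup F] [NormedSpace ℝ F] [CompleteSpace F] {f : E3 → F}
    (hf : ContDiffOn ℝ ∞ f Ω) (hf0 : ∀ y ∈ Ω, y 0 = 0 → f y = 0) {y : E3} (hy : y ∈ Ω) :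
    ∃ U : Set E3, IsOpen U ∧ y ∈ U ∧ ∃ f' : E3 → F,
      ContDiffOn ℝ ∞ f' (Ω ∩ U) ∧ ∀ z ∈ Ω ∩ U, f z = r z • f' z := by
  rcases (h.nonneg hy).eq_or_lt with hy0 | hy0
  swap
  · have hsub : Ω ∩ inn Ω ⊆ Ω := inter_subset_left
    refine ⟨inn Ω, h.isOpen_inn, ⟨hy, hy0⟩, fun z => (r z)⁻¹ • f z, ?_, ?_⟩
    · exact ((h.smooth.mono hsub).inv fun z hz => (h.r_pos hz.2).ne').smul (hf.mono hsub)
    · intro z hz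
      rw [smul_smul, mul_inv_cancel₀ (h.r_pos hz.2).ne', one_smul]
  obtain ⟨U, hU, hyU, f₁, hf₁, hf₁e⟩ := h.exists_eq_coord0_smul hf hf0 hy hy0.symm
  obtain ⟨V, hV, hyV, R, hR, hRe⟩ := h.exists_eq_coord0_smul h.smooth h.zero hy hy0.symm
  -- Where y₀ = 0 the derivative of r = y₀ R is R(y) dy₀, so R(y) = 0 would contradict dr ≠ 0.
  have hRy : R y ≠ 0 := by
    intro hR0
    refine h.deriv_ne y hy hy0.symm ?_
    have h1 : HasFDerivWithinAt r (0 : E3 →L[ℝ] ℝ) (Ω ∩ V) y := by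
      have hRd : HasFDerivWithinAt R (fderivWithin ℝ R (Ω ∩ V) y) (Ω ∩ V) y :=
        (hR.differentiableOn (by simp) y ⟨hy, hyV⟩).hasFDerivWithinAt
      have := (coord0.hasFDerivWithinAt (s := Ω ∩ V) (x := y)).mul hRd
      have h2 : HasFDerivWithinAt (fun z => coord0 z * R z) (0 : E3 →L[ℝ] ℝ) (Ω ∩ V) y := by
        rwa [hR0, show coord0 y = 0 from hy0.symm, zero_smul, zero_smul, add_zero] at this
      exact h2.congr (fun z hz => hRe z hz) (hRe y ⟨hy, hyV⟩)
    have h2 : HasFDerivWithinAt r (0 : E3 →L[ℝ] ℝ) Ω y :=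
      (hasFDerivWithinAt_inter (hV.mem_nhds hyV)).1 h1
    exact h2.fderivWithin (h.uniqueDiffOn y hy)
  obtain ⟨W, hW, hWe⟩ : ∃ W : Set E3, IsOpen W ∧ y ∈ W ∧ ∀ z ∈ Ω ∩ V ∩ W, R z ≠ 0 := by
    have hc : ContinuousWithinAt R (Ω ∩ V) y := hR.continuousOn y ⟨hy, hyV⟩
    have := hc.eventually_ne hRy
    obtain ⟨W, hW, hyW, hWs⟩ := mem_nhdsWithin.1 this
    exact ⟨W, hW, hyW, fun z hz => hWs ⟨hz.2, hz.1⟩⟩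
  refine ⟨U ∩ V ∩ W, (hU.inter hV).inter hW, ⟨⟨hyU, hyV⟩, hWe.1⟩, fun z => (R z)⁻¹ • f₁ z, ?_, ?_⟩
  · refine ContDiffOn.smul ((hR.mono ?_).inv ?_) (hf₁.mono ?_)
    · exact fun z hz => ⟨hz.1, hz.2.1.2⟩
    · exact fun z hz => hWe.2 z ⟨⟨hz.1, hz.2.1.2⟩, hz.2.2⟩
    · exact fun z hz => ⟨hz.1, hz.2.1.1⟩
  · intro z hz
    have hRz := hWe.2 z ⟨⟨hz.1, hz.2.1.2⟩, hz.2.2⟩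
    rw [hf₁e z ⟨hz.1, hz.2.1.1⟩, hRe z ⟨hz.1, hz.2.1.2⟩, smul_smul, smul_eq_mul, mul_assoc, mul_inv_cancel₀ hRz,
      mul_one]

/-- Smooth functions vanishing on the boundary are smooth multiples of the defining function. -/
theorem IsHalfDomain.exists_eq_smul {Ω : Set E3} {r : E3 → ℝ} (h : IsHalfDomain Ω r)
    {F : Type} [NormedAddCommGroup F] [NormedSpace ℝ F] [CompleteSpace F] {f : E3 → F}
    (hf : ContDiffOn ℝ ∞ f Ω) (hf0 : ∀ y ∈ Ω, y 0 = 0 → f y = 0) :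
    ∃ f' : E3 → F, ContDiffOn ℝ ∞ f' Ω ∧ ∀ z ∈ Ω, f z = r z • f' z := by
  choose! U hU hyU f' hf' hf'e using fun y (hy : y ∈ Ω) => h.exists_eq_smul_local hf hf0 hy
  -- Off the boundary r > 0 determines the quotient, and by continuity the local quotients also
  -- agree on the boundary. They therefore glue without a partition of unity.
  have key : ∀ y ∈ Ω, ∀ z ∈ Ω ∩ U y, f' z z = f' y z := by
    intro y hy z hz
    refine h.eqOn_of_eqOn_inn hz.1 (f := f' z) (g := f' y) ?_ ?_ ?_
    · have := (hf' z hz.1).continuousOn z ⟨hz.1, hyU z hz.1⟩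
      exact (continuousWithinAt_inter ((hU z hz.1).mem_nhds (hyU z hz.1))).1 this
    · have := (hf' y hy).continuousOn z hz
      exact (continuousWithinAt_inter ((hU y hy).mem_nhds hz.2)).1 this
    · filter_upwards [self_mem_nhdsWithin, mem_nhdsWithin_of_mem_nhds ((hU y hy).mem_nhds hz.2),
        mem_nhdsWithin_of_mem_nhds ((hU z hz.1).mem_nhds (hyU z hz.1))] with w hw hwy hwz
      have e := (hf'e z hz.1 w ⟨hw.1, hwz⟩).symm.trans (hf'e y hy w ⟨hw.1, hwy⟩)
      exact smul_right_injective F (h.r_pos hw).ne' e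
  refine ⟨fun z => f' z z, fun y hy => ?_, fun z hz => hf'e z hz z ⟨hz, hyU z hz⟩⟩
  have h1 : ContDiffOn ℝ ∞ (fun z => f' z z) (Ω ∩ U y) := (hf' y hy).congr (key y hy)
  exact (contDiffWithinAt_inter ((hU y hy).mem_nhds (hyU y hy))).1 (h1 y ⟨hy, hyU y hy⟩)

/-! ### Functions with a pole along the boundary -/

section Laurent

variable {F : Type} [NormedAddCommGroup F] [NormedSpace ℝ F] {G : Type} [NormedAddCommGroup G]
  [NormedSpace ℝ G] {Ω : Set E3} {r : E3 → ℝ}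

/-- `r ^ N • f` extends smoothly to the boundary. -/
def IsLaurent (Ω : Set E3) (r : E3 → ℝ) (N : ℕ) (f : E3 → F) : Prop :=
  ∃ h : E3 → F, ContDiffOn ℝ ∞ h Ω ∧ ∀ y ∈ inn Ω, h y = r y ^ N • f y

theorem isLaurent_of_contDiffOn {f : E3 → F} (hf : ContDiffOn ℝ ∞ f Ω) : IsLaurent Ω r 0 f :=
  ⟨f, hf, fun y _ => by simp⟩

namespace IsLaurent

theorem congr {N : ℕ} {f g : E3 → F} (hf : IsLaurent Ω r N f) (h : ∀ y ∈ inn Ω, g y = f y) :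
    IsLaurent Ω r N g := by
  obtain ⟨k, hk, hke⟩ := hf
  exact ⟨k, hk, fun y hy => by rw [hke y hy, h y hy]⟩

theorem mono (hr : IsHalfDomain Ω r) {N N' : ℕ} {f : E3 → F} (hf : IsLaurent Ω r N f)
    (h : N ≤ N') : IsLaurent Ω r N' f := by
  obtain ⟨k, hk, hke⟩ := hf
  refine ⟨fun y => r y ^ (N' - N) • k y, (hr.smooth.pow _).smul hk, fun y hy => ?_⟩
  simp only [hke y hy, smul_smul, ← pow_add, Nat.sub_add_cancel h]

theorem add {N : ℕ} {f g : E3 → F} (hf : IsLaurent Ω r N f) (hg : IsLaurent Ω r N g) :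
    IsLaurent Ω r N (fun y => f y + g y) := by
  obtain ⟨k, hk, hke⟩ := hf
  obtain ⟨l, hl, hle⟩ := hg
  exact ⟨fun y => k y + l y, hk.add hl, fun y hy => by simp only [hke y hy, hle y hy, smul_add]⟩

theorem smul {N N' : ℕ} {a : E3 → ℝ} {f : E3 → F} (ha : IsLaurent Ω r N a)
    (hf : IsLaurent Ω r N' f) : IsLaurent Ω r (N + N') (fun y => a y • f y) := by
  obtain ⟨k, hk, hke⟩ := ha
  obtain ⟨l, hl, hle⟩ := hf
  refine ⟨fun y => k y • l y, hk.smul hl, fun y hy => ?_⟩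
  simp only [hke y hy, hle y hy, smul_eq_mul]
  module

theorem clm (L : F →L[ℝ] G) {N : ℕ} {f : E3 → F} (hf : IsLaurent Ω r N f) :
    IsLaurent Ω r N (fun y => L (f y)) := by
  obtain ⟨k, hk, hke⟩ := hf
  refine ⟨fun y => L (k y), L.contDiff.comp_contDiffOn hk, fun y hy => ?_⟩
  simp only [hke y hy, map_smul]

theorem contDiffOn (hr : IsHalfDomain Ω r) {N : ℕ} {f : E3 → F} (hf : IsLaurent Ω r N f) :
    ContDiffOn ℝ ∞ f (inn Ω) := by
  obtain ⟨k, hk, hke⟩ := hf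
  have hsub : inn Ω ⊆ Ω := inter_subset_left
  have h1 : ContDiffOn ℝ ∞ (fun y => (r y ^ N)⁻¹ • k y) (inn Ω) :=
    (((hr.smooth.mono hsub).pow N).inv fun y hy => (pow_pos (hr.r_pos hy) _).ne').smul (hk.mono hsub)
  refine h1.congr fun y hy => ?_
  rw [hke y hy, smul_smul, inv_mul_cancel₀ (pow_pos (hr.r_pos hy) _).ne', one_smul]

/-- With k = r^N f one has r^{N+1} df = r dk - N k dr, and the right-hand side is smooth up to the
boundary. -/
theorem fderiv (hr : IsHalfDomain Ω r) {N : ℕ} {f : E3 → F} (hf : IsLaurent Ω r N f) :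
    IsLaurent Ω r (N + 1) (fderiv ℝ f) := by
  have hfd : ∀ y ∈ inn Ω, DifferentiableAt ℝ f y := fun y hy =>
    ((hf.contDiffOn hr).contDiffAt (hr.isOpen_inn.mem_nhds hy)).differentiableAt (by simp)
  obtain ⟨k, hk, hke⟩ := hf
  refine ⟨fun y => r y • fderivWithin ℝ k Ω y - (N : ℝ) • (fderivWithin ℝ r Ω y).smulRight (k y),
    ?_, fun y hy => ?_⟩
  · have h1 := hk.fderivWithin hr.uniqueDiffOn (m := ∞) (by simp)
    have h2 := hr.smooth.fderivWithin hr.uniqueDiffOn (m := ∞) (by simp)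
    exact (hr.smooth.smul h1).sub ((h2.smulRight hk).const_smul _)
  · have hkd : HasFDerivAt k (r y ^ N • _root_.fderiv ℝ f y +
        (N * r y ^ (N - 1)) • (_root_.fderiv ℝ r y).smulRight (f y)) y := by
      have hrd : HasFDerivAt r (_root_.fderiv ℝ r y) y :=
        ((hr.contDiffAt hr.smooth hy).differentiableAt (by simp)).hasFDerivAt
      have h1 := (hrd.pow N).smul (hfd y hy).hasFDerivAt
      have h2 : HasFDerivAt (fun z => r z ^ N • f z) (r y ^ N • _root_.fderiv ℝ f y +
        (N * r y ^ (N - 1)) • (_root_.fderiv ℝ r y).smulRight (f y)) y := by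
        refine HasFDerivAt.congr_fderiv (f := fun z => r z ^ N • f z) h1 ?_
        ext v
        simp [mul_smul]
      refine h2.congr_of_eventuallyEq ?_
      filter_upwards [hr.isOpen_inn.mem_nhds hy] with z hz using hke z hz
    beta_reduce
    rw [fderivWithin_of_mem_nhds (hr.mem_nhds hy), fderivWithin_of_mem_nhds (hr.mem_nhds hy),
      hkd.fderiv, hke y hy]
    ext v
    rcases N with _ | N
    · simp
    · simp only [Nat.add_sub_cancel, sub_apply, smul_apply, add_apply,
        ContinuousLinearMap.smulRight_apply]
      module

/-- A function with at most a pole that has limits at the boundary extends smoothly. -/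
theorem exists_extension [CompleteSpace F] (hr : IsHalfDomain Ω r) : ∀ {N : ℕ} {f : E3 → F},
    IsLaurent Ω r N f → (∀ y ∈ Ω, y 0 = 0 → ∃ l, Tendsto f (𝓝[inn Ω] y) (𝓝 l)) →
    ∃ h : E3 → F, ContDiffOn ℝ ∞ h Ω ∧ ∀ y ∈ inn Ω, h y = f y := by
  intro N
  induction N with
  | zero =>
    rintro f ⟨k, hk, hke⟩ -
    exact ⟨k, hk, fun y hy => by simpa using hke y hy⟩
  | succ N ih =>
    rintro f ⟨k, hk, hke⟩ hlim
    -- Since f has a limit, k = r^{N+1} f tends to 0 at the boundary. Hence k is divisible by r and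
    -- the order of the pole drops.
    have hk0 : ∀ y ∈ Ω, y 0 = 0 → k y = 0 := by
      intro y hy hy0
      obtain ⟨l, hl⟩ := hlim y hy hy0
      have := hr.neBot hy
      have h1 : Tendsto k (𝓝[inn Ω] y) (𝓝 (k y)) := (hk.continuousOn y hy).mono inter_subset_left
      have h2 : Tendsto r (𝓝[inn Ω] y) (𝓝 (r y)) :=
        (hr.smooth.continuousOn y hy).mono inter_subset_left
      rw [hr.zero y hy hy0] at h2
      have h3 := ((h2.pow (N + 1)).smul hl)
      rw [zero_pow (by simp), zero_smul] at h3
      refine tendsto_nhds_unique h1 (h3.congr' ?_)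
      filter_upwards [self_mem_nhdsWithin] with z hz using (hke z hz).symm
    obtain ⟨k', hk', hke'⟩ := hr.exists_eq_smul hk hk0
    refine ih ⟨k', hk', fun y hy => ?_⟩ hlim
    have h1 := hke y hy
    rw [hke' y hy.1, pow_succ', mul_smul] at h1
    exact smul_right_injective F (hr.r_pos hy).ne' h1

end IsLaurent

end Laurent

/-! ### Products of powers and logarithms -/

section PowLog

open Polynomial

variable {Ω : Set E3} {r : E3 → ℝ}

/-- The function `r^s Q(log r)`. -/
noncomputable def plog (r : E3 → ℝ) (s : ℂ) (Q : ℂ[X]) (y : E3) : ℂ :=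
  (r y : ℂ) ^ s * Q.eval ((Real.log (r y) : ℝ) : ℂ)

theorem plog_eq_exp {s : ℂ} {Q : ℂ[X]} {y : E3} (hy : 0 < r y) : plog r s Q y =
    Complex.exp (((Real.log (r y) : ℝ) : ℂ) * s) * Q.eval ((Real.log (r y) : ℝ) : ℂ) := by
  rw [plog, Complex.cpow_def_of_ne_zero (by exact_mod_cast hy.ne'), ← Complex.ofReal_log hy.le]

theorem hasDerivAt_powLog (s : ℂ) (Q : ℂ[X]) {x : ℝ} (hx : 0 < x) :
    HasDerivAt (fun x : ℝ => Complex.exp (((Real.log x : ℝ) : ℂ) * s) *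
      Q.eval ((Real.log x : ℝ) : ℂ)) ((x⁻¹ : ℝ) • (Complex.exp (((Real.log x : ℝ) : ℂ) * s) *
        (eulerOp s Q).eval ((Real.log x : ℝ) : ℂ))) x := by
  have h1 : HasDerivAt (fun x : ℝ => ((Real.log x : ℝ) : ℂ)) ((x⁻¹ : ℝ) : ℂ) x :=
    (Real.hasDerivAt_log hx.ne').ofReal_comp
  have h2 := (h1.mul_const s).cexp
  have h3 := (Q.hasDerivAt ((Real.log x : ℝ) : ℂ)).comp x h1
  refine HasDerivAt.congr_deriv (h2.mul h3) ?_
  rw [eulerOp_apply]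
  simp only [eval_add, eval_smul, smul_eq_mul, Complex.real_smul]
  ring

theorem hasFDerivAt_plog (hr : IsHalfDomain Ω r) (s : ℂ) (Q : ℂ[X]) {y : E3} (hy : y ∈ inn Ω) :
    HasFDerivAt (plog r s Q) ((fderiv ℝ r y).smulRight ((r y)⁻¹ • plog r s (eulerOp s Q) y)) y := by
  have hrd : HasFDerivAt r (fderiv ℝ r y) y :=
    ((hr.contDiffAt hr.smooth hy).differentiableAt (by simp)).hasFDerivAt
  have h1 := (hasDerivAt_powLog s Q (hr.r_pos hy)).hasFDerivAt.comp y hrd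
  have h2 : HasFDerivAt ((fun x : ℝ => Complex.exp (((Real.log x : ℝ) : ℂ) * s) *
      Q.eval ((Real.log x : ℝ) : ℂ)) ∘ r)
      ((fderiv ℝ r y).smulRight ((r y)⁻¹ • plog r s (eulerOp s Q) y)) y := by
    refine h1.congr_fderiv (ContinuousLinearMap.ext fun v => ?_)
    rw [plog_eq_exp (hr.r_pos hy)]
    simp
  refine h2.congr_of_eventuallyEq ?_
  filter_upwards [hr.isOpen_inn.mem_nhds hy] with z hz using plog_eq_exp (hr.r_pos hz)

theorem contDiffOn_plog (hr : IsHalfDomain Ω r) (s : ℂ) (Q : ℂ[X]) :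
    ContDiffOn ℝ ∞ (plog r s Q) (inn Ω) := by
  have hsub : inn Ω ⊆ Ω := inter_subset_left
  have h1 : ContDiffOn ℝ ∞ (fun y => ((Real.log (r y) : ℝ) : ℂ)) (inn Ω) :=
    Complex.ofRealCLM.contDiff.comp_contDiffOn
      ((hr.smooth.mono hsub).log fun y hy => (hr.r_pos hy).ne')
  have h2 : ContDiff ℝ ∞ (fun z : ℂ => Q.eval z) := by
    have : ContDiff ℂ ∞ (fun z : ℂ => aeval z Q) := Q.contDiff_aeval ∞
    simpa using this.restrict_scalars ℝ
  have h3 : ContDiffOn ℝ ∞ (fun y => ((Real.log (r y) : ℝ) : ℂ) * s) (inn Ω) :=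
    h1.mul contDiffOn_const
  have h4 := ((Complex.contDiff_exp (𝕜 := ℂ) (n := ∞)).restrict_scalars ℝ).comp_contDiffOn h3
  refine (h4.mul (h2.comp_contDiffOn h1)).congr fun y hy => ?_
  exact plog_eq_exp (hr.r_pos hy)


variable {F : Type} [NormedAddCommGroup F] [NormedSpace ℝ F] [NormedSpace ℂ F] [IsScalarTower ℝ ℂ F]
  {G : Type} [NormedAddCommGroup G] [NormedSpace ℝ G] [NormedSpace ℂ G] [IsScalarTower ℝ ℂ G]

theorem fderiv_plog_smul (hr : IsHalfDomain Ω r) (s : ℂ) (Q : ℂ[X]) {f : E3 → F} {y : E3}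
    (hy : y ∈ inn Ω) (hf : DifferentiableAt ℝ f y) :
    fderiv ℝ (fun z => plog r s Q z • f z) y = plog r s Q y • fderiv ℝ f y +
      plog r s (eulerOp s Q) y • ((r y)⁻¹ • (fderiv ℝ r y).smulRight (f y)) := by
  have h : HasFDerivAt (fun z => plog r s Q z • f z) _ y :=
    (hasFDerivAt_plog hr s Q hy).smul hf.hasFDerivAt
  rw [h.fderiv]
  ext v
  simp only [add_apply, smul_apply, ContinuousLinearMap.smulRight_apply]
  congr 1
  rw [smul_assoc, smul_assoc, smul_comm (plog r s (eulerOp s Q) y) (r y)⁻¹ (fderiv ℝ r y v • f y),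
    smul_comm (plog r s (eulerOp s Q) y) (fderiv ℝ r y v), smul_comm (r y)⁻¹ (fderiv ℝ r y v),
    smul_comm (r y)⁻¹]

/-- Families of the form `(s, Q) ↦ r^s ∑ ((s + D)^j Q)(log r) g_j`, the `g_j` having poles. -/
def IsLogFamily (Ω : Set E3) (r : E3 → ℝ) (J : ℕ) (Φ : ℂ → ℂ[X] → E3 → F) : Prop :=
  ∃ g : ℕ → E3 → F, (∀ j, ∃ N, IsLaurent Ω r N (g j)) ∧ ∀ s Q, ∀ y ∈ inn Ω,
    Φ s Q y = ∑ j ∈ Finset.range J, plog r s ((eulerOp s ^ j) Q) y • g j y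

theorem isLogFamily_smul {f : E3 → F} (hf : ContDiffOn ℝ ∞ f Ω) :
    IsLogFamily Ω r 1 (fun s Q y => plog r s Q y • f y) :=
  ⟨fun _ => f, fun _ => ⟨0, isLaurent_of_contDiffOn hf⟩, fun s Q y _ => by simp⟩

namespace IsLogFamily

theorem congr {J : ℕ} {Φ Ψ : ℂ → ℂ[X] → E3 → F} (hΦ : IsLogFamily Ω r J Φ)
    (h : ∀ s Q, ∀ y ∈ inn Ω, Ψ s Q y = Φ s Q y) : IsLogFamily Ω r J Ψ := by
  obtain ⟨g, hg, he⟩ := hΦ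
  exact ⟨g, hg, fun s Q y hy => by rw [h s Q y hy, he s Q y hy]⟩

theorem mono {J J' : ℕ} {Φ : ℂ → ℂ[X] → E3 → F} (hΦ : IsLogFamily Ω r J Φ) (h : J ≤ J') :
    IsLogFamily Ω r J' Φ := by
  obtain ⟨g, hg, he⟩ := hΦ
  refine ⟨fun j => if j < J then g j else 0, fun j => ?_, fun s Q y hy => ?_⟩
  · beta_reduce
    split_ifs
    · exact hg j
    · exact ⟨0, isLaurent_of_contDiffOn contDiffOn_const⟩
  · rw [he s Q y hy, ← Finset.sum_subset (Finset.range_subset_range.2 h)]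
    · refine Finset.sum_congr rfl fun j hj => ?_
      simp only [if_pos (Finset.mem_range.1 hj)]
    · intro j _ hj
      simp only [if_neg (show ¬ j < J by simpa using hj), Pi.zero_apply, smul_zero]

theorem add (hr : IsHalfDomain Ω r) {J : ℕ} {Φ Ψ : ℂ → ℂ[X] → E3 → F} (hΦ : IsLogFamily Ω r J Φ)
    (hΨ : IsLogFamily Ω r J Ψ) : IsLogFamily Ω r J (fun s Q y => Φ s Q y + Ψ s Q y) := by
  obtain ⟨g, hg, he⟩ := hΦ
  obtain ⟨k, hk, hke⟩ := hΨ
  refine ⟨fun j y => g j y + k j y, fun j => ?_, fun s Q y hy => ?_⟩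
  · obtain ⟨N, hN⟩ := hg j
    obtain ⟨N', hN'⟩ := hk j
    exact ⟨max N N', (hN.mono hr (le_max_left _ _)).add (hN'.mono hr (le_max_right _ _))⟩
  · beta_reduce
    rw [he s Q y hy, hke s Q y hy, ← Finset.sum_add_distrib]
    simp only [smul_add]

theorem sum (hr : IsHalfDomain Ω r) {ι : Type*} {J : ℕ} {t : Finset ι}
    {Φ : ι → ℂ → ℂ[X] → E3 → F} (hΦ : ∀ i ∈ t, IsLogFamily Ω r J (Φ i)) :
    IsLogFamily Ω r J (fun s Q y => ∑ i ∈ t, Φ i s Q y) := by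
  classical
  induction t using Finset.induction_on with
  | empty =>
    exact ⟨fun _ => 0, fun _ => ⟨0, isLaurent_of_contDiffOn contDiffOn_const⟩, fun s Q y _ => by simp⟩
  | insert i s hi ih =>
    refine ((hΦ i (by simp)).add hr (ih fun j hj => hΦ j (by simp [hj]))).congr fun s Q y _ => ?_
    rw [Finset.sum_insert hi]

theorem smul {J N : ℕ} {Φ : ℂ → ℂ[X] → E3 → F} {a : E3 → ℝ} (ha : IsLaurent Ω r N a)
    (hΦ : IsLogFamily Ω r J Φ) : IsLogFamily Ω r J (fun s Q y => a y • Φ s Q y) := by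
  obtain ⟨g, hg, he⟩ := hΦ
  refine ⟨fun j y => a y • g j y, fun j => ?_, fun s Q y hy => ?_⟩
  · obtain ⟨N', hN'⟩ := hg j
    exact ⟨_, ha.smul hN'⟩
  · beta_reduce
    rw [he s Q y hy, Finset.smul_sum]
    exact Finset.sum_congr rfl fun j _ => smul_comm _ _ _

theorem clm {J : ℕ} {Φ : ℂ → ℂ[X] → E3 → F} (L : F →L[ℝ] G)
    (hL : ∀ (c : ℂ) (x : F), L (c • x) = c • L x)
    (hΦ : IsLogFamily Ω r J Φ) : IsLogFamily Ω r J (fun s Q y => L (Φ s Q y)) := by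
  obtain ⟨g, hg, he⟩ := hΦ
  refine ⟨fun j y => L (g j y), fun j => ?_, fun s Q y hy => ?_⟩
  · obtain ⟨N', hN'⟩ := hg j
    exact ⟨_, hN'.clm L⟩
  · beta_reduce
    rw [he s Q y hy, map_sum]
    exact Finset.sum_congr rfl fun j _ => hL _ _

theorem contDiffOn (hr : IsHalfDomain Ω r) {J : ℕ} {Φ : ℂ → ℂ[X] → E3 → F}
    (hΦ : IsLogFamily Ω r J Φ) (s : ℂ) (Q : ℂ[X]) : ContDiffOn ℝ ∞ (Φ s Q) (inn Ω) := by
  obtain ⟨g, hg, he⟩ := hΦ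
  refine ContDiffOn.congr (ContDiffOn.sum fun j _ => ?_) (he s Q)
  exact (contDiffOn_plog hr s _).smul ((hg j).choose_spec.contDiffOn hr)

/-- The derivative falls either on g_j, or on the power-logarithm factor, where it applies one more
s + D to Q and produces the factor r^{-1} dr. This costs one more term and one more order of the
pole, while the coefficients stay independent of s and Q. -/
theorem fderiv (hr : IsHalfDomain Ω r) {J : ℕ} {Φ : ℂ → ℂ[X] → E3 → F}
    (hΦ : IsLogFamily Ω r J Φ) : IsLogFamily Ω r (J + 1) (fun s Q => fderiv ℝ (Φ s Q)) := by
  obtain ⟨g, hg, he⟩ := hΦ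
  have hgd : ∀ j, ∀ y ∈ inn Ω, DifferentiableAt ℝ (g j) y := fun j y hy =>
    (((hg j).choose_spec.contDiffOn hr).contDiffAt (hr.isOpen_inn.mem_nhds hy)).differentiableAt
      (by simp)
  have h1 : IsLogFamily Ω r J (fun s Q y => ∑ j ∈ Finset.range J,
      plog r s ((eulerOp s ^ j) Q) y • _root_.fderiv ℝ (g j) y) :=
    ⟨fun j => _root_.fderiv ℝ (g j), fun j => ⟨_, (hg j).choose_spec.fderiv hr⟩, fun s Q y _ => rfl⟩
  have h2 : IsLogFamily Ω r (J + 1) (fun s Q y => ∑ j ∈ Finset.range J,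
      plog r s ((eulerOp s ^ (j + 1)) Q) y •
        ((r y)⁻¹ • (_root_.fderiv ℝ r y).smulRight (g j y))) := by
    -- The extra factor s + D shifts the index by one, so the coefficient at index 0 is zero.
    refine ⟨fun j => if j = 0 then 0 else fun y =>
      ((r y)⁻¹ • (_root_.fderiv ℝ r y).smulRight (g (j - 1) y)), fun j => ?_, fun s Q y _ => ?_⟩
    · beta_reduce
      split_ifs
      · exact ⟨0, isLaurent_of_contDiffOn contDiffOn_const⟩
      · obtain ⟨N, k, hk, hke⟩ := hg (j - 1)
        refine ⟨N + 1, fun y => (fderivWithin ℝ r Ω y).smulRight (k y), ?_, fun y hy => ?_⟩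
        · exact (hr.smooth.fderivWithin hr.uniqueDiffOn (m := ∞) (by simp)).smulRight hk
        · have hry := (hr.r_pos hy).ne'
          beta_reduce
          rw [fderivWithin_of_mem_nhds (hr.mem_nhds hy), hke y hy, smul_smul, pow_succ,
            mul_assoc, mul_inv_cancel₀ hry, mul_one]
          ext v
          simp only [ContinuousLinearMap.smulRight_apply, smul_apply]
          exact smul_comm _ _ _
    · rw [Finset.sum_range_succ']
      beta_reduce
      rw [if_pos rfl, Pi.zero_apply, smul_zero, add_zero]
      refine Finset.sum_congr rfl fun j _ => ?_
      rw [if_neg (Nat.succ_ne_zero j), Nat.add_sub_cancel]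
  refine ((h1.mono (Nat.le_succ J)).add hr h2).congr fun s Q y hy => ?_
  have h3 : _root_.fderiv ℝ (Φ s Q) y = _root_.fderiv ℝ (fun y => ∑ j ∈ Finset.range J,
      plog r s ((eulerOp s ^ j) Q) y • g j y) y := by
    refine Filter.EventuallyEq.fderiv_eq ?_
    filter_upwards [hr.isOpen_inn.mem_nhds hy] with z hz using he s Q z hz
  rw [h3, fderiv_fun_sum, ← Finset.sum_add_distrib]
  · refine Finset.sum_congr rfl fun j _ => ?_
    rw [fderiv_plog_smul hr _ _ hy (hgd j y hy), pow_succ', Module.End.mul_apply]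
  · intro j _
    exact ((hasFDerivAt_plog hr s _ hy).differentiableAt).smul (hgd j y hy)

end IsLogFamily

end PowLog

/-! ### Recovering the coefficients of a family from its indicial limits -/

open Polynomial in
theorem eulerOp_pow_one (s : ℂ) (j : ℕ) : (eulerOp s ^ j) 1 = C (s ^ j) := by
  induction j with
  | zero => simp
  | succ j ih =>
    rw [pow_succ', Module.End.mul_apply, ih, eulerOp_apply, derivative_C, add_zero, smul_C,
      smul_eq_mul, pow_succ']

/-- The coefficients of a polynomial of degree `< J` are linear combinations of its values. -/
theorem exists_interpolation (J : ℕ) : ∃ c : ℕ → ℕ → ℂ, ∀ (a : ℕ → ℂ), ∀ j < J,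
    a j = ∑ k ∈ Finset.range J, c j k * ∑ i ∈ Finset.range J, (k : ℂ) ^ i * a i := by
  -- The nodes are 0, …, J - 1, and c is the inverse of their Vandermonde matrix.
  set V : Matrix (Fin J) (Fin J) ℂ := Matrix.vandermonde fun k => ((k : ℕ) : ℂ) with hV
  have hdet : IsUnit V.det := by
    rw [isUnit_iff_ne_zero, hV, Matrix.det_vandermonde_ne_zero_iff]
    intro i j hij
    exact Fin.ext (Nat.cast_injective (R := ℂ) hij)
  refine ⟨fun j k => if h : j < J ∧ k < J then V⁻¹ ⟨j, h.1⟩ ⟨k, h.2⟩ else 0, fun a j hj => ?_⟩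
  have h1 : (V⁻¹ * V).mulVec (fun i : Fin J => a i) ⟨j, hj⟩ = a j := by
    rw [Matrix.nonsing_inv_mul V hdet, Matrix.one_mulVec]
  rw [← Matrix.mulVec_mulVec] at h1
  rw [← h1, Matrix.mulVec, dotProduct, Finset.sum_range]
  refine Finset.sum_congr rfl fun k _ => ?_
  beta_reduce
  rw [dif_pos ⟨hj, k.2⟩, Matrix.mulVec, dotProduct, Finset.sum_range]
  rfl

section

open Polynomial

variable {Ω : Set E3} {r : E3 → ℝ}

theorem cpow_neg_mul_plog (s : ℂ) (Q : ℂ[X]) {y : E3} (hy : 0 < r y) :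
    (r y : ℂ) ^ (-s) * plog r s Q y = Q.eval ((Real.log (r y) : ℝ) : ℂ) := by
  have h0 : (r y : ℂ) ≠ 0 := by exact_mod_cast hy.ne'
  rw [plog, ← mul_assoc, ← Complex.cpow_add _ _ h0, neg_add_cancel, Complex.cpow_zero, one_mul]

/-- If `r^{-s} Φ(s, 1)` has the limit `p(s) a` at the boundary for all `s`, the coefficients of the
family `Φ` are smooth up to the boundary, with boundary values given by `p` and `a`. -/
theorem IsLogFamily.exists_contDiffOn (hr : IsHalfDomain Ω r) {J : ℕ} {Φ : ℂ → ℂ[X] → E3 → ℂ}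
    (hΦ : IsLogFamily Ω r J Φ) (p : ℂ[X]) (a : E3 → ℂ)
    (hlim : ∀ s, ∀ y ∈ Ω, y 0 = 0 →
      Tendsto (fun z => (r z : ℂ) ^ (-s) * Φ s 1 z) (𝓝[inn Ω] y) (𝓝 (p.eval s * a y))) :
    ∃ g : ℕ → E3 → ℂ, (∀ j, ContDiffOn ℝ ∞ (g j) Ω) ∧
      (∀ s Q, ∀ y ∈ inn Ω,
        Φ s Q y = ∑ j ∈ Finset.range J, plog r s ((eulerOp s ^ j) Q) y * g j y) ∧
      ∀ y ∈ Ω, y 0 = 0 → ∀ s Q,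
        ∑ j ∈ Finset.range J, g j y • (eulerOp s ^ j) Q = a y • aeval (eulerOp s) p Q := by
  obtain ⟨g, hg, he⟩ := hΦ
  obtain ⟨c, hc⟩ := exists_interpolation J
  have hval : ∀ s, ∀ y ∈ inn Ω, (r y : ℂ) ^ (-s) * Φ s 1 y =
      ∑ i ∈ Finset.range J, s ^ i * g i y := by
    intro s y hy
    rw [he s 1 y hy, Finset.mul_sum]
    refine Finset.sum_congr rfl fun i _ => ?_
    rw [smul_eq_mul, ← mul_assoc, cpow_neg_mul_plog _ _ (hr.r_pos hy), eulerOp_pow_one, eval_C]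
  -- For Q = 1 the family gives Σ s^j g_j, which converges for every s. Interpolation at finitely
  -- many s expresses each g_j through convergent functions.
  have hgl : ∀ j < J, ∀ y ∈ Ω, y 0 = 0 → ∃ l, Tendsto (g j) (𝓝[inn Ω] y) (𝓝 l) := by
    intro j hj y hy hy0
    refine ⟨∑ k ∈ Finset.range J, c j k * (p.eval (k : ℂ) * a y), ?_⟩
    have h1 := tendsto_finsetSum (Finset.range J) fun (k : ℕ) _ =>
      (hlim k y hy hy0).const_mul (c j k)
    refine h1.congr' ?_
    filter_upwards [self_mem_nhdsWithin] with z hz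
    rw [hc (fun i => g i z) j hj]
    exact Finset.sum_congr rfl fun k _ => by rw [hval _ z hz]
  -- Indices j ≥ J do not enter the sum, and nothing is known about their limits; they get the value
  -- 0.
  have hext : ∀ j, ∃ h : E3 → ℂ, ContDiffOn ℝ ∞ h Ω ∧ (j < J → ∀ y ∈ inn Ω, h y = g j y) := by
    intro j
    by_cases hj : j < J
    · obtain ⟨h, h1, h2⟩ := (hg j).choose_spec.exists_extension hr (hgl j hj)
      exact ⟨h, h1, fun _ => h2⟩
    · exact ⟨0, contDiffOn_const, fun h => absurd h hj⟩
  choose h hh hhe using hext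
  refine ⟨h, hh, fun s Q y hy => ?_, fun y hy hy0 s Q => ?_⟩
  · rw [he s Q y hy]
    refine Finset.sum_congr rfl fun j hj => ?_
    rw [hhe j (Finset.mem_range.1 hj) y hy, smul_eq_mul]
  · have := hr.neBot hy
    have h1 : ∀ s : ℂ, ∑ j ∈ Finset.range J, s ^ j * h j y = p.eval s * a y := by
      intro s
      have h2 : Tendsto (fun z => ∑ j ∈ Finset.range J, s ^ j * h j z) (𝓝[inn Ω] y)
          (𝓝 (∑ j ∈ Finset.range J, s ^ j * h j y)) :=
        tendsto_finsetSum _ fun j _ =>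
          (((hh j).continuousOn y hy).mono inter_subset_left).const_mul _
      refine tendsto_nhds_unique h2 ((hlim s y hy hy0).congr' ?_)
      filter_upwards [self_mem_nhdsWithin] with z hz
      rw [hval s z hz]
      exact Finset.sum_congr rfl fun j hj => by rw [hhe j (Finset.mem_range.1 hj) z hz]
    -- Agreement for all s is an identity of polynomials, into which the operator s + D may be
    -- substituted. Limits with Q = 1 thus determine the action on all logarithmic terms.
    have h2 : ∑ j ∈ Finset.range J, C (h j y) * X ^ j = C (a y) * p := by
      refine Polynomial.funext fun s => ?_
      rw [eval_finsetSum, eval_mul, eval_C, mul_comm (a y), ← h1 s]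
      refine Finset.sum_congr rfl fun j _ => ?_
      rw [eval_mul, eval_C, eval_pow, eval_X, mul_comm]
    have h3 := congrArg (fun P => aeval (eulerOp s) P Q) h2
    simp only [map_sum, map_mul, aeval_C, map_pow, aeval_X, LinearMap.sum_apply] at h3
    exact h3

end

/-! ### Functions of a given order at the boundary -/

section Order

variable {F : Type} [NormedAddCommGroup F] [NormedSpace ℝ F] {Ω : Set E3} {r : E3 → ℝ}

/-- `f` is smooth off the boundary and its derivatives of order `j` are `O(r^(K-j))`, locally
uniformly up to the boundary. -/
structure HasOrder (Ω : Set E3) (r : E3 → ℝ) (K : ℝ) (f : E3 → F) : Prop where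
  smooth : ContDiffOn ℝ ∞ f (inn Ω)
  bound : ∀ C ⊆ Ω, IsCompact C → ∀ j : ℕ, ∃ A : ℝ, ∀ y ∈ C ∩ inn Ω,
    ‖iteratedFDeriv ℝ j f y‖ ≤ A * r y ^ (K - j)

theorem IsHalfDomain.exists_compact (hr : IsHalfDomain Ω r) {y : E3} (hy : y ∈ Ω) :
    ∃ C ⊆ Ω, IsCompact C ∧ C ∈ 𝓝[Ω] y := by
  obtain ⟨O, hO, rfl⟩ := hr.exists_open
  obtain ⟨δ, hδ, hball⟩ := Metric.nhds_basis_closedBall.mem_iff.1 (hO.mem_nhds hy.1)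
  refine ⟨Metric.closedBall y δ ∩ {z | 0 ≤ z 0}, fun z hz => ⟨hball hz.1, hz.2⟩, ?_, ?_⟩
  · exact (isCompact_closedBall y δ).inter_right (isClosed_le continuous_const coord0.continuous)
  · filter_upwards [self_mem_nhdsWithin,
      mem_nhdsWithin_of_mem_nhds (Metric.closedBall_mem_nhds y hδ)] with z hz hz'
      using ⟨hz', hz.2⟩

theorem IsHalfDomain.exists_le (hr : IsHalfDomain Ω r) {C : Set E3} (hC : C ⊆ Ω)
    (hCc : IsCompact C) : ∃ R : ℝ, 1 ≤ R ∧ ∀ y ∈ C, r y ≤ R := by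
  obtain ⟨R, hR⟩ := hCc.bddAbove_image (hr.smooth.continuousOn.mono hC)
  exact ⟨max R 1, le_max_right _ _, fun y hy => (hR ⟨y, hy, rfl⟩).trans (le_max_left _ _)⟩

theorem rpow_le_rpow_of_le {x R s t : ℝ} (hx : 0 < x) (hxR : x ≤ R) (hst : s ≤ t) :
    x ^ t ≤ R ^ (t - s) * x ^ s := by
  rw [← sub_add_cancel t s, Real.rpow_add hx, add_sub_cancel_right]
  exact mul_le_mul_of_nonneg_right (Real.rpow_le_rpow hx.le hxR (by linarith))
    (Real.rpow_nonneg hx.le _)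

namespace HasOrder

theorem congr (hr : IsHalfDomain Ω r) {K : ℝ} {f g : E3 → F} (hf : HasOrder Ω r K f)
    (h : ∀ y ∈ inn Ω, g y = f y) : HasOrder Ω r K g := by
  refine ⟨hf.smooth.congr h, fun C hC hCc j => ?_⟩
  obtain ⟨A, hA⟩ := hf.bound C hC hCc j
  refine ⟨A, fun y hy => ?_⟩
  have : g =ᶠ[𝓝 y] f := by
    filter_upwards [hr.isOpen_inn.mem_nhds hy.2] with z hz using h z hz
  rw [this.iteratedFDeriv ℝ j |>.eq_of_nhds]
  exact hA y hy

theorem contDiffAt (hr : IsHalfDomain Ω r) {K : ℝ} {f : E3 → F} (hf : HasOrder Ω r K f) {y : E3}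
    (hy : y ∈ inn Ω) : ContDiffAt ℝ ∞ f y := hf.smooth.contDiffAt (hr.isOpen_inn.mem_nhds hy)

theorem add (hr : IsHalfDomain Ω r) {K : ℝ} {f g : E3 → F} (hf : HasOrder Ω r K f)
    (hg : HasOrder Ω r K g) : HasOrder Ω r K (fun y => f y + g y) := by
  refine ⟨hf.smooth.add hg.smooth, fun C hC hCc j => ?_⟩
  obtain ⟨A, hA⟩ := hf.bound C hC hCc j
  obtain ⟨A', hA'⟩ := hg.bound C hC hCc j
  refine ⟨A + A', fun y hy => ?_⟩
  have h1 : iteratedFDeriv ℝ j (fun y => f y + g y) y = iteratedFDeriv ℝ j f y +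
      iteratedFDeriv ℝ j g y := iteratedFDeriv_add_apply
    ((hf.contDiffAt hr hy.2).of_le (by exact_mod_cast le_top))
    ((hg.contDiffAt hr hy.2).of_le (by exact_mod_cast le_top))
  rw [h1, add_mul]
  exact (norm_add_le _ _).trans (add_le_add (hA y hy) (hA' y hy))

theorem zero (K : ℝ) : HasOrder Ω r K (fun _ => (0 : F)) := by
  refine ⟨contDiffOn_const, fun C _ _ j => ⟨0, fun y _ => ?_⟩⟩
  have : iteratedFDeriv ℝ j (fun _ : E3 => (0 : F)) = 0 := iteratedFDeriv_fun_zero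
  rw [this]
  simp

theorem sum (hr : IsHalfDomain Ω r) {ι : Type*} {K : ℝ} {s : Finset ι} {f : ι → E3 → F}
    (hf : ∀ i ∈ s, HasOrder Ω r K (f i)) : HasOrder Ω r K (fun y => ∑ i ∈ s, f i y) := by
  classical
  induction s using Finset.induction_on with
  | empty => simpa using zero K
  | insert i s hi ih =>
    refine ((hf i (by simp)).add hr (ih fun j hj => hf j (by simp [hj]))).congr hr fun y _ => ?_
    rw [Finset.sum_insert hi]

theorem mono (hr : IsHalfDomain Ω r) {K K' : ℝ} {f : E3 → F} (hf : HasOrder Ω r K f)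
    (h : K' ≤ K) : HasOrder Ω r K' f := by
  refine ⟨hf.smooth, fun C hC hCc j => ?_⟩
  obtain ⟨A, hA⟩ := hf.bound C hC hCc j
  obtain ⟨R, hR, hRC⟩ := hr.exists_le hC hCc
  refine ⟨|A| * R ^ (K - K'), fun y hy => ?_⟩
  have hy0 := hr.r_pos hy.2
  refine (hA y hy).trans ?_
  rw [mul_assoc]
  have h1 := rpow_le_rpow_of_le hy0 (hRC y hy.1) (s := K' - j) (t := K - j) (by linarith)
  rw [show K - (j : ℝ) - (K' - j) = K - K' by ring] at h1
  exact mul_le_mul (le_abs_self A) h1 (Real.rpow_nonneg hy0.le _) (abs_nonneg A)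

theorem fderiv (hr : IsHalfDomain Ω r) {K : ℝ} {f : E3 → F} (hf : HasOrder Ω r K f) :
    HasOrder Ω r (K - 1) (fderiv ℝ f) := by
  refine ⟨hf.smooth.fderiv_of_isOpen hr.isOpen_inn (by simp), fun C hC hCc j => ?_⟩
  obtain ⟨A, hA⟩ := hf.bound C hC hCc (j + 1)
  refine ⟨A, fun y hy => ?_⟩
  rw [norm_iteratedFDeriv_fderiv]
  convert hA y hy using 3
  push_cast; ring

theorem tendsto_zero (hr : IsHalfDomain Ω r) {K : ℝ} {f : E3 → F} (hf : HasOrder Ω r K f) {y : E3}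
    (hy : y ∈ Ω) (hy0 : y 0 = 0) {t : ℝ} (ht : t < K) :
    Tendsto (fun z => r z ^ (-t) • f z) (𝓝[inn Ω] y) (𝓝 0) := by
  obtain ⟨C, hC, hCc, hCy⟩ := hr.exists_compact hy
  obtain ⟨A, hA⟩ := hf.bound C hC hCc 0
  have h1 : Tendsto r (𝓝[inn Ω] y) (𝓝 0) := by
    have : ContinuousWithinAt r (inn Ω) y := (hr.smooth.continuousOn y hy).mono inter_subset_left
    rwa [ContinuousWithinAt, hr.zero y hy hy0] at this
  have h2 : Tendsto (fun z => A * r z ^ (K - t)) (𝓝[inn Ω] y) (𝓝 0) := by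
    have := (h1.rpow_const (p := K - t) (Or.inr (by linarith))).const_mul A
    rwa [Real.zero_rpow (by linarith), mul_zero] at this
  refine squeeze_zero_norm' ?_ h2
  filter_upwards [self_mem_nhdsWithin, nhdsWithin_mono y inter_subset_left hCy] with z hz hzC
  have hz0 := hr.r_pos hz
  have h3 := hA z ⟨hzC, hz⟩
  rw [norm_iteratedFDeriv_zero, Nat.cast_zero, sub_zero] at h3
  rw [norm_smul, Real.norm_of_nonneg (Real.rpow_nonneg hz0.le _), sub_eq_add_neg, Real.rpow_add hz0]
  calc r z ^ (-t) * ‖f z‖ ≤ r z ^ (-t) * (A * r z ^ K) :=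
        mul_le_mul_of_nonneg_left h3 (Real.rpow_nonneg hz0.le _)
    _ = A * (r z ^ K * r z ^ (-t)) := by ring

/-- A function of high order extends by zero to a differentiable function. -/
theorem contDiffOn_indicator (hr : IsHalfDomain Ω r) (m : ℕ) : ∀ {F : Type} [NormedAddCommGroup F]
    [NormedSpace ℝ F] {K : ℝ} {f : E3 → F}, HasOrder Ω r K f → (m : ℝ) + 1 < K →
    ContDiffOn ℝ m ((inn Ω).indicator f) Ω := by
  have hbd : ∀ y ∈ Ω, y ∉ inn Ω → y 0 = 0 := fun y hy hy' =>
    le_antisymm (not_lt.1 fun h => hy' ⟨hy, h⟩) (hr.nonneg hy)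
  have hlim : ∀ {F : Type} [NormedAddCommGroup F] [NormedSpace ℝ F] {K : ℝ} {f : E3 → F},
      HasOrder Ω r K f → ∀ y ∈ Ω, y ∉ inn Ω → ∀ t < K, t = 0 ∨ t = 1 →
      Tendsto (fun z => r z ^ (-t) • (inn Ω).indicator f z) (𝓝[Ω] y) (𝓝 0) := by
    intro F _ _ K f hf y hy hy' t ht ht'
    have h1 := hf.tendsto_zero hr hy (hbd y hy hy') ht
    have h2 : Ω = inn Ω ∪ (Ω \ inn Ω) := by
      rw [union_sdiff_cancel (show inn Ω ⊆ Ω from inter_subset_left)]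
    rw [h2, nhdsWithin_union, tendsto_sup, ← h2]
    refine ⟨h1.congr' ?_, tendsto_const_nhds.congr' ?_⟩
    · filter_upwards [self_mem_nhdsWithin] with z hz
      rw [indicator_of_mem hz]
    · filter_upwards [self_mem_nhdsWithin] with z hz
      rw [indicator_of_notMem hz.2, smul_zero]
  induction m with
  | zero =>
    intro F _ _ K f hf hK
    rw [Nat.cast_zero, contDiffOn_zero]
    intro y hy
    by_cases hy' : y ∈ inn Ω
    · have h1 : ContinuousAt f y := (hf.contDiffAt hr hy').continuousAt
      refine (h1.congr ?_).continuousWithinAt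
      filter_upwards [hr.isOpen_inn.mem_nhds hy'] with z hz
      rw [indicator_of_mem hz]
    · have := hlim hf y hy hy' 0 (by simp at hK; linarith) (Or.inl rfl)
      rw [ContinuousWithinAt, indicator_of_notMem hy']
      simpa using this
  | succ m ih =>
    intro F _ _ K f hf hK
    push_cast at hK ⊢
    rw [contDiffOn_succ_iff_hasFDerivWithinAt_of_uniqueDiffOn hr.uniqueDiffOn]
    refine ⟨by simp, (inn Ω).indicator (_root_.fderiv ℝ f), ih (hf.fderiv hr) (by linarith), ?_⟩
    intro y hy
    by_cases hy' : y ∈ inn Ω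
    · rw [indicator_of_mem hy']
      have h1 : HasFDerivAt f (_root_.fderiv ℝ f y) y :=
        ((hf.contDiffAt hr hy').differentiableAt (by simp)).hasFDerivAt
      refine (h1.congr_of_eventuallyEq ?_).hasFDerivWithinAt
      filter_upwards [hr.isOpen_inn.mem_nhds hy'] with z hz
      rw [indicator_of_mem hz]
    · rw [indicator_of_notMem hy', hasFDerivWithinAt_iff_isLittleO, indicator_of_notMem hy']
      simp only [sub_zero, zero_apply]
      -- At a boundary point f = o(r) because its order exceeds 1, and r = O(|z - y|). The extension
      -- by zero therefore has derivative 0 there.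
      have h1 : (fun z => r z) =O[𝓝[Ω] y] fun z => z - y := by
        have := (hr.smooth.differentiableOn (by simp) y hy).hasFDerivWithinAt.isBigO_sub
        simpa [hr.zero y hy (hbd y hy hy')] using this
      have h2 : (fun z => (inn Ω).indicator f z) =o[𝓝[Ω] y] fun z => r z := by
        have h3 := hlim hf y hy hy' 1 (by have : (0 : ℝ) ≤ m := by positivity
                                          linarith) (Or.inr rfl)
        have h4 := (Asymptotics.isLittleO_one_iff ℝ).2 h3
        have h5 := (Asymptotics.isBigO_refl (fun z => r z) (𝓝[Ω] y)).smul_isLittleO h4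
        simp only [smul_eq_mul, mul_one] at h5
        refine h5.congr' ?_ EventuallyEq.rfl
        filter_upwards [self_mem_nhdsWithin] with z hz
        by_cases hz' : z ∈ inn Ω
        · rw [smul_smul, Real.rpow_neg_one, mul_inv_cancel₀ (hr.r_pos hz').ne', one_smul]
        · rw [indicator_of_notMem hz', smul_zero, smul_zero]
      exact h2.trans_isBigO h1

end HasOrder

end Order

/-! ### Growth of powers and logarithms at the boundary -/

open Polynomial in
theorem exists_eval_log_le (Q : ℂ[X]) {ε R : ℝ} (hε : 0 < ε) (hR : 1 ≤ R) :
    ∃ A : ℝ, ∀ x : ℝ, 0 < x → x ≤ R → ‖Q.eval ((Real.log x : ℝ) : ℂ)‖ * x ^ ε ≤ A := by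
  induction Q using Polynomial.induction_on' with
  | add p q hp hq =>
    obtain ⟨A, hA⟩ := hp
    obtain ⟨A', hA'⟩ := hq
    refine ⟨A + A', fun x hx hxR => ?_⟩
    rw [eval_add]
    calc _ ≤ (‖p.eval ((Real.log x : ℝ) : ℂ)‖ + ‖q.eval ((Real.log x : ℝ) : ℂ)‖) * x ^ ε :=
          mul_le_mul_of_nonneg_right (norm_add_le _ _) (Real.rpow_nonneg hx.le _)
      _ ≤ A + A' := by rw [add_mul]; exact add_le_add (hA x hx hxR) (hA' x hx hxR)
  | monomial n a =>
    obtain ⟨A, hA0, hA⟩ : ∃ A : ℝ, 0 ≤ A ∧ ∀ x : ℝ, 0 < x → x ≤ R → |Real.log x| ^ n * x ^ ε ≤ A := by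
      have hRε : 0 ≤ R ^ ε := Real.rpow_nonneg (by linarith) _
      have hlogR : 0 ≤ Real.log R := Real.log_nonneg hR
      refine ⟨((n + 1) / ε) ^ n * R ^ ε + Real.log R ^ n * R ^ ε, by positivity, fun x hx hxR => ?_⟩
      rcases le_total x 1 with h1 | h1
      · have h2 := Real.abs_log_mul_self_rpow_lt x (ε / (n + 1)) hx h1 (by positivity)
        rw [abs_mul, abs_of_nonneg (Real.rpow_nonneg hx.le _), one_div_div] at h2
        have h3 : |Real.log x| ^ n * x ^ ε ≤ (|Real.log x| * x ^ (ε / (n + 1))) ^ n * R ^ ε := by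
          rw [mul_pow, mul_assoc]
          refine mul_le_mul_of_nonneg_left ?_ (by positivity)
          rw [← Real.rpow_natCast, ← Real.rpow_mul hx.le]
          have h4 := Real.rpow_le_rpow_of_exponent_ge hx h1
            (show ε / (n + 1) * n ≤ ε by
              rw [div_mul_eq_mul_div, div_le_iff₀ (by positivity)]; nlinarith)
          exact h4.trans (le_mul_of_one_le_right (Real.rpow_nonneg hx.le _) (Real.one_le_rpow hR hε.le))
        have h5 : (|Real.log x| * x ^ (ε / (n + 1))) ^ n * R ^ ε ≤ ((n + 1) / ε) ^ n * R ^ ε := by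
          gcongr
        have : 0 ≤ Real.log R ^ n * R ^ ε := by positivity
        linarith
      · have h2 : |Real.log x| ≤ Real.log R := by
          rw [abs_of_nonneg (Real.log_nonneg h1)]
          exact Real.log_le_log hx hxR
        have h3 : |Real.log x| ^ n * x ^ ε ≤ Real.log R ^ n * R ^ ε := by
          gcongr
        have : 0 ≤ ((n + 1) / ε) ^ n * R ^ ε := by positivity
        linarith
    refine ⟨‖a‖ * A, fun x hx hxR => ?_⟩
    rw [eval_monomial, norm_mul, norm_pow, Complex.norm_real, Real.norm_eq_abs, mul_assoc]
    exact mul_le_mul_of_nonneg_left (hA x hx hxR) (norm_nonneg _)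

section

open Polynomial

variable {Ω : Set E3} {r : E3 → ℝ}

theorem norm_plog {s : ℂ} {Q : ℂ[X]} {y : E3} (hy : 0 < r y) :
    ‖plog r s Q y‖ = r y ^ s.re * ‖Q.eval ((Real.log (r y) : ℝ) : ℂ)‖ := by
  rw [plog, norm_mul, Complex.norm_cpow_eq_rpow_re_of_pos hy]

theorem exists_norm_plog_le (hr : IsHalfDomain Ω r) {s : ℂ} (Q : ℂ[X]) {t : ℝ} (ht : t < s.re)
    {C : Set E3} (hC : C ⊆ Ω) (hCc : IsCompact C) :
    ∃ A : ℝ, ∀ y ∈ C ∩ inn Ω, ‖plog r s Q y‖ ≤ A * r y ^ t := by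
  obtain ⟨R, hR, hRC⟩ := hr.exists_le hC hCc
  obtain ⟨A, hA⟩ := exists_eval_log_le Q (sub_pos.2 ht) hR
  refine ⟨A, fun y hy => ?_⟩
  have hy0 := hr.r_pos hy.2
  rw [norm_plog hy0, ← sub_add_cancel s.re t, Real.rpow_add hy0]
  calc _ = (‖Q.eval ((Real.log (r y) : ℝ) : ℂ)‖ * r y ^ (s.re - t)) * r y ^ t := by ring
    _ ≤ _ := mul_le_mul_of_nonneg_right (hA _ hy0 (hRC y hy.1)) (Real.rpow_nonneg hy0.le _)

theorem plog_mul_inv {s : ℂ} {Q : ℂ[X]} {y : E3} (hy : 0 < r y) :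
    plog r s Q y * ((r y)⁻¹ : ℝ) = plog r (s - 1) Q y := by
  have h0 : (r y : ℂ) ≠ 0 := by exact_mod_cast hy.ne'
  rw [plog, plog, Complex.cpow_sub _ _ h0, Complex.cpow_one]
  push_cast
  ring

/-- The gap between t and Re s absorbs the logarithms. The derivative of r^s Q(log r) f is r^s Q(log
r) df + r^{s-1} ((s + D)Q)(log r) dr ⊗ f, a sum of two terms of the same kind, so the bounds follow
by induction on the number of derivatives with f, F, s, Q and t varying. -/
theorem hasOrder_plog_smul (hr : IsHalfDomain Ω r) {F : Type} [NormedAddCommGroup F]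
    [NormedSpace ℝ F] [NormedSpace ℂ F] [IsScalarTower ℝ ℂ F] {f : E3 → F}
    (hf : ContDiffOn ℝ ∞ f Ω) (s : ℂ) (Q : ℂ[X]) {t : ℝ} (ht : t < s.re) :
    HasOrder Ω r t (fun y => plog r s Q y • f y) := by
  have hsm : ∀ {F : Type} [NormedAddCommGroup F]
      [NormedSpace ℝ F] [NormedSpace ℂ F] [IsScalarTower ℝ ℂ F] {f : E3 → F},
      ContDiffOn ℝ ∞ f Ω → ∀ (s : ℂ) (Q : ℂ[X]),
      ContDiffOn ℝ ∞ (fun y => plog r s Q y • f y) (inn Ω) := by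
    intro F _ _ _ _ f hf s Q
    exact (contDiffOn_plog hr s Q).smul (hf.mono inter_subset_left)
  refine ⟨hsm hf s Q, fun C hC hCc j => ?_⟩
  induction j generalizing F s Q t with
  | zero =>
    obtain ⟨A, hA⟩ := exists_norm_plog_le hr Q ht hC hCc
    obtain ⟨B, hB⟩ := hCc.exists_bound_of_continuousOn (hf.continuousOn.mono hC)
    refine ⟨A * B, fun y hy => ?_⟩
    rw [norm_iteratedFDeriv_zero, norm_smul, Nat.cast_zero, sub_zero]
    calc _ ≤ (A * r y ^ t) * B := mul_le_mul (hA y hy) (hB y hy.1) (norm_nonneg _)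
          ((norm_nonneg _).trans (hA y hy))
      _ = _ := by ring
  | succ j ih =>
    have h1 := hf.fderivWithin hr.uniqueDiffOn (m := ∞) (by simp)
    have h2 : ContDiffOn ℝ ∞ (fun y => (fderivWithin ℝ r Ω y).smulRight (f y)) Ω :=
      (hr.smooth.fderivWithin hr.uniqueDiffOn (m := ∞) (by simp)).smulRight hf
    obtain ⟨A, hA⟩ := ih h1 s Q ht
    obtain ⟨A', hA'⟩ := ih h2 (s - 1) (eulerOp s Q) (t := t - 1) (by simpa using ht)
    obtain ⟨R, hR, hRC⟩ := hr.exists_le hC hCc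
    refine ⟨|A| * R + A', fun y hy => ?_⟩
    have hy0 := hr.r_pos hy.2
    rw [← norm_iteratedFDeriv_fderiv]
    have h3 : fderiv ℝ (fun y => plog r s Q y • f y) =ᶠ[𝓝 y] fun y =>
        plog r s Q y • fderivWithin ℝ f Ω y +
        plog r (s - 1) (eulerOp s Q) y • (fderivWithin ℝ r Ω y).smulRight (f y) := by
      filter_upwards [hr.isOpen_inn.mem_nhds hy.2] with z hz
      rw [fderiv_plog_smul hr s Q hz ((hr.contDiffAt hf hz).differentiableAt (by simp)),
        fderivWithin_of_mem_nhds (hr.mem_nhds hz), fderivWithin_of_mem_nhds (hr.mem_nhds hz),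
        ← plog_mul_inv (hr.r_pos hz), mul_smul]
      congr 2
      exact (algebraMap_smul ℂ (r z)⁻¹ _).symm
    rw [(h3.iteratedFDeriv ℝ j).eq_of_nhds]
    have hj : ((j : ℕ∞) : WithTop ℕ∞) ≤ ∞ := by exact_mod_cast le_top
    have h4 := iteratedFDeriv_add_apply (i := j)
      (((hsm h1 s Q).contDiffAt (hr.isOpen_inn.mem_nhds hy.2)).of_le hj)
      (((hsm h2 (s - 1) (eulerOp s Q)).contDiffAt (hr.isOpen_inn.mem_nhds hy.2)).of_le hj)
    refine (congrArg norm h4).le.trans ((norm_add_le _ _).trans ?_)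
    rw [add_mul]
    refine add_le_add ((hA y hy).trans ?_) ((hA' y hy).trans (le_of_eq ?_))
    · have h5 := rpow_le_rpow_of_le hy0 (hRC y hy.1) (s := t - ((j + 1 : ℕ) : ℝ)) (t := t - j)
        (by push_cast; linarith)
      rw [show t - (j : ℝ) - (t - ((j + 1 : ℕ) : ℝ)) = 1 by push_cast; ring, Real.rpow_one] at h5
      rw [mul_assoc]
      exact mul_le_mul (le_abs_self A) h5 (Real.rpow_nonneg hy0.le _) (abs_nonneg A)
    · congr 2; push_cast; ring

end

/-! ### Charts -/

section Charts

variable {M : Type*} [TopologicalSpace M] [ChartedSpace H3 M]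

/-- The domain of the coordinates of a chart. -/
abbrev chartDom (e : OpenPartialHomeomorph M H3) : Set E3 := (e.extend (𝓡∂ 3)).target

theorem extend_mem {e : OpenPartialHomeomorph M H3} {x : M} (hx : x ∈ e.source) :
    e.extend (𝓡∂ 3) x ∈ chartDom e :=
  (e.extend (𝓡∂ 3)).map_source (by rwa [e.extend_source])

theorem symm_mem {e : OpenPartialHomeomorph M H3} {y : E3} (hy : y ∈ chartDom e) :
    (e.extend (𝓡∂ 3)).symm y ∈ e.source := by
  have := (e.extend (𝓡∂ 3)).map_target hy
  rwa [e.extend_source] at this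

theorem extend_symm_eq {e : OpenPartialHomeomorph M H3} {y : E3} (hy : y ∈ chartDom e) :
    e.extend (𝓡∂ 3) ((e.extend (𝓡∂ 3)).symm y) = y := (e.extend (𝓡∂ 3)).right_inv hy

theorem symm_extend_eq {e : OpenPartialHomeomorph M H3} {x : M} (hx : x ∈ e.source) :
    (e.extend (𝓡∂ 3)).symm (e.extend (𝓡∂ 3) x) = x := e.extend_left_inv hx

theorem exists_open_chartDom (e : OpenPartialHomeomorph M H3) :
    ∃ O : Set E3, IsOpen O ∧ chartDom e = O ∩ {y | 0 ≤ y 0} := by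
  refine ⟨(𝓡∂ 3).symm ⁻¹' e.target, e.open_target.preimage (𝓡∂ 3).continuous_symm, ?_⟩
  rw [chartDom, e.extend_target, range_modelWithCornersEuclideanHalfSpace]

theorem uniqueDiffOn_chartDom (e : OpenPartialHomeomorph M H3) : UniqueDiffOn ℝ (chartDom e) := by
  obtain ⟨O, hO, h⟩ := exists_open_chartDom e
  rw [h, inter_comm]
  exact uniqueDiffOn_half.inter hO

theorem image_source (e : OpenPartialHomeomorph M H3) :
    e.extend (𝓡∂ 3) '' e.source = chartDom e := (e.extend_target_eq_image_source).symm

theorem mdifferentiable_chart {e : OpenPartialHomeomorph M H3} (he : e ∈ smoothCharts M) :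
    e.MDifferentiable (𝓡∂ 3) (𝓡∂ 3) :=
  ⟨(contMDiffOn_of_mem_maximalAtlas he).mdifferentiableOn (by simp),
    (contMDiffOn_symm_of_mem_maximalAtlas he).mdifferentiableOn (by simp)⟩

theorem isInvertible_chartDiff {e : OpenPartialHomeomorph M H3} (he : e ∈ smoothCharts M) {x : M}
    (hx : x ∈ e.source) : (chartDiff e x).IsInvertible := by
  have h1 := ((𝓡∂ 3).hasMFDerivAt (x := e x)).comp x
    ((mdifferentiable_chart he).mdifferentiableAt hx).hasMFDerivAt
  let L : TangentSpace (𝓡∂ 3) x ≃L[ℝ] E3 := (mdifferentiable_chart he).mfderiv hx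
  refine ⟨L, ?_⟩
  exact h1.mfderiv.symm

theorem chartDiff_coordVector {e : OpenPartialHomeomorph M H3} (he : e ∈ smoothCharts M) {x : M}
    (hx : x ∈ e.source) (i : Fin 3) :
    chartDiff e x (coordVector e x i) = EuclideanSpace.single i (1 : ℝ) := by
  have h := (isInvertible_chartDiff he hx).self_comp_inverse
  exact congrArg (fun L : E3 →L[ℝ] E3 => L (EuclideanSpace.single i 1)) h

theorem coordCovector_coordVector {e : OpenPartialHomeomorph M H3} (he : e ∈ smoothCharts M) {x : M}
    (hx : x ∈ e.source) (i j : Fin 3) :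
    coordCovector e x i (coordVector e x j) = if i = j then 1 else 0 := by
  have : coordCovector e x i (coordVector e x j) = (chartDiff e x (coordVector e x j)) i := rfl
  rw [this, chartDiff_coordVector he hx]
  simp

theorem eq_sum_coordVector {e : OpenPartialHomeomorph M H3} (he : e ∈ smoothCharts M) {x : M}
    (hx : x ∈ e.source) (v : TangentSpace (𝓡∂ 3) x) :
    v = ∑ i, coordCovector e x i v • coordVector e x i := by
  obtain ⟨L, hL⟩ := isInvertible_chartDiff he hx
  have hinj : Function.Injective (chartDiff e x) := by
    rw [← hL]; exact L.injective
  refine hinj ?_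
  rw [map_sum]
  simp only [map_smul, chartDiff_coordVector he hx]
  ext j
  rw [show (chartDiff e x v) j = coordCovector e x j v from rfl]
  refine Eq.trans ?_ (map_sum (EuclideanSpace.proj j : E3 →L[ℝ] ℝ) (fun k =>
    coordCovector e x k v • (EuclideanSpace.single k (1 : ℝ) : E3)) Finset.univ).symm
  rw [Finset.sum_eq_single j (fun k _ hk => by simp [hk.symm]) (by simp)]
  simp

theorem eq_sum_coordCovector {e : OpenPartialHomeomorph M H3} (he : e ∈ smoothCharts M) {x : M}
    (hx : x ∈ e.source) (θ : Module.Dual ℝ (TangentSpace (𝓡∂ 3) x)) :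
    θ = ∑ i, θ (coordVector e x i) • coordCovector e x i := by
  ext v
  conv_lhs => rw [eq_sum_coordVector he hx v]
  rw [map_sum, LinearMap.sum_apply]
  refine Finset.sum_congr rfl fun i _ => ?_
  rw [map_smul, LinearMap.smul_apply, smul_eq_mul, smul_eq_mul, mul_comm]

/-- Interior points are defined through the preferred chart at the point. Any smooth chart is a
local diffeomorphism to the half space, and these respect interior points. -/
theorem mem_interior_iff [IsManifold (𝓡∂ 3) ∞ M] {e : OpenPartialHomeomorph M H3}
    (he : e ∈ smoothCharts M) {x : M} (hx : x ∈ e.source) : x ∈ int M ↔ 0 < e.extend (𝓡∂ 3) x 0 := by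
  let Φ : PartialDiffeomorph (𝓡∂ 3) (𝓡∂ 3) M H3 ∞ :=
    { e.toPartialEquiv with
      open_source := e.open_source
      open_target := e.open_target
      contMDiffOn_toFun := contMDiffOn_of_mem_maximalAtlas he
      contMDiffOn_invFun := contMDiffOn_symm_of_mem_maximalAtlas he }
  have h1 : IsLocalDiffeomorphAt (𝓡∂ 3) (𝓡∂ 3) ∞ e x := ⟨Φ, hx, fun _ _ => rfl⟩
  have h2 := h1.isInteriorPoint_iff (by simp)
  refine h2.trans ?_
  rw [ModelWithCorners.IsInteriorPoint, interior_range_modelWithCornersEuclideanHalfSpace]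
  simp only [mfld_simps]
  rfl

theorem mem_boundary_iff [IsManifold (𝓡∂ 3) ∞ M] {e : OpenPartialHomeomorph M H3}
    (he : e ∈ smoothCharts M) {x : M} (hx : x ∈ e.source) : x ∈ bdry M ↔ e.extend (𝓡∂ 3) x 0 = 0 := by
  have h1 : x ∈ bdry M ↔ x ∉ int M := by
    exact (𝓡∂ 3).isBoundaryPoint_iff_not_isInteriorPoint x
  rw [h1, mem_interior_iff he hx, not_lt]
  refine ⟨fun h => le_antisymm h ?_, fun h => h.le⟩
  obtain ⟨O, -, hO⟩ := exists_open_chartDom e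
  have := extend_mem hx
  rw [hO] at this
  exact this.2

theorem symm_mem_int [IsManifold (𝓡∂ 3) ∞ M] {e : OpenPartialHomeomorph M H3}
    (he : e ∈ smoothCharts M) {y : E3} (hy : y ∈ chartDom e) :
    (e.extend (𝓡∂ 3)).symm y ∈ int M ↔ 0 < y 0 := by
  rw [mem_interior_iff he (symm_mem hy), extend_symm_eq hy]

theorem symm_mem_bdry [IsManifold (𝓡∂ 3) ∞ M] {e : OpenPartialHomeomorph M H3}
    (he : e ∈ smoothCharts M) {y : E3} (hy : y ∈ chartDom e) :
    (e.extend (𝓡∂ 3)).symm y ∈ bdry M ↔ y 0 = 0 := by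
  rw [mem_boundary_iff he (symm_mem hy), extend_symm_eq hy]

theorem image_source_int [IsManifold (𝓡∂ 3) ∞ M] {e : OpenPartialHomeomorph M H3}
    (he : e ∈ smoothCharts M) : e.extend (𝓡∂ 3) '' (e.source ∩ int M) = inn (chartDom e) := by
  ext y
  constructor
  · rintro ⟨x, hx, rfl⟩
    exact ⟨extend_mem hx.1, (mem_interior_iff he hx.1).1 hx.2⟩
  · intro hy
    exact ⟨_, ⟨symm_mem hy.1, (symm_mem_int he hy.1).2 hy.2⟩, extend_symm_eq hy.1⟩

theorem continuousOn_symm (e : OpenPartialHomeomorph M H3) :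
    ContinuousOn (e.extend (𝓡∂ 3)).symm (chartDom e) := e.continuousOn_extend_symm

theorem tendsto_extend [IsManifold (𝓡∂ 3) ∞ M] {e : OpenPartialHomeomorph M H3}
    (he : e ∈ smoothCharts M) {x : M} (hx : x ∈ e.source) :
    Tendsto (e.extend (𝓡∂ 3)) (𝓝[int M] x) (𝓝[inn (chartDom e)] (e.extend (𝓡∂ 3) x)) := by
  refine tendsto_nhdsWithin_iff.2 ⟨((e.continuousAt_extend (I := 𝓡∂ 3) hx).tendsto).mono_left
    nhdsWithin_le_nhds, ?_⟩
  filter_upwards [self_mem_nhdsWithin,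
    mem_nhdsWithin_of_mem_nhds (e.open_source.mem_nhds hx)] with z hz hz'
  exact ⟨extend_mem hz', (mem_interior_iff he hz').1 hz⟩

theorem tendsto_symm [IsManifold (𝓡∂ 3) ∞ M] {e : OpenPartialHomeomorph M H3}
    (he : e ∈ smoothCharts M) {y : E3} (hy : y ∈ chartDom e) :
    Tendsto (e.extend (𝓡∂ 3)).symm (𝓝[inn (chartDom e)] y) (𝓝[int M] ((e.extend (𝓡∂ 3)).symm y)) := by
  refine tendsto_nhdsWithin_iff.2 ⟨(continuousOn_symm e y hy).mono inter_subset_left, ?_⟩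
  filter_upwards [self_mem_nhdsWithin] with z hz using (symm_mem_int he hz.1).2 hz.2

theorem contDiffOn_comp_symm {F : Type} [NormedAddCommGroup F] [NormedSpace ℝ F]
    {n : ℕ∞} {e : OpenPartialHomeomorph M H3} (he : e ∈ smoothCharts M) {s : Set M}
    {f : M → F} (hs : s ⊆ e.source) : ContMDiffOn (𝓡∂ 3) 𝓘(ℝ, F) n f s ↔
      ContDiffOn ℝ n (f ∘ (e.extend (𝓡∂ 3)).symm) (e.extend (𝓡∂ 3) '' s) := by
  have hen : e ∈ IsManifold.maximalAtlas (𝓡∂ 3) n M :=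
    IsManifold.maximalAtlas_subset_of_le (by exact_mod_cast le_top) he
  exact (contMDiffOn_iff_source_of_mem_maximalAtlas hen hs).trans contMDiffOn_iff_contDiffOn

/-- The differential of a function in coordinates. -/
theorem mfderiv_eq_comp {F : Type} [NormedAddCommGroup F] [NormedSpace ℝ F]
    {e : OpenPartialHomeomorph M H3} (he : e ∈ smoothCharts M) {x : M} (hx : x ∈ e.source)
    {f : M → F} (hf : DifferentiableWithinAt ℝ (f ∘ (e.extend (𝓡∂ 3)).symm) (chartDom e)
      (e.extend (𝓡∂ 3) x)) :
    mfderiv (𝓡∂ 3) 𝓘(ℝ, F) f x = (fderivWithin ℝ (f ∘ (e.extend (𝓡∂ 3)).symm) (chartDom e)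
      (e.extend (𝓡∂ 3) x)).comp (chartDiff e x) := by
  have h1 : HasMFDerivAt (𝓡∂ 3) 𝓘(ℝ, E3) (e.extend (𝓡∂ 3)) x (chartDiff e x) := by
    have h2 := ((𝓡∂ 3).hasMFDerivAt (x := e x)).comp x
      ((mdifferentiable_chart he).mdifferentiableAt hx).hasMFDerivAt
    exact h2.mdifferentiableAt.hasMFDerivAt
  have h2 := hf.hasFDerivWithinAt.hasMFDerivWithinAt
  have h3 : HasMFDerivWithinAt (𝓡∂ 3) 𝓘(ℝ, F)
      ((f ∘ (e.extend (𝓡∂ 3)).symm) ∘ e.extend (𝓡∂ 3)) e.source x _ :=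
    h2.comp x h1.hasMFDerivWithinAt (fun z hz => extend_mem hz)
  have h4 := h3.hasMFDerivAt (e.open_source.mem_nhds hx)
  have h5 := h4.congr_of_eventuallyEq (f₁ := f) (by
    filter_upwards [e.open_source.mem_nhds hx] with z hz
    simp only [Function.comp, symm_extend_eq hz])
  exact h5.mfderiv

theorem isHalfDomain_chart [IsManifold (𝓡∂ 3) ∞ M] {ρ : M → ℝ} (hρ : IsDefiningFunction ρ)
    {e : OpenPartialHomeomorph M H3} (he : e ∈ smoothCharts M) :
    IsHalfDomain (chartDom e) (ρ ∘ (e.extend (𝓡∂ 3)).symm) := by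
  have hsm : ContDiffOn ℝ ∞ (ρ ∘ (e.extend (𝓡∂ 3)).symm) (chartDom e) := by
    rw [← image_source, ← contDiffOn_comp_symm he subset_rfl]
    exact hρ.smooth.contMDiffOn
  refine ⟨exists_open_chartDom e, hsm, fun y hy hy0 => ?_, fun y hy hy0 => ?_, fun y hy hy0 h0 => ?_⟩
  · refine lt_of_le_of_ne (hρ.nonneg _) fun h => ?_
    have := (symm_mem_bdry he hy).1 ((hρ.zero_iff _).1 h.symm)
    exact hy0.ne' this
  · exact (hρ.zero_iff _).2 ((symm_mem_bdry he hy).2 hy0)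
  · refine hρ.deriv_ne_zero _ ((symm_mem_bdry he hy).2 hy0) ?_
    have h1 := mfderiv_eq_comp he (symm_mem hy) (f := ρ)
      (by rw [extend_symm_eq hy]; exact hsm.differentiableOn (by simp) y hy)
    rw [extend_symm_eq hy, h0] at h1
    rw [h1]
    exact ContinuousLinearMap.zero_comp _

end Charts

open scoped Manifold ContDiff ComplexConjugate Matrix


/-! ### Components of tensors -/

section Tensors

variable {M : Type*} [TopologicalSpace M] [ChartedSpace H3 M]

/-- The action of a change of frame on components. -/
noncomputable def frameChange {a b : ℕ} (P Q : Matrix (Fin 3) (Fin 3) ℝ) (f : Comp a b ℂ) :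
    Comp a b ℂ :=
  fun i j => ∑ k : Fin a → Fin 3, ∑ l : Fin b → Fin 3,
    (((∏ t, P (i t) (k t)) * (∏ t, Q (j t) (l t)) : ℝ) : ℂ) * f k l

theorem tensor_apply_eq_sum {a b : ℕ} {x : M} (T : TensorAt a b x)
    {θ : Fin 3 → Module.Dual ℝ (TangentSpace (𝓡∂ 3) x)} {v : Fin 3 → TangentSpace (𝓡∂ 3) x}
    {θ' : Fin a → Module.Dual ℝ (TangentSpace (𝓡∂ 3) x)} {v' : Fin b → TangentSpace (𝓡∂ 3) x}
    {P : Fin a → Fin 3 → ℝ} {Q : Fin b → Fin 3 → ℝ} (hθ : ∀ t, θ' t = ∑ k, P t k • θ k)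
    (hv : ∀ t, v' t = ∑ l, Q t l • v l) :
    T θ' v' = ∑ k : Fin a → Fin 3, ∑ l : Fin b → Fin 3,
      (((∏ t, P t (k t)) * (∏ t, Q t (l t)) : ℝ) : ℂ) * components θ v T k l := by
  obtain rfl : θ' = fun t => ∑ k, P t k • θ k := funext hθ
  obtain rfl : v' = fun t => ∑ l, Q t l • v l := funext hv
  rw [T.map_sum, sum_apply]
  refine Finset.sum_congr rfl fun k _ => ?_
  rw [T.map_smul_univ, smul_apply, MultilinearMap.map_sum,
    Finset.smul_sum]
  refine Finset.sum_congr rfl fun l _ => ?_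
  rw [MultilinearMap.map_smul_univ, smul_smul, Complex.real_smul]
  rfl

theorem components_eq_frameChange {a b : ℕ} {x : M} (T : TensorAt a b x)
    {θ θ' : Fin 3 → Module.Dual ℝ (TangentSpace (𝓡∂ 3) x)}
    {v v' : Fin 3 → TangentSpace (𝓡∂ 3) x} {P Q : Matrix (Fin 3) (Fin 3) ℝ}
    (hθ : ∀ i, θ' i = ∑ k, P i k • θ k) (hv : ∀ j, v' j = ∑ l, Q j l • v l) :
    components θ' v' T = frameChange P Q (components θ v T) := by
  funext i j
  exact tensor_apply_eq_sum T (fun t => hθ (i t)) (fun t => hv (j t))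

theorem coordComp_injective {a b : ℕ} {e : OpenPartialHomeomorph M H3} (he : e ∈ smoothCharts M)
    {x : M} (hx : x ∈ e.source) : Function.Injective (coordComp (a := a) (b := b) e x) := by
  refine (injective_iff_map_eq_zero _).2 fun T hT => ?_
  ext θ v
  have := tensor_apply_eq_sum T (θ := coordCovector e x) (v := coordVector e x) (θ' := θ) (v' := v)
    (fun t => eq_sum_coordCovector he hx (θ t)) (fun t => eq_sum_coordVector he hx (v t))
  rw [this]
  refine Finset.sum_eq_zero fun k _ => Finset.sum_eq_zero fun l _ => ?_
  rw [show components (coordCovector e x) (coordVector e x) T = 0 from hT]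
  simp

theorem prod_ite_eq_one {a : ℕ} (k l : Fin a → Fin 3) :
    (∏ t, if k t = l t then (1 : ℝ) else 0) = if k = l then 1 else 0 := by
  split_ifs with h
  · exact Finset.prod_eq_one fun t _ => by simp [h]
  · obtain ⟨t, ht⟩ := Function.ne_iff.1 h
    exact Finset.prod_eq_zero (Finset.mem_univ t) (by simp [ht])

/-- Products of dual basis elements realize every array of components. This is what allows a tensor
at a boundary point to be defined as a limit of components. -/
theorem coordComp_surjective {a b : ℕ} {e : OpenPartialHomeomorph M H3} (he : e ∈ smoothCharts M)
    {x : M} (hx : x ∈ e.source) : Function.Surjective (coordComp (a := a) (b := b) e x) := by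
  intro f
  let A (k : Fin a → Fin 3) : MultilinearMap ℝ
      (fun _ : Fin a => Module.Dual ℝ (TangentSpace (𝓡∂ 3) x)) ℝ :=
    (MultilinearMap.mkPiAlgebra ℝ (Fin a) ℝ).compLinearMap
      (fun t => Module.Dual.eval ℝ _ (coordVector e x (k t)))
  let D (l : Fin b → Fin 3) : MultilinearMap ℝ (fun _ : Fin b => TangentSpace (𝓡∂ 3) x) ℝ :=
    (MultilinearMap.mkPiAlgebra ℝ (Fin b) ℝ).compLinearMap (fun t => coordCovector e x (l t))
  have hA : ∀ k i : Fin a → Fin 3, A k (fun t => coordCovector e x (i t)) =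
      if i = k then 1 else 0 := fun k i => by
    simp only [A, MultilinearMap.compLinearMap_apply, MultilinearMap.mkPiAlgebra_apply,
      Module.Dual.eval_apply, coordCovector_coordVector he hx, prod_ite_eq_one]
  have hD : ∀ l j : Fin b → Fin 3, D l (fun t => coordVector e x (j t)) =
      if l = j then 1 else 0 := fun l j => by
    simp only [D, MultilinearMap.compLinearMap_apply, MultilinearMap.mkPiAlgebra_apply,
      coordCovector_coordVector he hx, prod_ite_eq_one]
  refine ⟨∑ k, (A k).smulRight (∑ l, (D l).smulRight (f k l)), ?_⟩
  funext i j
  change (∑ k, (A k).smulRight (∑ l, (D l).smulRight (f k l))) (fun t => coordCovector e x (i t))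
    (fun t => coordVector e x (j t)) = f i j
  simp only [sum_apply, MultilinearMap.smulRight_apply, smul_apply,
    hA, hD]
  simp

theorem tendsto_frameChange {a b : ℕ} {ι : Type*} {l : Filter ι}
    {P Q : ι → Matrix (Fin 3) (Fin 3) ℝ} {P₀ Q₀ : Matrix (Fin 3) (Fin 3) ℝ} {f : ι → Comp a b ℂ}
    {f₀ : Comp a b ℂ} (hP : ∀ i j, Tendsto (fun x => P x i j) l (𝓝 (P₀ i j)))
    (hQ : ∀ i j, Tendsto (fun x => Q x i j) l (𝓝 (Q₀ i j))) (hf : Tendsto f l (𝓝 f₀)) :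
    Tendsto (fun x => frameChange (P x) (Q x) (f x)) l (𝓝 (frameChange P₀ Q₀ f₀)) := by
  refine tendsto_pi_nhds.2 fun i => tendsto_pi_nhds.2 fun j => ?_
  refine tendsto_finsetSum _ fun k _ => tendsto_finsetSum _ fun m _ => ?_
  refine Tendsto.mul ?_ ((tendsto_pi_nhds.1 (tendsto_pi_nhds.1 hf k)) m)
  exact (Complex.continuous_ofReal.tendsto _).comp
    ((tendsto_finsetProd _ fun t _ => hP _ _).mul (tendsto_finsetProd _ fun t _ => hQ _ _))

/-! ### Regularity in charts -/

theorem isOfClassOn_univ_iff {a b : ℕ} {n : ℕ∞} {u : TensorField M a b} :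
    IsOfClassOn n univ u ↔ ∀ e ∈ smoothCharts M, ContDiffOn ℝ n (coordRep e u) (chartDom e) := by
  refine forall₂_congr fun e he => ?_
  rw [inter_univ, contDiffOn_comp_symm he subset_rfl, image_source]
  rfl

theorem isOfClassOn_int_iff [IsManifold (𝓡∂ 3) ∞ M] {a b : ℕ} {n : ℕ∞} {u : TensorField M a b} :
    IsOfClassOn n (int M) u ↔
      ∀ e ∈ smoothCharts M, ContDiffOn ℝ n (coordRep e u) (inn (chartDom e)) := by
  refine forall₂_congr fun e he => ?_
  rw [contDiffOn_comp_symm he inter_subset_left, image_source_int he]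
  rfl

/-! ### Smoothness of coordinate frames -/

variable [IsManifold (𝓡∂ 3) ∞ M]

theorem contMDiffOn_symm' {e : OpenPartialHomeomorph M H3} (he : e ∈ smoothCharts M) :
    ContMDiffOn 𝓘(ℝ, E3) (𝓡∂ 3) ∞ (e.extend (𝓡∂ 3)).symm (chartDom e) := by
  have h := contMDiffOn_extend_symm (I := 𝓡∂ 3) he
  rwa [← e.extend_target'] at h

/-- Coordinate vectors are images of constant vectors under the differential of the inverse chart,
so their smoothness reduces to that of its tangent map. The derivative is taken within the chart
domain because the latter may contain boundary points. -/
theorem mfderivWithin_symm_single {e : OpenPartialHomeomorph M H3} (he : e ∈ smoothCharts M) {y : E3}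
    (hy : y ∈ chartDom e) (i : Fin 3) :
    mfderivWithin 𝓘(ℝ, E3) (𝓡∂ 3) (e.extend (𝓡∂ 3)).symm (chartDom e) y
      (EuclideanSpace.single i (1 : ℝ) : E3) = coordVector e ((e.extend (𝓡∂ 3)).symm y) i := by
  have hu : UniqueMDiffWithinAt 𝓘(ℝ, E3) (chartDom e) y :=
    (uniqueDiffOn_chartDom e y hy).uniqueMDiffWithinAt
  have h1 : MDifferentiableWithinAt 𝓘(ℝ, E3) (𝓡∂ 3) (e.extend (𝓡∂ 3)).symm (chartDom e) y :=
    (contMDiffOn_symm' he).mdifferentiableOn (by simp) y hy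
  have h2 : HasMFDerivAt (𝓡∂ 3) 𝓘(ℝ, E3) (e.extend (𝓡∂ 3)) ((e.extend (𝓡∂ 3)).symm y)
      (chartDiff e ((e.extend (𝓡∂ 3)).symm y)) := by
    have := ((𝓡∂ 3).hasMFDerivAt (x := e ((e.extend (𝓡∂ 3)).symm y))).comp _
      ((mdifferentiable_chart he).mdifferentiableAt (symm_mem hy)).hasMFDerivAt
    exact this.mdifferentiableAt.hasMFDerivAt
  have h3 := h2.comp_hasMFDerivWithinAt y h1.hasMFDerivWithinAt
  have h4 : HasMFDerivWithinAt 𝓘(ℝ, E3) 𝓘(ℝ, E3) (e.extend (𝓡∂ 3) ∘ (e.extend (𝓡∂ 3)).symm)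
      (chartDom e) y (ContinuousLinearMap.id ℝ E3) :=
    (hasMFDerivWithinAt_id (I := 𝓘(ℝ, E3)) (chartDom e) y).congr_of_eventuallyEq
      (by filter_upwards [self_mem_nhdsWithin] with z hz using extend_symm_eq hz)
      (extend_symm_eq hy)
  have h5 := hu.eq h3 h4
  obtain ⟨L, hL⟩ := isInvertible_chartDiff he (symm_mem hy)
  have hinj : Function.Injective (chartDiff e ((e.extend (𝓡∂ 3)).symm y)) := by
    rw [← hL]; exact L.injective
  refine hinj ?_
  rw [chartDiff_coordVector he (symm_mem hy)]
  exact congrArg (fun L : E3 →L[ℝ] E3 => L (EuclideanSpace.single i 1)) h5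

theorem contMDiffOn_coordVector {e : OpenPartialHomeomorph M H3} (he : e ∈ smoothCharts M)
    (i : Fin 3) : ContMDiffOn 𝓘(ℝ, E3) ((𝓡∂ 3).prod 𝓘(ℝ, E3)) ∞
      (fun y => (⟨(e.extend (𝓡∂ 3)).symm y, coordVector e ((e.extend (𝓡∂ 3)).symm y) i⟩ :
        TangentBundle (𝓡∂ 3) M)) (chartDom e) := by
  have h1 := (contMDiffOn_symm' he).contMDiffOn_tangentMapWithin (m := ∞) (by simp)
    (uniqueDiffOn_chartDom e).uniqueMDiffOn
  have h2 : ContMDiffOn 𝓘(ℝ, E3) (𝓘(ℝ, E3).prod 𝓘(ℝ, E3)) ∞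
      (fun y : E3 => (⟨y, EuclideanSpace.single i (1 : ℝ)⟩ : TangentBundle 𝓘(ℝ, E3) E3))
      (chartDom e) := fun y _ =>
    ((contMDiffAt_vectorSpace_iff_contDiffAt
      (V := fun _ => (EuclideanSpace.single i (1 : ℝ) : E3))).2 contDiffAt_const).contMDiffWithinAt
  refine (h1.comp h2 fun y hy => hy).congr fun y hy => ?_
  rw [← mfderivWithin_symm_single he hy i]
  rfl

/-- The components of `gbar` in coordinates. -/
noncomputable def gbarMatrix (gbar : SmoothMetric M) (e : OpenPartialHomeomorph M H3) (x : M) :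
    Matrix (Fin 3) (Fin 3) ℝ :=
  fun i j => gbar.inner x (coordVector e x i) (coordVector e x j)

theorem contDiffOn_gbarMatrix (gbar : SmoothMetric M) {e : OpenPartialHomeomorph M H3}
    (he : e ∈ smoothCharts M) (i j : Fin 3) :
    ContDiffOn ℝ ∞ (fun y => gbarMatrix gbar e ((e.extend (𝓡∂ 3)).symm y) i j) (chartDom e) := by
  rw [← contMDiffOn_iff_contDiffOn]
  have h0 : ContMDiffOn 𝓘(ℝ, E3) ((𝓡∂ 3).prod 𝓘(ℝ, E3 →L[ℝ] E3 →L[ℝ] ℝ)) ∞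
      (fun y => Bundle.TotalSpace.mk' (E3 →L[ℝ] E3 →L[ℝ] ℝ)
        (E := fun x : M => TangentSpace (𝓡∂ 3) x →L[ℝ] TangentSpace (𝓡∂ 3) x →L[ℝ] ℝ)
        ((e.extend (𝓡∂ 3)).symm y) (gbar.inner ((e.extend (𝓡∂ 3)).symm y))) (chartDom e) :=
    gbar.contMDiff.comp_contMDiffOn (contMDiffOn_symm' he)
  have h1 := ContMDiffOn.clm_bundle_apply₂ (F₁ := E3) (F₂ := E3) (F₃ := ℝ)
    (E₁ := fun x : M => TangentSpace (𝓡∂ 3) x) (E₂ := fun x : M => TangentSpace (𝓡∂ 3) x)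
    (E₃ := Bundle.Trivial M ℝ) h0
    (contMDiffOn_coordVector he i) (contMDiffOn_coordVector he j)
  intro y hy
  have h2 := h1 y hy
  simp only [Bundle.contMDiffWithinAt_totalSpace] at h2
  exact h2.2

theorem gbarMatrix_posDef (gbar : SmoothMetric M) {e : OpenPartialHomeomorph M H3}
    (he : e ∈ smoothCharts M) {x : M} (hx : x ∈ e.source) : (gbarMatrix gbar e x).PosDef := by
  refine Matrix.PosDef.of_dotProduct_mulVec_pos
    (Matrix.IsHermitian.ext fun i j => gbar.symm x _ _) fun c hc => ?_
  have h1 : star c ⬝ᵥ gbarMatrix gbar e x *ᵥ c =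
      gbar.inner x (∑ i, c i • coordVector e x i) (∑ j, c j • coordVector e x j) := by
    simp only [map_sum, map_smul, sum_apply, smul_apply, dotProduct, Matrix.mulVec, gbarMatrix,
      Pi.star_apply, star_trivial, Finset.mul_sum, smul_eq_mul]
    rw [Finset.sum_comm]
    refine Finset.sum_congr rfl fun i _ => Finset.sum_congr rfl fun j _ => by ring
  rw [h1]
  refine gbar.pos x _ fun h0 => hc ?_
  funext i
  have h2 := congrArg (coordCovector e x i) h0
  simpa [map_sum, map_smul, coordCovector_coordVector he hx] using h2

/-- The frame of one chart in the frame of another depends continuously on the point. -/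
theorem continuousAt_coordCovector_coordVector {e e' : OpenPartialHomeomorph M H3}
    (he : e ∈ smoothCharts M) (he' : e' ∈ smoothCharts M) {x : M} (hx : x ∈ e.source)
    (hx' : x ∈ e'.source) (i j : Fin 3) :
    ContinuousAt (fun z => coordCovector e' z i (coordVector e z j)) x := by
  set f : E3 → E3 := e'.extend (𝓡∂ 3) ∘ (e.extend (𝓡∂ 3)).symm with hf
  have hd : ∀ z ∈ e.source, z ∈ e'.source →
      ContDiffWithinAt ℝ ∞ f (chartDom e) (e.extend (𝓡∂ 3) z) := by
    intro z hz hz'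
    have h1 : ContMDiffOn (𝓡∂ 3) 𝓘(ℝ, E3) ∞ (e'.extend (𝓡∂ 3)) (e.source ∩ e'.source) :=
      (OpenPartialHomeomorph.contMDiffOn_extend he').mono inter_subset_right
    have h2 := (contDiffOn_comp_symm (n := ⊤) he inter_subset_left).1 h1 _ ⟨z, ⟨hz, hz'⟩, rfl⟩
    refine h2.mono_of_mem_nhdsWithin ?_
    have h3 := (continuousOn_symm e _ (extend_mem hz)).preimage_mem_nhdsWithin
      (e'.open_source.mem_nhds (by rwa [symm_extend_eq hz]))
    filter_upwards [h3, self_mem_nhdsWithin] with w hw hw'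
    exact ⟨_, ⟨symm_mem hw', hw⟩, extend_symm_eq hw'⟩
  have hev : (fun z => fderivWithin ℝ f (chartDom e) (e.extend (𝓡∂ 3) z)
      (EuclideanSpace.single j (1 : ℝ)) i) =ᶠ[𝓝 x]
      fun z => coordCovector e' z i (coordVector e z j) := by
    filter_upwards [e.open_source.mem_nhds hx, e'.open_source.mem_nhds hx'] with z hz hz'
    have h1 : chartDiff e' z = _ :=
      mfderiv_eq_comp he hz ((hd z hz hz').differentiableWithinAt (by simp))
    rw [← chartDiff_coordVector he hz j]
    exact (congrArg (fun L : TangentSpace (𝓡∂ 3) z →L[ℝ] E3 => L (coordVector e z j) i) h1).symm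
  refine ContinuousAt.congr ?_ hev
  have h4 := ((hd x hx hx').fderivWithin_right (m := 0) (uniqueDiffOn_chartDom e) (by simp)
    (extend_mem hx)).continuousWithinAt
  have h5 : Tendsto (e.extend (𝓡∂ 3)) (𝓝 x) (𝓝[chartDom e] (e.extend (𝓡∂ 3) x)) := by
    refine tendsto_nhdsWithin_iff.2 ⟨e.continuousAt_extend (I := 𝓡∂ 3) hx, ?_⟩
    filter_upwards [e.open_source.mem_nhds hx] with z hz using extend_mem hz
  have h6 := h4.tendsto.comp h5
  have h7 : Continuous fun L : E3 →L[ℝ] E3 => L (EuclideanSpace.single j (1 : ℝ)) i :=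
    (EuclideanSpace.proj i : E3 →L[ℝ] ℝ).continuous.comp
      (ContinuousLinearMap.apply ℝ E3 (EuclideanSpace.single j (1 : ℝ))).continuous
  exact (h7.tendsto _).comp h6

end Tensors

open scoped Manifold ContDiff ComplexConjugate Matrix


/-! ### Orthonormal frames and fibres -/

section Orthonormalize

open scoped Matrix.Norms.Operator

/-- Symmetric matrices close to the identity are orthonormalized by matrices close to the
identity. -/
theorem exists_orthonormalizing {ι : Type*} {l : Filter ι} {S : ι → Matrix (Fin 3) (Fin 3) ℝ}
    (hS : Tendsto S l (𝓝 1)) (hsymm : ∀ z, (S z)ᵀ = S z) :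
    ∃ C : ι → Matrix (Fin 3) (Fin 3) ℝ, Tendsto C l (𝓝 1) ∧
      ∀ᶠ z in l, C z * S z * (C z)ᵀ = 1 := by
  let f : Matrix (Fin 3) (Fin 3) ℝ → Matrix (Fin 3) (Fin 3) ℝ := fun A => A * A
  -- The derivative of A ↦ A² at the identity is multiplication by 2, so the inverse function
  -- theorem gives a square root g near 1. The orthonormalizing matrix is C = g(S⁻¹).
  let L : Matrix (Fin 3) (Fin 3) ℝ ≃L[ℝ] Matrix (Fin 3) (Fin 3) ℝ :=
    ContinuousLinearEquiv.smulLeft (Units.mk0 (2 : ℝ) two_ne_zero)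
  have hf : HasStrictFDerivAt f (L : Matrix (Fin 3) (Fin 3) ℝ →L[ℝ] Matrix (Fin 3) (Fin 3) ℝ) 1 := by
    have h := (hasStrictFDerivAt_id (𝕜 := ℝ) (1 : Matrix (Fin 3) (Fin 3) ℝ)).mul'
      (hasStrictFDerivAt_id (𝕜 := ℝ) (1 : Matrix (Fin 3) (Fin 3) ℝ))
    refine h.congr_fderiv ?_
    ext1 A
    change (1 : Matrix (Fin 3) (Fin 3) ℝ) * A + A * 1 = (2 : ℝ) • A
    rw [one_mul, mul_one, two_smul]
  have hf1 : f 1 = 1 := one_mul 1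
  set g := hf.localInverse f L 1 with hg
  have hgc : Tendsto g (𝓝 1) (𝓝 1) := by
    have h := hf.localInverse_continuousAt
    rw [ContinuousAt, hf.localInverse_apply_image, hf1] at h
    exact h
  have hgr : ∀ᶠ A in 𝓝 (1 : Matrix (Fin 3) (Fin 3) ℝ), g A * g A = A := by
    have h := hf.eventually_right_inverse
    rwa [hf1] at h
  have hgl : ∀ᶠ A in 𝓝 (1 : Matrix (Fin 3) (Fin 3) ℝ), g (A * A) = A :=
    hf.eventually_left_inverse
  have hT : Tendsto (fun A : Matrix (Fin 3) (Fin 3) ℝ => Aᵀ) (𝓝 1) (𝓝 1) := by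
    have := (continuous_id.matrix_transpose (A := fun A : Matrix (Fin 3) (Fin 3) ℝ => A)).tendsto 1
    rwa [Matrix.transpose_one] at this
  have hdet : ∀ᶠ z in l, IsUnit (S z).det := by
    have h1 : Tendsto (fun z => (S z).det) l (𝓝 1) := by
      have h2 := ((continuous_id.matrix_det (A := fun A : Matrix (Fin 3) (Fin 3) ℝ => A)).tendsto
        1).comp hS
      rwa [Matrix.det_one] at h2
    filter_upwards [h1.eventually_ne one_ne_zero] with z hz using isUnit_iff_ne_zero.2 hz
  have hinv : Tendsto (fun z => (S z)⁻¹) l (𝓝 1) := by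
    have h1 : ContinuousAt Ring.inverse (1 : Matrix (Fin 3) (Fin 3) ℝ) :=
      NormedRing.inverse_continuousAt 1
    have h2 := h1.tendsto.comp hS
    simp only [Ring.inverse_one] at h2
    refine h2.congr fun z => ?_
    simp [Matrix.nonsing_inv_eq_ringInverse]
  refine ⟨fun z => g (S z)⁻¹, hgc.comp hinv, ?_⟩
  filter_upwards [hdet, hinv.eventually hgr, (hT.comp (hgc.comp hinv)).eventually hgl]
    with z hz h1 h2
  -- The transpose of the root is again a square root of the symmetric matrix S⁻¹ near 1, and such a
  -- root is unique.
  have h3 : (g (S z)⁻¹)ᵀ = g (S z)⁻¹ := by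
    have h4 : g ((g (S z)⁻¹)ᵀ * (g (S z)⁻¹)ᵀ) = (g (S z)⁻¹)ᵀ := h2
    rw [← Matrix.transpose_mul, h1, Matrix.transpose_nonsing_inv, hsymm] at h4
    exact h4.symm
  rw [h3]
  refine mul_eq_one_comm.1 ?_
  rw [← mul_assoc, h1, Matrix.nonsing_inv_mul _ hz]

end Orthonormalize

section Fibre

variable {M : Type*} [TopologicalSpace M] [ChartedSpace H3 M] [IsManifold (𝓡∂ 3) ∞ M]

theorem inner_sum_coordVector (gbar : SmoothMetric M) (e : OpenPartialHomeomorph M H3) (x : M)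
    (c d : Fin 3 → ℝ) :
    gbar.inner x (∑ i, c i • coordVector e x i) (∑ j, d j • coordVector e x j) =
      ∑ i, ∑ j, c i * gbarMatrix gbar e x i j * d j := by
  simp only [map_sum, map_smul, sum_apply, smul_apply, gbarMatrix, smul_eq_mul]
  simp only [Finset.mul_sum]
  rw [Finset.sum_comm]
  exact Finset.sum_congr rfl fun i _ => Finset.sum_congr rfl fun j _ => by ring

theorem basis_coord_eq_inner (gbar : SmoothMetric M) {x : M}
    (f : Module.Basis (Fin 3) ℝ (TangentSpace (𝓡∂ 3) x))
    (hf : ∀ i j, gbar.inner x (f i) (f j) = if i = j then 1 else 0) (i : Fin 3)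
    (v : TangentSpace (𝓡∂ 3) x) : f.coord i v = gbar.inner x (f i) v := by
  have h := congrArg (gbar.inner x (f i)) (f.sum_repr v)
  rw [map_sum] at h
  rw [Module.Basis.coord_apply]
  simpa only [map_smul, hf, smul_eq_mul, mul_ite, mul_one, mul_zero, Finset.sum_ite_eq,
    Finset.mem_univ, if_true] using h

/-- The dual basis of an orthonormal frame consists of the covectors gbar(f_i, ·), so its matrix in
coordinates is R G when that of the frame is R. -/
theorem components_basis (gbar : SmoothMetric M) {a b : ℕ} {e : OpenPartialHomeomorph M H3}
    (he : e ∈ smoothCharts M) {x : M} (hx : x ∈ e.source)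
    (f : Module.Basis (Fin 3) ℝ (TangentSpace (𝓡∂ 3) x))
    (hf : ∀ i j, gbar.inner x (f i) (f j) = if i = j then 1 else 0)
    {R : Matrix (Fin 3) (Fin 3) ℝ} (hR : ∀ i, f i = ∑ k, R i k • coordVector e x k)
    (T : TensorAt a b x) : components (fun i => f.coord i) (fun i => f i) T =
      frameChange (R * gbarMatrix gbar e x) R (coordComp e x T) := by
  refine components_eq_frameChange T (fun i => ?_) hR
  conv_lhs => rw [eq_sum_coordCovector he hx (f.coord i)]
  refine Finset.sum_congr rfl fun k _ => ?_
  rw [basis_coord_eq_inner gbar f hf, hR]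
  congr 1
  simp [map_sum, map_smul, sum_apply, gbarMatrix, Matrix.mul_apply]

/-- The complexification of the space of allowed components. -/
abbrev TensorType.complexV (B : TensorType) : Submodule ℂ (Comp B.a B.b ℂ) :=
  Submodule.span ℂ ((fun c : Comp B.a B.b ℝ => fun i j => (c i j : ℂ)) '' (B.V : Set _))

/-- Orthonormal frames at x are the matrices R with R G Rᵀ = 1. In this form membership in the
bundle can be compared at different points. -/
theorem mem_fibre_iff (B : TensorType) (gbar : SmoothMetric M) {e : OpenPartialHomeomorph M H3}
    (he : e ∈ smoothCharts M) {x : M} (hx : x ∈ e.source) (T : TensorAt B.a B.b x) :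
    T ∈ B.fibre gbar x ↔ ∀ R : Matrix (Fin 3) (Fin 3) ℝ, R * gbarMatrix gbar e x * Rᵀ = 1 →
      frameChange (R * gbarMatrix gbar e x) R (coordComp e x T) ∈ B.complexV := by
  have hin : ∀ (R : Matrix (Fin 3) (Fin 3) ℝ) (i j : Fin 3),
      gbar.inner x (∑ k, R i k • coordVector e x k) (∑ k, R j k • coordVector e x k) =
        (R * gbarMatrix gbar e x * Rᵀ) i j := by
    intro R i j
    rw [inner_sum_coordVector, Finset.sum_comm]
    simp only [Matrix.mul_apply, Matrix.transpose_apply, Finset.sum_mul]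
  simp only [TensorType.fibre, Submodule.mem_iInf, Submodule.mem_comap]
  constructor
  · intro h R hR
    have ho : ∀ i j, gbar.inner x (∑ k, R i k • coordVector e x k)
        (∑ k, R j k • coordVector e x k) = if i = j then 1 else 0 := by
      intro i j
      rw [hin, hR, Matrix.one_apply]
    have hli : LinearIndependent ℝ fun i => ∑ k, R i k • coordVector e x k := by
      refine Fintype.linearIndependent_iff.2 fun c hc i => ?_
      have h1 := congrArg (gbar.inner x (∑ k, R i k • coordVector e x k)) hc
      rw [map_sum, map_zero] at h1
      simpa only [map_smul, ho, smul_eq_mul, mul_ite, mul_one, mul_zero, Finset.sum_ite_eq,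
        Finset.mem_univ, if_true] using h1
    have hcard : Fintype.card (Fin 3) = Module.finrank ℝ (TangentSpace (𝓡∂ 3) x) := by
      rw [Fintype.card_fin]
      exact (finrank_euclideanSpace_fin (𝕜 := ℝ) (n := 3)).symm
    let f := basisOfLinearIndependentOfCardEqFinrank hli hcard
    have hf : ∀ i, f i = ∑ k, R i k • coordVector e x k := fun i => by
      simp [f]
    have hfo : ∀ i j, gbar.inner x (f i) (f j) = if i = j then 1 else 0 := by
      intro i j
      rw [hf, hf, ho]
    have h2 := h f hfo
    rwa [components_basis gbar he hx f hfo hf] at h2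
  · intro h f hfo
    have hf : ∀ i, f i = ∑ k, (Matrix.of fun i k => coordCovector e x k (f i)) i k •
        coordVector e x k := fun i => eq_sum_coordVector he hx (f i)
    rw [components_basis gbar he hx f hfo hf]
    refine h _ ?_
    ext i j
    rw [← hin, ← hf, ← hf, hfo, Matrix.one_apply]

theorem continuousAt_gbarMatrix (gbar : SmoothMetric M) {e : OpenPartialHomeomorph M H3}
    (he : e ∈ smoothCharts M) {x : M} (hx : x ∈ e.source) :
    Tendsto (gbarMatrix gbar e) (𝓝 x) (𝓝 (gbarMatrix gbar e x)) := by
  refine tendsto_pi_nhds.2 fun i => tendsto_pi_nhds.2 fun j => ?_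
  have h1 := (contDiffOn_gbarMatrix gbar he i j).continuousOn _ (extend_mem hx)
  have h5 : Tendsto (e.extend (𝓡∂ 3)) (𝓝 x) (𝓝[chartDom e] (e.extend (𝓡∂ 3) x)) := by
    refine tendsto_nhdsWithin_iff.2 ⟨e.continuousAt_extend (I := 𝓡∂ 3) hx, ?_⟩
    filter_upwards [e.open_source.mem_nhds hx] with z hz using extend_mem hz
  have h2 := h1.tendsto.comp h5
  rw [symm_extend_eq hx] at h2
  refine h2.congr' ?_
  filter_upwards [e.open_source.mem_nhds hx] with z hz
  simp only [Function.comp, symm_extend_eq hz]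

/-- The bundle is closed. -/
theorem mem_fibre_of_tendsto (B : TensorType) (gbar : SmoothMetric M)
    {e : OpenPartialHomeomorph M H3} (he : e ∈ smoothCharts M) {x : M} (hx : x ∈ e.source)
    {l : Filter M} [l.NeBot] (hl : l ≤ 𝓝 x) {T : TensorField M B.a B.b}
    (hT : ∀ᶠ z in l, T z ∈ B.fibre gbar z) {T₀ : TensorAt B.a B.b x}
    (hlim : Tendsto (fun z => coordComp e z (T z)) l (𝓝 (coordComp e x T₀))) :
    T₀ ∈ B.fibre gbar x := by
  rw [mem_fibre_iff B gbar he hx]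
  intro R hR
  have hG := (continuousAt_gbarMatrix gbar he hx).mono_left hl
  have hGs : ∀ z, (gbarMatrix gbar e z)ᵀ = gbarMatrix gbar e z := fun z => by
    ext i j; exact gbar.symm z _ _
  have hS : Tendsto (fun z => R * gbarMatrix gbar e z * Rᵀ) l (𝓝 1) := by
    rw [← hR]
    exact (tendsto_const_nhds.mul hG).mul tendsto_const_nhds
  -- An orthonormal frame R at x is corrected to C(z) R, orthonormal at nearby z and converging to
  -- R. The components in these frames lie in a fixed finite-dimensional, hence closed, subspace.
  obtain ⟨C, hC, hCe⟩ := exists_orthonormalizing hS fun z => by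
    simp only [Matrix.transpose_mul, Matrix.transpose_transpose, hGs, mul_assoc]
  have hCR : Tendsto (fun z => C z * R) l (𝓝 R) := by
    have := hC.mul (tendsto_const_nhds (x := R))
    rwa [one_mul] at this
  have hW : IsClosed (B.complexV : Set (Comp B.a B.b ℂ)) := Submodule.closed_of_finiteDimensional _
  have hent : ∀ {A : M → Matrix (Fin 3) (Fin 3) ℝ} {A₀ : Matrix (Fin 3) (Fin 3) ℝ},
      Tendsto A l (𝓝 A₀) → ∀ i j, Tendsto (fun z => A z i j) l (𝓝 (A₀ i j)) := fun h i j =>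
    tendsto_pi_nhds.1 (tendsto_pi_nhds.1 h i) j
  refine hW.mem_of_tendsto (tendsto_frameChange (hent (hCR.mul hG)) (hent hCR) hlim) ?_
  filter_upwards [hCe, hT, hl (e.open_source.mem_nhds hx)] with z hz hTz hze
  refine (mem_fibre_iff B gbar he hze _).1 hTz _ ?_
  rw [← hz, Matrix.transpose_mul]
  simp only [mul_assoc]

/-! ### Division of sections by the defining function -/

theorem coordComp_eq_frameChange {a b : ℕ} {e e' : OpenPartialHomeomorph M H3}
    (he : e ∈ smoothCharts M) {x : M} (hx : x ∈ e.source)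
    (T : TensorAt a b x) : coordComp e' x T =
      frameChange (fun i k => coordCovector e' x i (coordVector e x k))
        (fun j l => coordCovector e x l (coordVector e' x j)) (coordComp e x T) :=
  components_eq_frameChange T (fun _ => eq_sum_coordCovector he hx _)
    (fun _ => eq_sum_coordVector he hx _)

/-- Limits of components in different charts. -/
theorem tendsto_coordComp {a b : ℕ} {e e' : OpenPartialHomeomorph M H3} (he : e ∈ smoothCharts M)
    (he' : e' ∈ smoothCharts M) {x : M} (hx : x ∈ e.source) (hx' : x ∈ e'.source) {l : Filter M}
    (hl : l ≤ 𝓝 x) {T : TensorField M a b} {T₀ : TensorAt a b x}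
    (hlim : Tendsto (fun z => coordComp e z (T z)) l (𝓝 (coordComp e x T₀))) :
    Tendsto (fun z => coordComp e' z (T z)) l (𝓝 (coordComp e' x T₀)) := by
  rw [coordComp_eq_frameChange he hx T₀ (e' := e')]
  refine (tendsto_frameChange
    (fun _ _ => (continuousAt_coordCovector_coordVector he he' hx hx' _ _).mono_left hl)
    (fun _ _ => (continuousAt_coordCovector_coordVector he' he hx' hx _ _).mono_left hl)
    hlim).congr' ?_
  filter_upwards [hl (e.open_source.mem_nhds hx)] with z hz
  exact (coordComp_eq_frameChange he hz (T z)).symm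

theorem neBot_nhdsWithin_int {ρ : M → ℝ} (hρ : IsDefiningFunction ρ) (x : M) :
    (𝓝[int M] x).NeBot := by
  have he := IsManifold.chart_mem_maximalAtlas (I := 𝓡∂ 3) (n := ∞) x
  have hx := mem_chart_source H3 x
  have h1 := (isHalfDomain_chart hρ he).neBot (extend_mem hx)
  have h2 := tendsto_symm he (extend_mem hx)
  rw [symm_extend_eq hx] at h2
  exact h2.neBot

/-- A section that vanishes on the boundary is divisible by the defining function. -/
theorem IsSection.exists_eq_smul {B : TensorType} {gbar : SmoothMetric M} {ρ : M → ℝ}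
    (hρ : IsDefiningFunction ρ) {c : TensorField M B.a B.b} (hc : IsSection B gbar univ c)
    (hc0 : ∀ x ∈ bdry M, c x = 0) :
    ∃ d : TensorField M B.a B.b, IsSection B gbar univ d ∧ ∀ x, c x = (ρ x : ℂ) • d x := by
  have hdiv : ∀ e ∈ smoothCharts M, ∃ f : E3 → Comp B.a B.b ℂ, ContDiffOn ℝ ∞ f (chartDom e) ∧
      ∀ y ∈ chartDom e, coordRep e c y = (ρ ((e.extend (𝓡∂ 3)).symm y)) • f y := by
    intro e he
    refine (isHalfDomain_chart hρ he).exists_eq_smul (isOfClassOn_univ_iff.1 hc.smooth e he) ?_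
    intro y hy hy0
    rw [coordRep, hc0 _ ((symm_mem_bdry he hy).2 hy0), map_zero]
  choose! f hf hfe using hdiv
  have hchart : ∀ x : M, chartAt H3 x ∈ smoothCharts M := fun x =>
    IsManifold.chart_mem_maximalAtlas x
  classical
  -- On the boundary the quotient is defined by its components in the preferred chart. That these
  -- are the right components in every chart is shown below.
  let d : TensorField M B.a B.b := fun x => if x ∈ int M then ((ρ x : ℂ))⁻¹ • c x else
    (coordComp_surjective (hchart x) (mem_chart_source H3 x)
      (f (chartAt H3 x) ((chartAt H3 x).extend (𝓡∂ 3) x))).choose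
  have hρint : ∀ x ∈ int M, ρ x ≠ 0 := fun x hx h0 => by
    have h1 := (hρ.zero_iff x).1 h0
    exact ((𝓡∂ 3).isBoundaryPoint_iff_not_isInteriorPoint x).1 h1 hx
  have hd_int : ∀ e ∈ smoothCharts M, ∀ x ∈ e.source, x ∈ int M →
      coordComp e x (d x) = f e (e.extend (𝓡∂ 3) x) := by
    intro e he x hx hxi
    simp only [d, if_pos hxi, map_smul]
    have h1 := hfe e he _ (extend_mem hx)
    rw [coordRep, symm_extend_eq hx] at h1
    rw [h1, ← algebraMap_smul ℂ (ρ x), smul_smul]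
    rw [show (algebraMap ℝ ℂ (ρ x)) = (ρ x : ℂ) from rfl,
      inv_mul_cancel₀ (by exact_mod_cast hρint x hxi), one_smul]
  have hlim : ∀ e ∈ smoothCharts M, ∀ x ∈ e.source, Tendsto (fun z => coordComp e z (d z))
      (𝓝[int M] x) (𝓝 (f e (e.extend (𝓡∂ 3) x))) := by
    intro e he x hx
    have h1 : Tendsto (f e) (𝓝[inn (chartDom e)] (e.extend (𝓡∂ 3) x)) _ :=
      ((hf e he).continuousOn _ (extend_mem hx)).mono inter_subset_left
    refine (h1.comp (tendsto_extend he hx)).congr' ?_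
    filter_upwards [self_mem_nhdsWithin, mem_nhdsWithin_of_mem_nhds (e.open_source.mem_nhds hx)]
      with z hz hze
    exact (hd_int e he z hze hz).symm
  have hd_chart : ∀ x, coordComp (chartAt H3 x) x (d x) =
      f (chartAt H3 x) ((chartAt H3 x).extend (𝓡∂ 3) x) := by
    intro x
    by_cases hx : x ∈ int M
    · exact hd_int _ (hchart x) x (mem_chart_source H3 x) hx
    · simp only [d, if_neg hx]
      exact (coordComp_surjective (hchart x) (mem_chart_source H3 x) _).choose_spec
  -- The boundary value is the limit of the quotient from the interior, and limits of components
  -- transform correctly between charts.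
  have hd : ∀ e ∈ smoothCharts M, ∀ x ∈ e.source,
      coordComp e x (d x) = f e (e.extend (𝓡∂ 3) x) := by
    intro e he x hx
    have := neBot_nhdsWithin_int hρ x
    have h1 := hlim _ (hchart x) x (mem_chart_source H3 x)
    rw [← hd_chart x] at h1
    have h2 := tendsto_coordComp (hchart x) he (mem_chart_source H3 x) hx nhdsWithin_le_nhds h1
    exact tendsto_nhds_unique h2 (hlim e he x hx)
  refine ⟨d, ⟨isOfClassOn_univ_iff.2 fun e he => (hf e he).congr fun y hy => ?_, fun x _ => ?_⟩, ?_⟩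
  · rw [coordRep, hd e he _ (symm_mem hy), extend_symm_eq hy]
  · have := neBot_nhdsWithin_int hρ x
    have h1 := hlim _ (hchart x) x (mem_chart_source H3 x)
    rw [← hd_chart x] at h1
    refine mem_fibre_of_tendsto B gbar (hchart x) (mem_chart_source H3 x) nhdsWithin_le_nhds ?_ h1
    filter_upwards [self_mem_nhdsWithin] with z hz
    simp only [d, if_pos hz]
    exact Submodule.smul_mem _ _ (hc.mem z (mem_univ z))
  · intro x
    refine coordComp_injective (hchart x) (mem_chart_source H3 x) ?_
    rw [map_smul, hd_chart]
    have h1 := hfe _ (hchart x) _ (extend_mem (mem_chart_source H3 x))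
    rw [coordRep, symm_extend_eq (mem_chart_source H3 x)] at h1
    rw [h1, ← algebraMap_smul ℂ (ρ x)]
    rfl

end Fibre

open scoped Manifold ContDiff ComplexConjugate Matrix Polynomial


/-! ### Iterated partial derivatives -/

section PartialDeriv

variable {Ω : Set E3} {r : E3 → ℝ} {F : Type} [NormedAddCommGroup F] [NormedSpace ℝ F]

theorem partialDeriv_zero (κ : Fin 0 → Fin 3) (f : E3 → F) : partialDeriv κ f = f := by
  funext y
  rw [partialDeriv, iteratedFDeriv_zero_apply]

theorem partialDeriv_succ {m : ℕ} (κ : Fin (m + 1) → Fin 3) {f : E3 → F} {y : E3}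
    (hf : ContDiffAt ℝ ∞ f y) : partialDeriv κ f y =
      fderiv ℝ (partialDeriv (Fin.tail κ) f) y (EuclideanSpace.single (κ 0) (1 : ℝ)) := by
  have hd : DifferentiableAt ℝ (iteratedFDeriv ℝ m f) y :=
    hf.differentiableAt_iteratedFDeriv (by exact_mod_cast ENat.natCast_lt_top m)
  have h1 := ((ContinuousMultilinearMap.apply ℝ (fun _ : Fin m => E3) F
    (fun t => EuclideanSpace.single (Fin.tail κ t) (1 : ℝ))).hasFDerivAt
      (x := iteratedFDeriv ℝ m f y)).comp y hd.hasFDerivAt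
  have h2 : HasFDerivAt (partialDeriv (Fin.tail κ) f) _ y := h1
  rw [h2.fderiv, partialDeriv, iteratedFDeriv_succ_apply_left]
  rfl

theorem partialDeriv_add {m : ℕ} (κ : Fin m → Fin 3) {f g : E3 → F} {y : E3}
    (hf : ContDiffAt ℝ ∞ f y) (hg : ContDiffAt ℝ ∞ g y) :
    partialDeriv κ (fun z => f z + g z) y = partialDeriv κ f y + partialDeriv κ g y := by
  have h := iteratedFDeriv_add_apply (hf.of_le (m := m) (by exact_mod_cast le_top))
    (hg.of_le (m := m) (by exact_mod_cast le_top))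
  rw [partialDeriv, partialDeriv, partialDeriv]
  exact congrArg (fun L : E3 [×m]→L[ℝ] F => L fun t => EuclideanSpace.single (κ t) (1 : ℝ)) h

theorem IsLaurent.partialDeriv (hr : IsHalfDomain Ω r) {m N : ℕ} (κ : Fin m → Fin 3) {f : E3 → F}
    (hf : IsLaurent Ω r N f) : IsLaurent Ω r (N + m) (partialDeriv κ f) := by
  induction m with
  | zero => rwa [partialDeriv_zero]
  | succ m ih =>
    refine IsLaurent.congr (((ih (Fin.tail κ)).fderiv hr).clm
      (ContinuousLinearMap.apply ℝ F (EuclideanSpace.single (κ 0) (1 : ℝ)))) fun y hy => ?_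
    exact partialDeriv_succ κ ((hf.contDiffOn hr).contDiffAt (hr.isOpen_inn.mem_nhds hy))

theorem IsLogFamily.partialDeriv [NormedSpace ℂ F] [IsScalarTower ℝ ℂ F] (hr : IsHalfDomain Ω r)
    {m J : ℕ} (κ : Fin m → Fin 3) {Φ : ℂ → ℂ[X] → E3 → F} (hΦ : IsLogFamily Ω r J Φ) :
    IsLogFamily Ω r (J + m) (fun s Q => partialDeriv κ (Φ s Q)) := by
  induction m with
  | zero => exact hΦ.congr fun s Q y _ => by rw [partialDeriv_zero]
  | succ m ih =>
    refine IsLogFamily.congr (((ih (Fin.tail κ)).fderiv hr).clm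
      (ContinuousLinearMap.apply ℝ F (EuclideanSpace.single (κ 0) (1 : ℝ)))
      (fun _ _ => rfl)) fun s Q y hy => ?_
    exact partialDeriv_succ κ ((hΦ.contDiffOn hr s Q).contDiffAt (hr.isOpen_inn.mem_nhds hy))

theorem HasOrder.clm (hr : IsHalfDomain Ω r) {G : Type} [NormedAddCommGroup G] [NormedSpace ℝ G]
    {K : ℝ} {f : E3 → F} (hf : HasOrder Ω r K f) (L : F →L[ℝ] G) :
    HasOrder Ω r K (fun y => L (f y)) := by
  refine ⟨L.contDiff.comp_contDiffOn hf.smooth, fun C hC hCc j => ?_⟩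
  obtain ⟨A, hA⟩ := hf.bound C hC hCc j
  refine ⟨‖L‖ * A, fun y hy => ?_⟩
  refine (L.norm_iteratedFDeriv_comp_left (hf.contDiffAt hr hy.2)
    (by exact_mod_cast le_top)).trans ?_
  rw [mul_assoc]
  exact mul_le_mul_of_nonneg_left (hA y hy) (norm_nonneg _)

theorem HasOrder.partialDeriv (hr : IsHalfDomain Ω r) {m : ℕ} {K : ℝ} (κ : Fin m → Fin 3)
    {f : E3 → F} (hf : HasOrder Ω r K f) : HasOrder Ω r (K - m) (partialDeriv κ f) := by
  induction m with
  | zero => simpa only [partialDeriv_zero, Nat.cast_zero, sub_zero] using hf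
  | succ m ih =>
    have h := ((ih (Fin.tail κ)).fderiv hr).clm hr
      (ContinuousLinearMap.apply ℝ F (EuclideanSpace.single (κ 0) (1 : ℝ)))
    rw [show K - ((m + 1 : ℕ) : ℝ) = K - m - 1 by push_cast; ring]
    exact h.congr hr fun y hy => partialDeriv_succ κ (hf.contDiffAt hr hy)

end PartialDeriv

/-! ### Second-order operators in coordinates -/

section LocalOp

variable {Ω : Set E3} {r : E3 → ℝ} {a b : ℕ}

/-- Coefficients of second-order operators on arrays of components. -/
abbrev OpCoeff (a b : ℕ) : Type :=
  ∀ m : Fin (2 + 1), (Fin m → Fin 3) → (Fin a → Fin 3) → (Fin b → Fin 3) → (Fin a → Fin 3) →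
    (Fin b → Fin 3) → E3 → ℝ

/-- The second-order operator with given coefficients. -/
noncomputable def localOp (α : OpCoeff a b) (f : E3 → Comp a b ℂ) (y : E3) : Comp a b ℂ :=
  fun i j => ∑ m : Fin (2 + 1), ∑ κ : Fin m → Fin 3, ∑ i', ∑ j',
    (α m κ i j i' j' y : ℂ) * partialDeriv κ f y i' j'

theorem localOp_add (α : OpCoeff a b) {f g : E3 → Comp a b ℂ} {y : E3}
    (hf : ContDiffAt ℝ ∞ f y) (hg : ContDiffAt ℝ ∞ g y) :
    localOp α (fun z => f z + g z) y = localOp α f y + localOp α g y := by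
  funext i j
  simp only [localOp, partialDeriv_add _ hf hg, Pi.add_apply, mul_add, Finset.sum_add_distrib]

theorem localOp_zero (α : OpCoeff a b) (y : E3) :
    localOp α (fun _ => (0 : Comp a b ℂ)) y = 0 := by
  have h := localOp_add α (f := fun _ => 0) (g := fun _ => 0) (y := y) contDiffAt_const
    contDiffAt_const
  simpa using h

theorem localOp_sum (α : OpCoeff a b) {ι : Type*} {s : Finset ι} {f : ι → E3 → Comp a b ℂ} {y : E3}
    (hf : ∀ x ∈ s, ContDiffAt ℝ ∞ (f x) y) :
    localOp α (fun z => ∑ x ∈ s, f x z) y = ∑ x ∈ s, localOp α (f x) y := by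
  classical
  induction s using Finset.induction_on with
  | empty => simpa using localOp_zero α y
  | insert i s hi ih =>
    simp only [Finset.sum_insert hi]
    rw [localOp_add α (hf i (Finset.mem_insert_self i s))
      (ContDiffAt.sum fun x hx => hf x (Finset.mem_insert_of_mem hx)),
      ih fun x hx => hf x (Finset.mem_insert_of_mem hx)]

/-- The component `(i, j)` of arrays of components. -/
noncomputable def evalComp (i : Fin a → Fin 3) (j : Fin b → Fin 3) : Comp a b ℂ →L[ℝ] ℂ :=
  (ContinuousLinearMap.proj j : ((Fin b → Fin 3) → ℂ) →L[ℝ] ℂ).comp (ContinuousLinearMap.proj i)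

theorem isLogFamily_localOp (hr : IsHalfDomain Ω r) {α : OpCoeff a b} {N J : ℕ}
    (hα : ∀ m κ i j i' j', IsLaurent Ω r N (α m κ i j i' j')) {Φ : ℂ → ℂ[X] → E3 → Comp a b ℂ}
    (hΦ : IsLogFamily Ω r J Φ) (i : Fin a → Fin 3) (j : Fin b → Fin 3) :
    IsLogFamily Ω r (J + 2) (fun s Q y => localOp α (Φ s Q) y i j) := by
  refine IsLogFamily.sum hr fun m _ => IsLogFamily.sum hr fun κ _ => IsLogFamily.sum hr fun i' _ =>
    IsLogFamily.sum hr fun j' _ => ?_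
  have h1 := ((hΦ.partialDeriv hr κ).clm (evalComp i' j') (fun _ _ => rfl)).mono
    (J' := J + 2) (by have := m.2; omega)
  refine (IsLogFamily.smul (hα m κ i j i' j') h1).congr fun s Q y hy => ?_
  rw [Complex.real_smul]
  rfl

/-- At most two derivatives and a pole of order N cost at most N + 2 orders. This crude bound
suffices because remainders of arbitrarily high order are available. -/
theorem tendsto_localOp_zero (hr : IsHalfDomain Ω r) {α : OpCoeff a b} {N : ℕ}
    (hα : ∀ m κ i j i' j', IsLaurent Ω r N (α m κ i j i' j')) {K t : ℝ} {f : E3 → Comp a b ℂ}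
    (hf : HasOrder Ω r K f) (ht : t + N + 2 < K) {y : E3} (hy : y ∈ Ω) (hy0 : y 0 = 0)
    (i : Fin a → Fin 3) (j : Fin b → Fin 3) :
    Tendsto (fun z => r z ^ (-t) • localOp α f z i j) (𝓝[inn Ω] y) (𝓝 0) := by
  simp only [localOp, Finset.smul_sum]
  rw [← Finset.sum_const_zero (s := (Finset.univ : Finset (Fin (2 + 1))))]
  refine tendsto_finsetSum _ fun m _ => ?_
  rw [← Finset.sum_const_zero (s := (Finset.univ : Finset (Fin m → Fin 3)))]
  refine tendsto_finsetSum _ fun κ _ => ?_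
  rw [← Finset.sum_const_zero (s := (Finset.univ : Finset (Fin a → Fin 3)))]
  refine tendsto_finsetSum _ fun i' _ => ?_
  rw [← Finset.sum_const_zero (s := (Finset.univ : Finset (Fin b → Fin 3)))]
  refine tendsto_finsetSum _ fun j' _ => ?_
  have hm : ((m : ℕ) : ℝ) ≤ 2 := by exact_mod_cast Nat.lt_succ_iff.1 m.2
  have h1 := ((hf.partialDeriv hr κ).clm hr (evalComp i' j')).tendsto_zero hr hy hy0
    (t := t + N) (by linarith)
  obtain ⟨h, hh, hhe⟩ := hα m κ i j i' j'
  have h2 : Tendsto h (𝓝[inn Ω] y) (𝓝 (h y)) := (hh.continuousOn y hy).mono inter_subset_left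
  have h3 := h2.smul h1
  rw [smul_zero] at h3
  refine h3.congr' ?_
  filter_upwards [self_mem_nhdsWithin] with z hz
  have hz0 := hr.r_pos hz
  rw [hhe z hz, smul_smul, smul_eq_mul, neg_add, Real.rpow_add hz0, Real.rpow_neg hz0.le (N : ℝ),
    Real.rpow_natCast, ← Complex.real_smul, smul_smul]
  congr 1
  field_simp

end LocalOp

/-! ### Coefficients of geometric operators -/

section Geometric

variable {M : Type*} [TopologicalSpace M] [ChartedSpace H3 M] [IsManifold (𝓡∂ 3) ∞ M]

/-- The defining function in coordinates. -/
noncomputable abbrev chartRho (ρ : M → ℝ) (e : OpenPartialHomeomorph M H3) : E3 → ℝ :=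
  ρ ∘ (e.extend (𝓡∂ 3)).symm

theorem metricMatrix_eq (ρ : M → ℝ) (gbar : SmoothMetric M) (e : OpenPartialHomeomorph M H3)
    (x : M) : metricMatrix ρ gbar e x = (ρ x ^ 2)⁻¹ • gbarMatrix gbar e x := rfl

theorem isLaurent_metricMatrix {ρ : M → ℝ} (hρ : IsDefiningFunction ρ) (gbar : SmoothMetric M)
    {e : OpenPartialHomeomorph M H3} (he : e ∈ smoothCharts M) (i j : Fin 3) :
    IsLaurent (chartDom e) (chartRho ρ e) 2
      (fun y => metricMatrix ρ gbar e ((e.extend (𝓡∂ 3)).symm y) i j) := by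
  refine ⟨_, contDiffOn_gbarMatrix gbar he i j, fun y hy => ?_⟩
  have h0 : chartRho ρ e y ≠ 0 := ((isHalfDomain_chart hρ he).r_pos hy).ne'
  beta_reduce
  rw [metricMatrix_eq, Matrix.smul_apply, smul_smul]
  change _ = (chartRho ρ e y ^ 2 * (chartRho ρ e y ^ 2)⁻¹) • _
  rw [mul_inv_cancel₀ (pow_ne_zero 2 h0), one_smul]

/-- In dimension three det g = ρ^{-6} det gbar, so (det g)^{-1/2} = ρ³ (det gbar)^{-1/2} has no
pole. -/
theorem isLaurent_inv_sqrt_det {ρ : M → ℝ} (hρ : IsDefiningFunction ρ) (gbar : SmoothMetric M)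
    {e : OpenPartialHomeomorph M H3} (he : e ∈ smoothCharts M) :
    IsLaurent (chartDom e) (chartRho ρ e) 0
      (fun y => (Real.sqrt (metricMatrix ρ gbar e ((e.extend (𝓡∂ 3)).symm y)).det)⁻¹) := by
  have hr := isHalfDomain_chart hρ he
  have hpos : ∀ y ∈ chartDom e, 0 < (gbarMatrix gbar e ((e.extend (𝓡∂ 3)).symm y)).det :=
    fun y hy => (gbarMatrix_posDef gbar he (symm_mem hy)).det_pos
  have hdet : ContDiffOn ℝ ∞ (fun y => (gbarMatrix gbar e ((e.extend (𝓡∂ 3)).symm y)).det)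
      (chartDom e) := by
    simp only [Matrix.det_fin_three]
    have h := contDiffOn_gbarMatrix gbar he
    have hm : ∀ i j k l m n, ContDiffOn ℝ ∞ (fun y =>
        gbarMatrix gbar e ((e.extend (𝓡∂ 3)).symm y) i j *
        gbarMatrix gbar e ((e.extend (𝓡∂ 3)).symm y) k l *
        gbarMatrix gbar e ((e.extend (𝓡∂ 3)).symm y) m n) (chartDom e) :=
      fun i j k l m n => ((h i j).mul (h k l)).mul (h m n)
    exact (((((hm _ _ _ _ _ _).sub (hm _ _ _ _ _ _)).sub (hm _ _ _ _ _ _)).add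
      (hm _ _ _ _ _ _)).add (hm _ _ _ _ _ _)).sub (hm _ _ _ _ _ _)
  refine ⟨fun y => chartRho ρ e y ^ 3 *
    (Real.sqrt (gbarMatrix gbar e ((e.extend (𝓡∂ 3)).symm y)).det)⁻¹,
    (hr.smooth.pow 3).mul ((hdet.sqrt fun y hy => (hpos y hy).ne').inv
      fun y hy => (Real.sqrt_pos.2 (hpos y hy)).ne'), fun y hy => ?_⟩
  have h0 : 0 < chartRho ρ e y := hr.r_pos hy
  beta_reduce
  rw [pow_zero, one_smul, metricMatrix_eq, Matrix.det_smul, Fintype.card_fin,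
    Real.sqrt_mul (by positivity)]
  have h1 : Real.sqrt ((ρ ((e.extend (𝓡∂ 3)).symm y) ^ 2)⁻¹ ^ 3) = (chartRho ρ e y ^ 3)⁻¹ := by
    rw [show (ρ ((e.extend (𝓡∂ 3)).symm y) ^ 2)⁻¹ ^ 3 = ((chartRho ρ e y ^ 3)⁻¹) ^ 2 by
      simp only [inv_pow, ← pow_mul]; rfl]
    exact Real.sqrt_sq (by positivity)
  rw [h1, mul_inv, inv_inv]

/-- An m-th derivative of g_{ij} has a pole of order at most 2 + m, and polynomials preserve such
bounds. The bound N is the same for all charts, so the order of an expansion can be fixed before a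
chart is chosen. -/
theorem exists_isLaurent_metricJet {ρ : M → ℝ} (hρ : IsDefiningFunction ρ) (gbar : SmoothMetric M)
    {n : ℕ} (q : MvPolynomial (JetVar n) ℝ) : ∃ N : ℕ, ∀ e ∈ smoothCharts M,
      IsLaurent (chartDom e) (chartRho ρ e) N
        (fun y => MvPolynomial.eval (metricJet ρ gbar e ((e.extend (𝓡∂ 3)).symm y) n) q) := by
  induction q using MvPolynomial.induction_on with
  | C c =>
    exact ⟨0, fun e he => by
      simp only [MvPolynomial.eval_C]; exact isLaurent_of_contDiffOn contDiffOn_const⟩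
  | add p q hp hq =>
    obtain ⟨N, hN⟩ := hp
    obtain ⟨N', hN'⟩ := hq
    refine ⟨max N N', fun e he => ?_⟩
    have hr := isHalfDomain_chart hρ he
    simp only [map_add]
    exact ((hN e he).mono hr (le_max_left _ _)).add ((hN' e he).mono hr (le_max_right _ _))
  | mul_X p v hp =>
    obtain ⟨N, hN⟩ := hp
    have hv : ∃ N', ∀ e ∈ smoothCharts M, IsLaurent (chartDom e) (chartRho ρ e) N'
        (fun y => metricJet ρ gbar e ((e.extend (𝓡∂ 3)).symm y) n v) := by
      rcases v with _ | ⟨⟨m, κ⟩, i, j⟩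
      · exact ⟨0, fun e he => isLaurent_inv_sqrt_det hρ gbar he⟩
      · refine ⟨2 + m, fun e he => ?_⟩
        refine ((isLaurent_metricMatrix hρ gbar he i j).partialDeriv (isHalfDomain_chart hρ he)
          κ).congr fun y hy => ?_
        simp only [metricJet, extend_symm_eq hy.1]
    obtain ⟨N', hN'⟩ := hv
    refine ⟨N + N', fun e he => ?_⟩
    simp only [map_mul, MvPolynomial.eval_X]
    exact (hN e he).smul (hN' e he)

/-- Geometric operators in coordinates. -/
theorem IsGeometric.exists_localOp {B : TensorType} {ρ : M → ℝ} (hρ : IsDefiningFunction ρ)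
    {gbar : SmoothMetric M} {P : TensorField M B.a B.b → TensorField M B.a B.b}
    (hP : IsGeometric B ρ gbar 2 P) :
    ∃ (N : ℕ) (α : OpenPartialHomeomorph M H3 → OpCoeff B.a B.b),
      (∀ e ∈ smoothCharts M, ∀ m κ i j i' j',
        IsLaurent (chartDom e) (chartRho ρ e) N (α e m κ i j i' j')) ∧
      ∀ u, IsSection B gbar (int M) u → ∀ e ∈ smoothCharts M, ∀ y ∈ inn (chartDom e),
        coordRep e (P u) y = localOp (α e) (coordRep e u) y := by
  obtain ⟨c, hc⟩ := hP
  choose N hN using fun m κ i j i' j' => exists_isLaurent_metricJet hρ gbar (c m κ i j i' j')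
  -- The sum serves as a common upper bound for the finitely many pole orders.
  refine ⟨∑ m, ∑ κ, ∑ i, ∑ j, ∑ i', ∑ j', N m κ i j i' j', fun e m κ i j i' j' y =>
    MvPolynomial.eval (metricJet ρ gbar e ((e.extend (𝓡∂ 3)).symm y) (2 - m)) (c m κ i j i' j'),
    fun e he m κ i j i' j' => ?_, fun u hu e he y hy => ?_⟩
  · refine (hN m κ i j i' j' e he).mono (isHalfDomain_chart hρ he) ?_
    have hle : ∀ {ι : Type} [Fintype ι] (f : ι → ℕ) (x : ι), f x ≤ ∑ x, f x := fun f x =>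
      Finset.single_le_sum (fun _ _ => Nat.zero_le _) (Finset.mem_univ x)
    exact ((((((hle (N m κ i j i') j').trans (hle (fun i' => ∑ j', N m κ i j i' j') i')).trans
      (hle (fun j => ∑ i', ∑ j', N m κ i j i' j') j)).trans
      (hle (fun i => ∑ j, ∑ i', ∑ j', N m κ i j i' j') i)).trans
      (hle (fun κ => ∑ i, ∑ j, ∑ i', ∑ j', N m κ i j i' j') κ)).trans
      (hle (fun m => ∑ κ, ∑ i, ∑ j, ∑ i', ∑ j', N m κ i j i' j') m))
  · funext i j
    have h := hc u hu e he _ ⟨symm_mem hy.1, (symm_mem_int he hy.1).2 hy.2⟩ i j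
    rw [extend_symm_eq hy.1] at h
    exact h

end Geometric

open scoped Manifold ContDiff ComplexConjugate Matrix Polynomial


/-! ### Asymptotic expansions at boundary points -/

section Asymptotics

variable {Ω : Set E3} {r : E3 → ℝ}

/-- Along rays, the defining function attains all small values. -/
theorem IsHalfDomain.le_map_ray (hr : IsHalfDomain Ω r) {y : E3} (hy : y ∈ Ω) (hy0 : y 0 = 0) :
    𝓝[>] (0 : ℝ) ≤ map (fun t : ℝ => r (y + t • e0)) (𝓝[>] 0) := by
  intro s hs
  have hs' : ∀ᶠ t in 𝓝[>] (0 : ℝ), r (y + t • e0) ∈ s := hs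
  obtain ⟨t₁, ht₁, hsub⟩ := mem_nhdsGT_iff_exists_Ioo_subset.1
    (hs'.and (hr.eventually_mem_inn hy))
  have ht₁0 : (0 : ℝ) < t₁ / 2 := half_pos ht₁
  have hmem : ∀ t ∈ Ioc 0 (t₁ / 2), r (y + t • e0) ∈ s ∧ y + t • e0 ∈ inn Ω := fun t ht =>
    hsub ⟨ht.1, ht.2.trans_lt (half_lt_self ht₁)⟩
  have hcont : ContinuousOn (fun t : ℝ => r (y + t • e0)) (Icc 0 (t₁ / 2)) := by
    refine hr.smooth.continuousOn.comp (by fun_prop) fun t ht => ?_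
    rcases ht.1.eq_or_lt with h0 | h0
    · rw [← h0]; simpa using hy
    · exact (hmem t ⟨h0, ht.2⟩).2.1
  have h0 : r (y + (0 : ℝ) • e0) = 0 := by simpa using hr.zero y hy hy0
  -- By the intermediate value theorem r takes every small positive value on the ray, so a limit
  -- along the ray is a limit as r → 0 in one real variable.
  have hivt := intermediate_value_Icc ht₁0.le hcont
  beta_reduce at hivt
  rw [h0] at hivt
  have hpos := hr.r_pos (hmem _ ⟨ht₁0, le_rfl⟩).2
  filter_upwards [Ioo_mem_nhdsGT hpos] with x hx
  obtain ⟨t, ht, htx⟩ := hivt ⟨hx.1.le, hx.2.le⟩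
  beta_reduce at htx
  rcases ht.1.eq_or_lt with h | h
  · rw [← h, h0] at htx
    exact absurd htx hx.1.ne
  · rw [← htx]
    exact (hmem t ⟨h, ht.2⟩).1

/-- Along rays, smooth functions converge to their boundary values like the defining function. -/
theorem IsHalfDomain.isBigO_ray (hr : IsHalfDomain Ω r) {y : E3} (hy : y ∈ Ω) (hy0 : y 0 = 0)
    {g : E3 → ℂ} (hg : ContDiffOn ℝ ∞ g Ω) :
    (fun t : ℝ => g (y + t • e0) - g y) =O[𝓝[>] 0] fun t => r (y + t • e0) := by
  have h1 := (hg.differentiableOn (by simp) y hy).hasFDerivWithinAt.isBigO_sub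
  have hray : Tendsto (fun t : ℝ => y + t • e0) (𝓝[>] 0) (𝓝[Ω] y) :=
    (hr.tendsto_ray hy).mono_right (nhdsWithin_mono _ inter_subset_left)
  have h2 := h1.comp_tendsto hray
  refine h2.trans ?_
  obtain ⟨f, hf, hfe⟩ := hr.exists_eq_smul (f := fun z => z 0) coord0.contDiff.contDiffOn
    (fun z _ hz => hz)
  have h3 : Tendsto (fun t : ℝ => f (y + t • e0)) (𝓝[>] 0) (𝓝 (f y)) :=
    (hf.continuousOn y hy).tendsto.comp hray
  have h4 : (fun t : ℝ => y + t • e0 - y) =O[𝓝[>] 0] fun t : ℝ => r (y + t • e0) * f (y + t • e0) := by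
    refine Asymptotics.IsBigO.of_bound ‖e0‖ ?_
    filter_upwards [hr.eventually_mem_inn hy] with t ht
    have h5 := hfe _ ht.1
    rw [smul_eq_mul] at h5
    rw [← h5]
    have h6 : (y + t • e0) 0 = t := by simp [hy0]
    rw [h6, add_sub_cancel_left, norm_smul, mul_comm]
  refine h4.trans ?_
  have h7 := (Asymptotics.isBigO_refl (fun t : ℝ => r (y + t • e0)) (𝓝[>] 0)).mul
    (h3.isBigO_one ℝ)
  simpa using h7

/-- The leading coefficients of an asymptotic expansion are determined by the function. -/
theorem IsHalfDomain.sum_eq_zero_of_tendsto (hr : IsHalfDomain Ω r) {ι : Type*} {I : Finset ι}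
    {σ : ι → ℂ} {Q : ι → ℂ[X]} {g : ι → E3 → ℂ} (hg : ∀ x ∈ I, ContDiffOn ℝ ∞ (g x) Ω) {y : E3}
    (hy : y ∈ Ω) (hy0 : y 0 = 0) {τ : ℝ} (hσ : ∀ x ∈ I, τ ≤ (σ x).re)
    (h : Tendsto (fun z => r z ^ (-τ) • ∑ x ∈ I, plog r (σ x) (Q x) z * g x z)
      (𝓝[inn Ω] y) (𝓝 0)) {s : ℂ} (hs : s.re = τ) :
    ∑ x ∈ I, (if σ x = s then g x y • Q x else 0) = 0 := by
  classical
  set R : ℂ → ℂ[X] := fun s => ∑ x ∈ I, (if σ x = s then g x y • Q x else 0) with hR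
  -- Only exponents on the line Re = τ contribute to the leading part. The exponent s is added so
  -- that it need not occur in the expansion.
  set S : Finset ℂ := insert s ((I.filter fun x => (σ x).re = τ).image σ) with hS
  have hSre : ∀ s' ∈ S, s'.re = τ := by
    intro s' hs'
    rcases Finset.mem_insert.1 hs' with rfl | h1
    · exact hs
    · obtain ⟨x, hx, rfl⟩ := Finset.mem_image.1 h1
      exact (Finset.mem_filter.1 hx).2
  refine powLog_eq_zero τ S hSre R ?_ s (Finset.mem_insert_self _ _)
  refine Tendsto.mono_left ?_ (hr.le_map_ray hy hy0)
  rw [tendsto_map'_iff]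
  have hray := hr.tendsto_ray hy
  -- Along the ray, terms with Re σ > τ are negligible. In the others g may be frozen at y: the
  -- error is O(r), which beats the logarithms. What is left is a function of r alone.
  have hdiff : Tendsto (fun t : ℝ => ∑ x ∈ I, r (y + t • e0) ^ (-τ) •
      (plog r (σ x) (Q x) (y + t • e0) *
        (g x (y + t • e0) - if (σ x).re = τ then g x y else 0))) (𝓝[>] 0) (𝓝 0) := by
    rw [show 𝓝 (0 : ℂ) = 𝓝 (∑ _x ∈ I, (0 : ℂ)) by rw [Finset.sum_const_zero]]
    refine tendsto_finsetSum _ fun x hx => ?_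
    by_cases hx0 : (σ x).re = τ
    · simp only [hx0, if_true]
      have h1 := ((hasOrder_plog_smul hr (f := fun _ => (1 : ℂ)) contDiffOn_const (σ x + 1) (Q x)
        (t := τ + 1 / 2) (by simp only [Complex.add_re, Complex.one_re, hx0]; linarith)).tendsto_zero
        hr hy hy0 (t := τ) (by linarith)).comp hray
      refine Asymptotics.IsBigO.trans_tendsto ?_ h1
      have h3 : (fun t : ℝ => g x (y + t • e0) - g x y) =O[𝓝[>] 0]
          fun t => ((r (y + t • e0) : ℝ) : ℂ) :=
        (hr.isBigO_ray hy hy0 (hg x hx)).trans (Asymptotics.isBigO_of_le _ fun t => by simp)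
      have h2 := (Asymptotics.isBigO_refl (fun t : ℝ => r (y + t • e0) ^ (-τ) •
        plog r (σ x) (Q x) (y + t • e0)) (𝓝[>] 0)).mul h3
      refine (h2.congr' ?_ ?_)
      · exact Eventually.of_forall fun t => by simp only [smul_mul_assoc]
      · filter_upwards [hr.eventually_mem_inn hy] with t ht
        have h3 : ((r (y + t • e0) : ℝ) : ℂ) ≠ 0 := by exact_mod_cast (hr.r_pos ht).ne'
        simp only [Function.comp, plog, Complex.cpow_add _ _ h3, Complex.cpow_one, smul_eq_mul,
          Complex.real_smul]
        ring
    · obtain ⟨t', ht', ht'2⟩ := exists_between (lt_of_le_of_ne (hσ x hx) (Ne.symm hx0))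
      simp only [hx0, if_false, sub_zero]
      exact ((hasOrder_plog_smul hr (hg x hx) (σ x) (Q x) ht'2).tendsto_zero hr hy hy0 ht').comp hray
  have h0 := (h.comp hray).sub hdiff
  rw [sub_zero] at h0
  refine Tendsto.congr' ?_ h0
  filter_upwards [hr.eventually_mem_inn hy] with t ht
  have hrt := hr.r_pos ht
  simp only [Function.comp]
  rw [Finset.smul_sum, ← Finset.sum_sub_distrib, ← Complex.real_smul]
  have h4 : ∀ s' ∈ S, ((r (y + t • e0) : ℝ) : ℂ) ^ s' *
      (R s').eval ((Real.log (r (y + t • e0)) : ℝ) : ℂ) =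
      ∑ x ∈ I, if σ x = s' then plog r (σ x) (Q x) (y + t • e0) * g x y else 0 := by
    intro s' _
    rw [hR]
    simp only [Polynomial.eval_finsetSum, Finset.mul_sum]
    refine Finset.sum_congr rfl fun x _ => ?_
    split_ifs with hx
    · rw [plog, Polynomial.eval_smul, hx, smul_eq_mul]
      ring
    · simp
  rw [Finset.sum_congr rfl h4, Finset.sum_comm, Finset.smul_sum]
  refine Finset.sum_congr rfl fun x hx => ?_
  rw [Finset.sum_ite_eq, ← smul_sub, ← mul_sub, sub_sub_cancel]
  congr 1
  split_ifs with h5 h6 h6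
  · rfl
  · refine absurd ?_ h6
    exact Finset.mem_insert_of_mem (Finset.mem_image.2 ⟨x, Finset.mem_filter.2 ⟨hx, h5⟩, rfl⟩)
  · exact absurd (hSre _ h6) h5
  · rw [mul_zero]

/-- Smooth functions of order `τ` are divisible by powers of the defining function. -/
theorem IsHalfDomain.exists_eq_pow_smul (hr : IsHalfDomain Ω r) {f : E3 → ℂ}
    (hf : ContDiffOn ℝ ∞ f Ω) {τ : ℝ} (hτ : ∀ t < τ, ∀ y ∈ Ω, y 0 = 0 →
      Tendsto (fun z => r z ^ (-t) • f z) (𝓝[inn Ω] y) (𝓝 0)) (N : ℕ) (hN : (N : ℝ) < τ + 1) :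
    ∃ f' : E3 → ℂ, ContDiffOn ℝ ∞ f' Ω ∧ ∀ z ∈ Ω, f z = r z ^ N • f' z := by
  induction N with
  | zero => exact ⟨f, hf, fun z _ => by simp⟩
  | succ N ih =>
    push_cast at hN
    obtain ⟨f₁, hf₁, hf₁e⟩ := ih (by linarith)
    have h0 : ∀ y ∈ Ω, y 0 = 0 → f₁ y = 0 := by
      intro y hy hy0
      have := hr.neBot hy
      have h1 : Tendsto f₁ (𝓝[inn Ω] y) (𝓝 (f₁ y)) :=
        (hf₁.continuousOn y hy).mono inter_subset_left
      refine tendsto_nhds_unique h1 ((hτ N (by linarith) y hy hy0).congr' ?_)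
      filter_upwards [self_mem_nhdsWithin] with z hz
      have hz0 := hr.r_pos hz
      rw [hf₁e z hz.1, smul_smul, Real.rpow_neg hz0.le, Real.rpow_natCast,
        inv_mul_cancel₀ (pow_ne_zero _ hz0.ne'), one_smul]
    obtain ⟨f', hf', hfe'⟩ := hr.exists_eq_smul hf₁ h0
    exact ⟨f', hf', fun z hz => by rw [hf₁e z hz, hfe' z hz, smul_smul, pow_succ]⟩

end Asymptotics

open scoped Manifold ContDiff ComplexConjugate Matrix Polynomial


/-! ### Spaces of sections -/

section Sections

variable {M : Type*} [TopologicalSpace M] [ChartedSpace H3 M] [IsManifold (𝓡∂ 3) ∞ M]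

/-- The components at a point as a linear map on tensor fields. -/
noncomputable def coordRepL {a b : ℕ} (e : OpenPartialHomeomorph M H3) (y : E3) :
    TensorField M a b →ₗ[ℂ] Comp a b ℂ where
  toFun u := coordRep e u y
  map_add' _ _ := map_add (coordComp e ((e.extend (𝓡∂ 3)).symm y)) _ _
  map_smul' c _ := map_smul (coordComp e ((e.extend (𝓡∂ 3)).symm y)) c _

theorem coordRep_smul {a b : ℕ} (e : OpenPartialHomeomorph M H3) (f : M → ℂ) (u : TensorField M a b)
    (y : E3) : coordRep e (fun x => f x • u x) y =
      f ((e.extend (𝓡∂ 3)).symm y) • coordRep e u y :=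
  map_smul (coordComp e ((e.extend (𝓡∂ 3)).symm y)) _ _

/-- The space of sections that are smooth up to the boundary. -/
def sectionSpace (B : TensorType) (gbar : SmoothMetric M) : Submodule ℂ (TensorField M B.a B.b) where
  carrier := {u | IsSection B gbar univ u}
  add_mem' {u v} hu hv := ⟨isOfClassOn_univ_iff.2 fun e he =>
    ((isOfClassOn_univ_iff.1 hu.smooth e he).add (isOfClassOn_univ_iff.1 hv.smooth e he)).congr
      fun y _ => (coordRepL e y).map_add u v,
    fun x hx => Submodule.add_mem _ (hu.mem x hx) (hv.mem x hx)⟩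
  zero_mem' := ⟨isOfClassOn_univ_iff.2 fun e _ =>
    (contDiffOn_const (c := 0)).congr fun y _ => (coordRepL e y).map_zero,
    fun _ _ => Submodule.zero_mem _⟩
  smul_mem' c u hu := ⟨isOfClassOn_univ_iff.2 fun e he =>
    (contDiffOn_const (c := c)).smul (isOfClassOn_univ_iff.1 hu.smooth e he) |>.congr
      fun y _ => (coordRepL e y).map_smul c u,
    fun x hx => Submodule.smul_mem _ c (hu.mem x hx)⟩

/-- The field `ρ^s Q(log ρ) c`. -/
noncomputable def powTerm {a b : ℕ} (ρ : M → ℝ) (s : ℂ) (Q : ℂ[X]) (c : TensorField M a b) :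
    TensorField M a b :=
  fun x => ((ρ x : ℂ) ^ s * Q.eval ((Real.log (ρ x) : ℝ) : ℂ)) • c x

theorem coordRep_powTerm {a b : ℕ} (ρ : M → ℝ) (s : ℂ) (Q : ℂ[X]) (c : TensorField M a b)
    (e : OpenPartialHomeomorph M H3) :
    coordRep e (powTerm ρ s Q c) = fun y => plog (chartRho ρ e) s Q y • coordRep e c y :=
  funext fun y => coordRep_smul e _ c y

theorem isSection_powTerm {B : TensorType} {gbar : SmoothMetric M} {ρ : M → ℝ}
    (hρ : IsDefiningFunction ρ) {c : TensorField M B.a B.b} (hc : IsSection B gbar univ c) (s : ℂ)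
    (Q : ℂ[X]) : IsSection B gbar (int M) (powTerm ρ s Q c) := by
  refine ⟨isOfClassOn_int_iff.2 fun e he => ?_, fun x _ =>
    Submodule.smul_mem _ _ (hc.mem x (mem_univ x))⟩
  rw [coordRep_powTerm]
  exact (contDiffOn_plog (isHalfDomain_chart hρ he) s Q).smul
    ((isOfClassOn_univ_iff.1 hc.smooth e he).mono inter_subset_left)

theorem isSection_pow_smul {B : TensorType} {gbar : SmoothMetric M} {ρ : M → ℝ}
    (hρ : IsDefiningFunction ρ) {c : TensorField M B.a B.b} (hc : IsSection B gbar univ c) (m : ℕ) :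
    IsSection B gbar univ (fun x => (ρ x : ℂ) ^ m • c x) := by
  refine ⟨isOfClassOn_univ_iff.2 fun e he => ?_, fun x _ =>
    Submodule.smul_mem _ _ (hc.mem x (mem_univ x))⟩
  refine ContDiffOn.congr ?_ fun y _ => coordRep_smul e (fun x => (ρ x : ℂ) ^ m) c y
  exact ((Complex.ofRealCLM.contDiff.comp_contDiffOn (isHalfDomain_chart hρ he).smooth).pow m).smul
    (isOfClassOn_univ_iff.1 hc.smooth e he)

theorem InB.hasOrder {B : TensorType} {ρ : M → ℝ} {δ : ℝ}
    {u : TensorField M B.a B.b} (h : InB B ρ δ u) {K : ℝ} (hK : K < δ - B.weight)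
    {e : OpenPartialHomeomorph M H3} (he : e ∈ smoothCharts M) :
    HasOrder (chartDom e) (chartRho ρ e) K (coordRep e u) := by
  have h' : ∀ k : ℕ, InWeighted B ρ k (K + B.weight) u := fun k => h k _ (by linarith)
  refine ⟨contDiffOn_infty.2 fun k => isOfClassOn_int_iff.1 (h' k).regular e he,
    fun C hC hCc j => ?_⟩
  obtain ⟨A, hA⟩ := (h' j).bound e he ((e.extend (𝓡∂ 3)).symm '' C)
    (hCc.image_of_continuousOn ((continuousOn_symm e).mono hC))
    (by rintro _ ⟨y, hy, rfl⟩; exact symm_mem (hC hy))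
  refine ⟨A, fun y hy => ?_⟩
  have h1 := hA _ ⟨⟨y, hy.1, rfl⟩, (symm_mem_int he hy.2.1).2 hy.2.2⟩ j le_rfl
  rwa [extend_symm_eq hy.2.1, show K + B.weight - B.weight - (j : ℝ) = K - j by ring] at h1

/-- The indicial map of `P` is `p(s) A`. -/
def HasIndicialMap (B : TensorType) (gbar : SmoothMetric M) (ρ : M → ℝ)
    (P : TensorField M B.a B.b → TensorField M B.a B.b) (p : ℂ[X])
    (A : ∀ q : M, B.fibre gbar q ≃ₗ[ℂ] B.fibre gbar q) : Prop :=
  ∀ s : ℂ, ∀ q ∈ bdry M, ∀ ubar, ∀ h : IsSection B gbar univ ubar, IndicialValue ρ P s ubar q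
      (p.eval s • (A q ⟨ubar q, h.mem q (mem_univ q)⟩ : TensorAt B.a B.b q))

/-- The field `A c`. -/
noncomputable def fibreMap {B : TensorType} {gbar : SmoothMetric M}
    (A : ∀ q : M, B.fibre gbar q ≃ₗ[ℂ] B.fibre gbar q) (c : sectionSpace B gbar) :
    TensorField M B.a B.b :=
  fun q => (A q ⟨(c : TensorField M B.a B.b) q, IsSection.mem c.2 q (mem_univ q)⟩ :
    TensorAt B.a B.b q)

theorem eq_zero_of_fibreMap_eq_zero {B : TensorType} {gbar : SmoothMetric M}
    {A : ∀ q : M, B.fibre gbar q ≃ₗ[ℂ] B.fibre gbar q} {c : sectionSpace B gbar} {q : M}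
    (h : fibreMap A c q = 0) : (c : TensorField M B.a B.b) q = 0 := by
  have h2 := (LinearEquiv.map_eq_zero_iff _).1 (Subtype.ext h)
  exact congrArg Subtype.val h2

theorem HasIndicialMap.tendsto {B : TensorType} {ρ : M → ℝ} {gbar : SmoothMetric M}
    {P : TensorField M B.a B.b → TensorField M B.a B.b} {p : ℂ[X]}
    {A : ∀ q : M, B.fibre gbar q ≃ₗ[ℂ] B.fibre gbar q} (hA : HasIndicialMap B gbar ρ P p A)
    (c : sectionSpace B gbar) {e : OpenPartialHomeomorph M H3}
    (he : e ∈ smoothCharts M) (s : ℂ) {y : E3} (hy : y ∈ chartDom e) (hy0 : y 0 = 0) :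
    Tendsto (fun z => (chartRho ρ e z : ℂ) ^ (-s) •
      coordRep e (P (powTerm ρ s 1 (c : TensorField M B.a B.b))) z) (𝓝[inn (chartDom e)] y)
      (𝓝 (p.eval s • coordRep e (fibreMap A c) y)) := by
  have h1 := (hA s _ ((symm_mem_bdry he hy).2 hy0) c c.2 e he (symm_mem hy)).comp
    (tendsto_symm he hy)
  rw [map_smul] at h1
  have h3 : powTerm ρ s 1 (c : TensorField M B.a B.b) =
      fun z => ((ρ z : ℂ) ^ s) • (c : TensorField M B.a B.b) z := by
    funext z
    rw [powTerm, Polynomial.eval_one, mul_one]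
  rw [h3]
  refine h1.congr fun z => ?_
  rw [Function.comp, map_smul]
  rfl

/-- The expansion of `P (ρ^s Q(log ρ) c)` has leading coefficient given by the indicial
polynomial. -/
theorem exists_family {B : TensorType} {ρ : M → ℝ} {gbar : SmoothMetric M}
    (hρ : IsDefiningFunction ρ) {P : TensorField M B.a B.b → TensorField M B.a B.b}
    (hP : IsGeometric B ρ gbar 2 P) {p : ℂ[X]}
    {A : ∀ q : M, B.fibre gbar q ≃ₗ[ℂ] B.fibre gbar q} (hA : HasIndicialMap B gbar ρ P p A)
    (c : sectionSpace B gbar) {e : OpenPartialHomeomorph M H3}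
    (he : e ∈ smoothCharts M) (i : Fin B.a → Fin 3) (j : Fin B.b → Fin 3) :
    ∃ g : ℕ → E3 → ℂ, (∀ k, ContDiffOn ℝ ∞ (g k) (chartDom e)) ∧
      (∀ s Q, ∀ y ∈ inn (chartDom e),
        coordRep e (P (powTerm ρ s Q (c : TensorField M B.a B.b))) y i j =
          ∑ k ∈ Finset.range 3, plog (chartRho ρ e) s ((eulerOp s ^ k) Q) y * g k y) ∧
      ∀ y ∈ chartDom e, y 0 = 0 → ∀ s Q, ∑ k ∈ Finset.range 3, g k y • (eulerOp s ^ k) Q =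
        coordRep e (fibreMap A c) y i j • Polynomial.aeval (eulerOp s) p Q := by
  have hr := isHalfDomain_chart hρ he
  obtain ⟨N, α, hα, hloc⟩ := hP.exists_localOp hρ
  -- One term for ρ^s Q(log ρ) c itself and one more for each of two derivatives.
  have hfam : IsLogFamily (chartDom e) (chartRho ρ e) 3
      (fun s Q y => coordRep e (P (powTerm ρ s Q (c : TensorField M B.a B.b))) y i j) := by
    refine (isLogFamily_localOp hr (hα e he) (isLogFamily_smul (r := chartRho ρ e)
      (isOfClassOn_univ_iff.1 (IsSection.smooth c.2) e he)) i j).congr fun s Q y hy => ?_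
    rw [hloc _ (isSection_powTerm hρ c.2 s Q) e he y hy, coordRep_powTerm]
  exact hfam.exists_contDiffOn hr p (fun y => coordRep e (fibreMap A c) y i j)
    fun s y hy hy0 => tendsto_pi_nhds.1 (tendsto_pi_nhds.1 (hA.tendsto c he s hy hy0) i) j

end Sections

/-! ### Expansions -/

section Expansions

variable {M : Type*} [TopologicalSpace M] [ChartedSpace H3 M] [IsManifold (𝓡∂ 3) ∞ M]
  {B : TensorType} {gbar : SmoothMetric M} {ρ : M → ℝ}

/-- The sum `∑ ρ^σ (log ρ)^q c_{σ q}` in coordinates. -/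
noncomputable def expTerm (ρ : M → ℝ) (e : OpenPartialHomeomorph M H3) (y : E3) :
    ((ℂ × ℕ) →₀ sectionSpace B gbar) →ₗ[ℂ] Comp B.a B.b ℂ :=
  Finsupp.lsum ℂ fun x => plog (chartRho ρ e) x.1 (Polynomial.X ^ x.2) y •
    (coordRepL e y).comp (sectionSpace B gbar).subtype

theorem expTerm_apply (e : OpenPartialHomeomorph M H3) (y : E3)
    (c : (ℂ × ℕ) →₀ sectionSpace B gbar) : expTerm ρ e y c =
      ∑ x ∈ c.support, plog (chartRho ρ e) x.1 (Polynomial.X ^ x.2) y • coordRep e (c x : TensorField M B.a B.b) y := by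
  rw [expTerm, Finsupp.lsum_apply]
  rfl

theorem expTerm_single (e : OpenPartialHomeomorph M H3) (y : E3) (x : ℂ × ℕ)
    (d : sectionSpace B gbar) : expTerm ρ e y (Finsupp.single x d) =
      plog (chartRho ρ e) x.1 (Polynomial.X ^ x.2) y • coordRep e (d : TensorField M B.a B.b) y := by
  rw [expTerm, Finsupp.lsum_single]
  rfl

/-- The expansion `u = ρ^n v + ∑ ρ^σ (log ρ)^q c_{σ q} + w` with a remainder `w` of order `K`. -/
structure HasExpansion (ρ : M → ℝ) (u : TensorField M B.a B.b) (n : ℕ) (K : ℝ)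
    (v : sectionSpace B gbar) (c : (ℂ × ℕ) →₀ sectionSpace B gbar) : Prop where
  order : ∀ e ∈ smoothCharts M, HasOrder (chartDom e) (chartRho ρ e) K (fun y => coordRep e u y -
    ((chartRho ρ e y : ℂ) ^ n • coordRep e (v : TensorField M B.a B.b) y + expTerm ρ e y c))

namespace HasExpansion

variable {u : TensorField M B.a B.b} {n : ℕ} {K : ℝ} {v : sectionSpace B gbar}
  {c : (ℂ × ℕ) →₀ sectionSpace B gbar}

/-- A coefficient that vanishes on the boundary is moved to the next order. -/
theorem shift (hρ : IsDefiningFunction ρ) (h : HasExpansion ρ u n K v c) (x : ℂ × ℕ)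
    (hx : ∀ q ∈ bdry M, (c x : TensorField M B.a B.b) q = 0) :
    ∃ d, HasExpansion ρ u n K v (c.erase x + Finsupp.single (x.1 + 1, x.2) d) := by
  obtain ⟨d, hd, hde⟩ := IsSection.exists_eq_smul hρ (c x).2 hx
  refine ⟨⟨d, hd⟩, ⟨fun e he => ?_⟩⟩
  have hr := isHalfDomain_chart hρ he
  refine (h.order e he).congr hr fun y hy => ?_
  congr 2
  conv_rhs => rw [← Finsupp.erase_add_single x c]
  rw [map_add, map_add]
  congr 1
  rw [expTerm_single, expTerm_single]
  have h1 : coordRep e (c x : TensorField M B.a B.b) y = (chartRho ρ e y : ℂ) • coordRep e d y := by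
    rw [show (c x : TensorField M B.a B.b) = fun x => (ρ x : ℂ) • d x from funext hde]
    exact coordRep_smul e (fun x => (ρ x : ℂ)) d y
  have h0 : (chartRho ρ e y : ℂ) ≠ 0 := by exact_mod_cast (hr.r_pos hy).ne'
  rw [h1, smul_smul, plog, plog, Complex.cpow_add _ _ h0, Complex.cpow_one]
  congr 1
  ring

/-- A term without logarithm is moved to the smooth part. -/
theorem move (hρ : IsDefiningFunction ρ) (h : HasExpansion ρ u n K v c) (m : ℕ) :
    ∃ v', HasExpansion ρ u n K v' (c.erase (((n + m : ℕ) : ℂ), 0)) := by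
  set x : ℂ × ℕ := (((n + m : ℕ) : ℂ), 0) with hx
  refine ⟨v + ⟨_, isSection_pow_smul hρ (c x).2 m⟩, ⟨fun e he => ?_⟩⟩
  have hr := isHalfDomain_chart hρ he
  refine (h.order e he).congr hr fun y hy => ?_
  congr 1
  conv_rhs => rw [← Finsupp.erase_add_single x c]
  rw [map_add, expTerm_single]
  have h1 : coordRep e ((v + ⟨_, isSection_pow_smul hρ (c x).2 m⟩ : sectionSpace B gbar) :
      TensorField M B.a B.b) y = coordRep e (v : TensorField M B.a B.b) y +
        (chartRho ρ e y : ℂ) ^ m • coordRep e (c x : TensorField M B.a B.b) y := by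
    exact ((coordRepL e y).map_add _ _).trans
      (congrArg _ (coordRep_smul e (fun x => (ρ x : ℂ) ^ m) _ y))
  have h2 : plog (chartRho ρ e) x.1 (Polynomial.X ^ x.2) y =
      (chartRho ρ e y : ℂ) ^ n * (chartRho ρ e y : ℂ) ^ m := by
    rw [plog, hx]
    simp only [pow_zero, Polynomial.eval_one, mul_one, Complex.cpow_natCast, pow_add]
  rw [h1, h2, smul_add, smul_smul]
  abel

end HasExpansion

end Expansions

open scoped Manifold ContDiff ComplexConjugate Matrix Polynomial


/-! ### Leading coefficients -/

theorem coeff_sum_ite (I : Finset (ℂ × ℕ)) (a : ℂ × ℕ → ℂ) {x : ℂ × ℕ} (hx : x ∈ I) :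
    (∑ x' ∈ I, if x'.1 = x.1 then a x' • (Polynomial.X : ℂ[X]) ^ x'.2 else 0).coeff x.2 = a x := by
  rw [Polynomial.finsetSum_coeff, Finset.sum_eq_single_of_mem x hx]
  · simp
  · intro x' _ hne
    split_ifs with h
    · rw [Polynomial.coeff_smul, Polynomial.coeff_X_pow, if_neg, smul_zero]
      exact fun h' => hne (Prod.ext h h'.symm)
    · simp

theorem aeval_eulerOp_one (s : ℂ) (p : ℂ[X]) :
    Polynomial.aeval (eulerOp s) p 1 = Polynomial.C (p.eval s) := by
  induction p using Polynomial.induction_on' with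
  | add p q hp hq => simp [hp, hq]
  | monomial k a =>
    rw [Polynomial.aeval_monomial, Module.End.mul_apply, eulerOp_pow_one]
    simp [Algebra.algebraMap_eq_smul_one, Polynomial.smul_eq_C_mul]

section Leading

variable {M : Type*} [TopologicalSpace M] [ChartedSpace H3 M] [IsManifold (𝓡∂ 3) ∞ M]
  {B : TensorType} {gbar : SmoothMetric M} {ρ : M → ℝ} {u : TensorField M B.a B.b} {n : ℕ} {K : ℝ}
  {v : sectionSpace B gbar} {c : (ℂ × ℕ) →₀ sectionSpace B gbar}

namespace HasExpansion

theorem hasOrder_pow_smul (hρ : IsDefiningFunction ρ) (v : sectionSpace B gbar) (n : ℕ) {t : ℝ}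
    (ht : t < n) {e : OpenPartialHomeomorph M H3} (he : e ∈ smoothCharts M) :
    HasOrder (chartDom e) (chartRho ρ e) t
      (fun y => (chartRho ρ e y : ℂ) ^ n • coordRep e (v : TensorField M B.a B.b) y) := by
  have hr := isHalfDomain_chart hρ he
  refine (hasOrder_plog_smul hr (isOfClassOn_univ_iff.1 (IsSection.smooth v.2) e he) (n : ℂ) 1
    (t := t) (by simpa using ht)).congr hr fun y _ => ?_
  simp [plog]

/-- Leading coefficients of order less than that of `u` vanish on the boundary. -/
theorem coeff_eq_zero_of_lt (hρ : IsDefiningFunction ρ) (h : HasExpansion ρ u n K v c)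
    {x : ℂ × ℕ} (hx : x ∈ c.support) (hmin : ∀ x' ∈ c.support, x.1.re ≤ x'.1.re) (hK : x.1.re < K)
    (hxn : x.1.re < n) (hu : ∀ t < (n : ℝ), ∀ e ∈ smoothCharts M,
      HasOrder (chartDom e) (chartRho ρ e) t (coordRep e u)) :
    ∀ q ∈ bdry M, (c x : TensorField M B.a B.b) q = 0 := by
  intro q hq
  have he := IsManifold.chart_mem_maximalAtlas (I := 𝓡∂ 3) (n := ∞) q
  have hqe := mem_chart_source H3 q
  set e := chartAt H3 q with hedef
  have hr := isHalfDomain_chart hρ he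
  have hy := extend_mem hqe
  have hy0 := (mem_boundary_iff he hqe).1 hq
  refine coordComp_injective he hqe ?_
  rw [map_zero]
  funext i j
  obtain ⟨t, ht, htn⟩ := exists_between hxn
  -- Since Re σ < t < n, the field u, the term ρ^n v and the remainder are all o(ρ^{Re σ}), hence so
  -- is the sum of the remaining terms.
  have hlim : Tendsto (fun z => chartRho ρ e z ^ (-x.1.re) • ∑ x' ∈ c.support,
      plog (chartRho ρ e) x'.1 (Polynomial.X ^ x'.2) z *
        coordRep e (c x' : TensorField M B.a B.b) z i j)
      (𝓝[inn (chartDom e)] (e.extend (𝓡∂ 3) q)) (𝓝 0) := by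
    have h1 := (((hu t htn e he).clm hr (evalComp i j)).tendsto_zero hr hy hy0 ht).sub
      ((((h.order e he).clm hr (evalComp i j)).tendsto_zero hr hy hy0 hK).add
      (((hasOrder_pow_smul hρ v n htn he).clm hr (evalComp i j)).tendsto_zero hr hy hy0 ht))
    rw [add_zero, sub_zero] at h1
    refine h1.congr fun z => ?_
    have h2 : ∀ a b d : Comp B.a B.b ℂ, a - ((a - (b + d)) + b) = d := fun a b d => by abel
    rw [← smul_add, ← smul_sub, ← map_add, ← map_sub, h2, expTerm_apply, map_sum]
    rfl
  have key := hr.sum_eq_zero_of_tendsto (I := c.support) (σ := fun x => x.1)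
    (Q := fun x => Polynomial.X ^ x.2)
    (g := fun x' z => coordRep e (c x' : TensorField M B.a B.b) z i j)
    (fun x' _ => (evalComp i j).contDiff.comp_contDiffOn
      (isOfClassOn_univ_iff.1 (IsSection.smooth (c x').2) e he)) hy hy0 hmin hlim rfl
  have h3 := coeff_sum_ite c.support
    (fun x' => coordRep e (c x' : TensorField M B.a B.b) (e.extend (𝓡∂ 3) q) i j) hx
  rw [key, Polynomial.coeff_zero, coordRep, symm_extend_eq hqe] at h3
  exact h3.symm

set_option maxHeartbeats 2000000 in
/-- Leading coefficients vanish on the boundary, except those of non-negative integral powers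
without logarithms. -/
theorem coeff_eq_zero_of_le (hρ : IsDefiningFunction ρ)
    {P : TensorField M B.a B.b → TensorField M B.a B.b} (hP : IsGeometric B ρ gbar 2 P) {p : ℂ[X]}
    {A : ∀ q : M, B.fibre gbar q ≃ₗ[ℂ] B.fibre gbar q} (hA : HasIndicialMap B gbar ρ P p A)
    (hpn : p.eval (n : ℂ) = 0) (hroot : ∀ s, p.eval s = 0 → (n : ℝ) ≤ s.re → s = n)
    (hsimple : (Polynomial.derivative p).eval (n : ℂ) ≠ 0)
    {N : ℕ} {α : OpenPartialHomeomorph M H3 → OpCoeff B.a B.b}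
    (hα : ∀ e ∈ smoothCharts M, ∀ m κ i j i' j',
        IsLaurent (chartDom e) (chartRho ρ e) N (α e m κ i j i' j'))
    (hloc : ∀ u, IsSection B gbar (int M) u → ∀ e ∈ smoothCharts M, ∀ y ∈ inn (chartDom e),
        coordRep e (P u) y = localOp (α e) (coordRep e u) y)
    (hu : IsSection B gbar (int M) u) (hPu_smooth : ExtendsSmoothly (P u)) {δ : ℝ} (hδ : (n : ℝ) < δ)
    (hPu : ∀ e ∈ smoothCharts M, HasOrder (chartDom e) (chartRho ρ e) δ (coordRep e (P u)))
    (h : HasExpansion ρ u n K v c)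
    {x : ℂ × ℕ} (hx : x ∈ c.support) (hmin : ∀ x' ∈ c.support, x.1.re ≤ x'.1.re)
    (hK : x.1.re + N + 2 < K) (hxn : n ≤ x.1.re)
    (hbad : ∀ m : ℕ, x ≠ (((n + m : ℕ) : ℂ), 0)) :
    ∀ q ∈ bdry M, (c x : TensorField M B.a B.b) q = 0 := by
  intro q hq
  have he := IsManifold.chart_mem_maximalAtlas (I := 𝓡∂ 3) (n := ∞) q
  have hqe := mem_chart_source H3 q
  set e := chartAt H3 q with hedef
  have hr := isHalfDomain_chart hρ he
  have hy := extend_mem hqe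
  have hy0 := (mem_boundary_iff he hqe).1 hq
  set y := e.extend (𝓡∂ 3) q with hydef
  have hqy : (e.extend (𝓡∂ 3)).symm y = q := symm_extend_eq hqe
  set r := chartRho ρ e with hrdef
  refine eq_zero_of_fibreMap_eq_zero (A := A) (coordComp_injective he hqe ?_)
  rw [map_zero]
  funext i j
  suffices hmain : coordRep e (fibreMap A (c x)) y i j = 0 by
    rwa [coordRep, hqy] at hmain
  set τ := x.1.re with hτ
  choose g hgs hge hgb using fun d : sectionSpace B gbar => exists_family hρ hP hA d he i j
  obtain ⟨V, hVs, hVe⟩ := hPu_smooth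
  set w : E3 → Comp B.a B.b ℂ := fun y => coordRep e u y -
    ((r y : ℂ) ^ n • coordRep e (v : TensorField M B.a B.b) y + expTerm ρ e y c) with hw
  have hworder : HasOrder (chartDom e) r K w := h.order e he
  -- The chosen component of P(ρ^n v) is ρ^n G0 with G0 smooth; at the boundary G0 vanishes because
  -- p(n) = 0.
  set G0 : E3 → ℂ := fun z => ∑ k ∈ Finset.range 3, (n : ℂ) ^ k * g v k z with hG0
  have hG0s : ContDiffOn ℝ ∞ G0 (chartDom e) :=
    ContDiffOn.sum fun k _ => contDiffOn_const.mul (hgs v k)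
  have hG00 : G0 y = 0 := by
    have h1 := hgb v y hy hy0 n 1
    rw [aeval_eulerOp_one, hpn, Polynomial.C_0, smul_zero] at h1
    have h2 := congrArg (Polynomial.eval 0) h1
    simp only [eulerOp_pow_one, Polynomial.eval_finsetSum, Polynomial.eval_smul, Polynomial.eval_C,
      Polynomial.eval_zero, smul_eq_mul] at h2
    rw [hG0, ← h2]
    exact Finset.sum_congr rfl fun k _ => mul_comm _ _
  -- In the interior f is the component of P applied to the power-logarithm terms and the remainder,
  -- yet it is smooth up to the boundary.
  set f : E3 → ℂ := fun z => coordRep e V z i j - (r z : ℂ) ^ n * G0 z with hf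
  have hfs : ContDiffOn ℝ ∞ f (chartDom e) :=
    ((evalComp i j).contDiff.comp_contDiffOn (isOfClassOn_univ_iff.1 hVs e he)).sub
      (((Complex.ofRealCLM.contDiff.comp_contDiffOn hr.smooth).pow n).mul hG0s)
  have hterm : ∀ (d : sectionSpace B gbar) (s : ℂ) (Q : ℂ[X]), ∀ z ∈ inn (chartDom e),
      localOp (α e) (fun z => plog r s Q z • coordRep e (d : TensorField M B.a B.b) z) z i j =
        ∑ k ∈ Finset.range 3, plog r s ((eulerOp s ^ k) Q) z * g d k z := by
    intro d s Q z hz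
    rw [← hge d s Q z hz, hloc _ (isSection_powTerm hρ d.2 s Q) e he z hz, coordRep_powTerm]
  have hsmooth : ∀ (d : sectionSpace B gbar) (s : ℂ) (Q : ℂ[X]), ∀ z ∈ inn (chartDom e),
      ContDiffAt ℝ ∞ (fun z => plog r s Q z • coordRep e (d : TensorField M B.a B.b) z) z :=
    fun d s Q z hz => ((contDiffOn_plog hr s Q).contDiffAt (hr.isOpen_inn.mem_nhds hz)).smul
      (hr.contDiffAt (isOfClassOn_univ_iff.1 (IsSection.smooth d.2) e he) hz)
  have hfe : ∀ z ∈ inn (chartDom e), f z = (∑ x' ∈ c.support, ∑ k ∈ Finset.range 3,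
      plog r x'.1 ((eulerOp x'.1 ^ k) (Polynomial.X ^ x'.2)) z * g (c x') k z) +
        localOp (α e) w z i j := by
    intro z hz
    have h1 : coordRep e V z = coordRep e (P u) z := by
      rw [coordRep, coordRep, hVe _ ((symm_mem_int he hz.1).2 hz.2)]
    have h2 : coordRep e u = fun z => (plog r n 1 z • coordRep e (v : TensorField M B.a B.b) z +
        ∑ x' ∈ c.support, plog r x'.1 (Polynomial.X ^ x'.2) z •
          coordRep e (c x' : TensorField M B.a B.b) z) + w z := by
      funext z
      simp only [hw, expTerm_apply, plog, Complex.cpow_natCast, Polynomial.eval_one, mul_one]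
      abel
    have h3 : coordRep e (P u) z i j = (∑ k ∈ Finset.range 3, plog r n ((eulerOp n ^ k) 1) z *
        g v k z + ∑ x' ∈ c.support, ∑ k ∈ Finset.range 3,
      plog r x'.1 ((eulerOp x'.1 ^ k) (Polynomial.X ^ x'.2)) z * g (c x') k z) +
        localOp (α e) w z i j := by
      rw [hloc u hu e he z hz, h2, localOp_add _ ((hsmooth v n 1 z hz).add
        (ContDiffAt.sum fun x' _ => hsmooth (c x') _ _ z hz)) (hworder.contDiffAt hr hz),
        localOp_add _ (hsmooth v n 1 z hz) (ContDiffAt.sum fun x' _ => hsmooth (c x') _ _ z hz),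
        localOp_sum _ fun x' _ => hsmooth (c x') _ _ z hz]
      simp only [Pi.add_apply, Finset.sum_apply, hterm _ _ _ z hz]
    have h4 : ∑ k ∈ Finset.range 3, plog r n ((eulerOp n ^ k) 1) z * g v k z =
        (r z : ℂ) ^ n * G0 z := by
      rw [hG0, Finset.mul_sum]
      refine Finset.sum_congr rfl fun k _ => ?_
      rw [eulerOp_pow_one, plog, Polynomial.eval_C, Complex.cpow_natCast, mul_assoc]
    simp only [hf, h1, h3, h4]
    ring
  -- Every term of f has order at least τ, up to logarithms. Being smooth, f is then divisible by r
  -- to the power ⌈τ⌉, since ⌈τ⌉ < τ + 1.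
  have hsumlim : ∀ t < τ, ∀ y' ∈ chartDom e, y' 0 = 0 →
      Tendsto (fun z => r z ^ (-t) • f z) (𝓝[inn (chartDom e)] y') (𝓝 0) := by
    intro t ht y' hy' hy'0
    have h1 := HasOrder.sum hr (K := (t + τ) / 2) (s := c.support) (fun x' hx' => HasOrder.sum hr
      (s := Finset.range 3) fun k _ => hasOrder_plog_smul hr (hgs (c x') k) x'.1
        ((eulerOp x'.1 ^ k) (Polynomial.X ^ x'.2)) (t := (t + τ) / 2)
        (by have := hmin x' hx'; linarith))
    have h2 := (h1.tendsto_zero hr hy' hy'0 (t := t) (by linarith)).add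
      (tendsto_localOp_zero hr (hα e he) hworder (t := t) (by linarith) hy' hy'0 i j)
    rw [add_zero] at h2
    refine h2.congr' ?_
    filter_upwards [self_mem_nhdsWithin] with z hz
    rw [hfe z hz, smul_add]
    rfl
  have hτ0 : 0 ≤ τ := (Nat.cast_nonneg n).trans hxn
  obtain ⟨f', hf's, hf'e⟩ := hr.exists_eq_pow_smul hfs hsumlim ⌈τ⌉₊ (Nat.ceil_lt_add_one hτ0)
  -- The smooth function f = r^{⌈τ⌉} f' is treated as one more term of the expansion: the index
  -- `none` carries exponent ⌈τ⌉, no logarithm and coefficient -f'.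
  have key := hr.sum_eq_zero_of_tendsto
    (I := Finset.insertNone (c.support ×ˢ Finset.range 3))
    (σ := fun o => o.elim ((⌈τ⌉₊ : ℕ) : ℂ) fun x => x.1.1)
    (Q := fun o => o.elim 1 fun x => (eulerOp x.1.1 ^ x.2) (Polynomial.X ^ x.1.2))
    (g := fun o => o.elim (fun z => - f' z) fun x => g (c x.1) x.2) (y := y) (τ := τ) (s := x.1)
    (by
      rintro (_ | x') -
      · exact hf's.neg
      · exact hgs _ _) hy hy0
    (by
      rintro (_ | x') hx'
      · simpa using Nat.le_ceil τ
      · rw [Finset.some_mem_insertNone, Finset.mem_product] at hx'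
        exact hmin _ hx'.1)
    (by
      have h1 := (tendsto_localOp_zero hr (hα e he) hworder (t := τ) hK hy hy0 i j).neg
      rw [neg_zero] at h1
      refine h1.congr' ?_
      filter_upwards [self_mem_nhdsWithin] with z hz
      rw [← smul_neg]
      congr 1
      rw [Finset.sum_insertNone, Finset.sum_product]
      simp only [Option.elim_none, Option.elim_some, plog, Polynomial.eval_one, mul_one,
        Complex.cpow_natCast]
      have h2 := hfe z hz
      rw [hf'e z hz.1, ← algebraMap_smul ℂ (r z ^ ⌈τ⌉₊)] at h2
      simp only [plog, smul_eq_mul, Complex.coe_algebraMap, Complex.ofReal_pow] at h2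
      linear_combination h2) rfl
  rw [Finset.sum_insertNone, Finset.sum_product] at key
  simp only [Option.elim_none, Option.elim_some] at key
  set a : ℂ × ℕ → ℂ := fun x' => coordRep e (fibreMap A (c x')) y i j with ha
  set R : ℂ[X] := ∑ x' ∈ c.support, if x'.1 = x.1 then a x' • (Polynomial.X : ℂ[X]) ^ x'.2 else 0
    with hR
  have hRa : R.coeff x.2 = a x := coeff_sum_ite c.support a hx
  -- The smooth term meets the exponent σ only if σ = ⌈τ⌉, and then it contributes a constant.
  -- Comparison of the coefficients of r^σ gives p(σ + D) R = b.
  set b : ℂ := if ((⌈τ⌉₊ : ℕ) : ℂ) = x.1 then f' y else 0 with hb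
  have hRb : Polynomial.aeval (eulerOp x.1) p R = Polynomial.C b := by
    have h1 : ∑ x' ∈ c.support, ∑ k ∈ Finset.range 3, (if x'.1 = x.1 then
        g (c x') k y • (eulerOp x'.1 ^ k) ((Polynomial.X : ℂ[X]) ^ x'.2) else 0) =
        Polynomial.aeval (eulerOp x.1) p R := by
      rw [hR, map_sum]
      refine Finset.sum_congr rfl fun x' _ => ?_
      split_ifs with hx'
      · rw [hgb (c x') y hy hy0 x'.1 (Polynomial.X ^ x'.2), hx', map_smul]
      · simp
    have h2 : (if ((⌈τ⌉₊ : ℕ) : ℂ) = x.1 then (-f' y) • (1 : ℂ[X]) else 0) = -Polynomial.C b := by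
      rw [hb]
      split_ifs
      · rw [Polynomial.smul_eq_C_mul, mul_one, Polynomial.C_neg]
      · simp
    rw [← h1]
    exact (neg_add_eq_zero.1 ((congrArg₂ (· + ·) h2.symm rfl).trans key)).symm
  change a x = 0
  rw [← hRa]
  by_cases hp0 : p.eval x.1 = 0
  -- Resonant case, σ = n. Here f' = ρ^{-n} P u - G0 tends to 0, by the decay of P u beyond order n
  -- and the vanishing of G0 on the boundary, so b = 0. As n is a simple root, R is then constant.
  · have hxn' : x.1 = n := hroot _ hp0 hxn
    have hτn : τ = n := by rw [hτ, hxn']; simp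
    have hb0 : b = 0 := by
      rw [hb]
      split_ifs
      swap
      · rfl
      have := hr.neBot hy
      have h1 : Tendsto f' (𝓝[inn (chartDom e)] y) (𝓝 (f' y)) :=
        (hf's.continuousOn y hy).mono inter_subset_left
      have h2 : Tendsto G0 (𝓝[inn (chartDom e)] y) (𝓝 (G0 y)) :=
        (hG0s.continuousOn y hy).mono inter_subset_left
      have h3 := (((hPu e he).clm hr (evalComp i j)).tendsto_zero hr hy hy0 hδ).sub h2
      rw [hG00, sub_zero] at h3
      refine tendsto_nhds_unique h1 (h3.congr' ?_)
      filter_upwards [self_mem_nhdsWithin] with z hz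
      have hz0 : 0 < r z := hr.r_pos hz
      have h4 := hf'e z hz.1
      have h5 : coordRep e V z = coordRep e (P u) z := by
        rw [coordRep, coordRep, hVe _ ((symm_mem_int he hz.1).2 hz.2)]
      rw [hτn, Nat.ceil_natCast, ← algebraMap_smul ℂ] at h4
      simp only [hf, h5, smul_eq_mul, Complex.coe_algebraMap, Complex.ofReal_pow] at h4
      have h6 : (r z : ℂ) ^ n ≠ 0 := pow_ne_zero _ (by exact_mod_cast hz0.ne')
      rw [Real.rpow_neg hz0.le, Real.rpow_natCast, ← algebraMap_smul ℂ]
      simp only [smul_eq_mul, Complex.coe_algebraMap, Complex.ofReal_pow, Complex.ofReal_inv]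
      change _ * coordRep e (P u) z i j - _ = _
      field_simp
      linear_combination h4
    rw [hb0, Polynomial.C_0] at hRb
    obtain ⟨a₀, ha₀⟩ := natDegree_eq_zero_of_aeval_eulerOp_of_root hp0 (hxn' ▸ hsimple) hRb
    have hx2 : x.2 ≠ 0 := fun h0 => hbad 0 (Prod.ext (by simpa using hxn') h0)
    rw [ha₀, Polynomial.coeff_C, if_neg hx2]
  -- Nonresonant case: R = b / p(σ) is constant. If the term has no logarithm, then σ is excluded
  -- from being n + m, so σ ≠ ⌈τ⌉ and b = 0.
  · have h1 := natDegree_eq_zero_of_aeval_eulerOp hp0 hRb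
    rw [h1, Polynomial.coeff_C]
    split_ifs with hx2
    · have hb0 : b = 0 := by
        rw [hb, if_neg]
        intro h2
        have h3 : (n : ℝ) ≤ (⌈τ⌉₊ : ℕ) := hxn.trans (Nat.le_ceil τ)
        obtain ⟨m, hm⟩ := Nat.exists_eq_add_of_le (Nat.cast_le.1 h3)
        exact hbad m (Prod.ext (by rw [← h2, hm]) hx2)
      rw [hb0, zero_div]
    · rfl

end HasExpansion

end Leading

open scoped Manifold ContDiff ComplexConjugate Matrix Polynomial


/-! ### Smoothness up to the boundary -/

section Smoothness

variable {M : Type*} [TopologicalSpace M] [ChartedSpace H3 M] [IsManifold (𝓡∂ 3) ∞ M]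
  {B : TensorType} {gbar : SmoothMetric M} {ρ : M → ℝ} {u : TensorField M B.a B.b} {n : ℕ} {K : ℝ}
  {v : sectionSpace B gbar} {c : (ℂ × ℕ) →₀ sectionSpace B gbar}

namespace HasExpansion

/-- If leading coefficients of order less than `K'` vanish on the boundary, apart from those of
integral powers without logarithms, then the expansion can be rewritten so that only terms of order
at least `K'` remain besides the smooth part. -/
theorem exists_le_re (hρ : IsDefiningFunction ρ) {K' : ℝ}
    (hvan : ∀ v c, HasExpansion (gbar := gbar) ρ u n K v c → ∀ x ∈ c.support,
      (∀ x' ∈ c.support, x.1.re ≤ x'.1.re) → x.1.re < K' →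
      (∀ m : ℕ, x ≠ (((n + m : ℕ) : ℂ), 0)) →
      ∀ q ∈ bdry M, (c x : TensorField M B.a B.b) q = 0)
    (h : HasExpansion ρ u n K v c) :
    ∃ v' c', HasExpansion (gbar := gbar) ρ u n K v' c' ∧ ∀ x ∈ c'.support, K' ≤ x.1.re := by
  induction hN : ∑ x ∈ c.support, ⌈K' - x.1.re⌉₊ using Nat.strong_induction_on
    generalizing v c with
  | _ N ih =>
  by_cases hdone : ∀ x ∈ c.support, K' ≤ x.1.re
  · exact ⟨v, c, h, hdone⟩
  push Not at hdone
  obtain ⟨x₁, hx₁, hx₁K⟩ := hdone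
  -- The induction measure adds up the distances of the exponents to K', rounded up and truncated at
  -- 0. Removing the lowest term, or raising its exponent by one, decreases it.
  obtain ⟨x, hx, hmin⟩ := Finset.exists_min_image c.support (fun x => x.1.re) ⟨x₁, hx₁⟩
  have hxK : x.1.re < K' := (hmin x₁ hx₁).trans_lt hx₁K
  have hpos : 0 < ⌈K' - x.1.re⌉₊ := Nat.ceil_pos.2 (by linarith)
  have hsum := Finset.add_sum_erase c.support (fun x => ⌈K' - x.1.re⌉₊) hx
  by_cases hgood : ∃ m : ℕ, x = (((n + m : ℕ) : ℂ), 0)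
  · obtain ⟨m, hm⟩ := hgood
    obtain ⟨v', hv'⟩ := h.move hρ m
    rw [← hm] at hv'
    refine ih _ ?_ hv' rfl
    rw [Finsupp.support_erase, ← hN]
    omega
  · push Not at hgood
    obtain ⟨d, hd⟩ := h.shift hρ x (hvan v c h x hx hmin hxK hgood)
    refine ih _ ?_ hd rfl
    have hsub : (c.erase x + Finsupp.single (x.1 + 1, x.2) d).support ⊆
        insert (x.1 + 1, x.2) (c.support.erase x) := by
      refine Finsupp.support_add.trans ?_
      rw [Finsupp.support_erase, Finset.insert_eq, Finset.union_comm]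
      exact Finset.union_subset_union Finsupp.support_single_subset subset_rfl
    -- The shifted term may merge with, or even cancel, one already present; so only inequalities
    -- are available here.
    have hle := Finset.sum_le_sum_of_subset (f := fun x : ℂ × ℕ => ⌈K' - x.1.re⌉₊) hsub
    have hins : ∑ x' ∈ insert (x.1 + 1, x.2) (c.support.erase x), ⌈K' - x'.1.re⌉₊ ≤
        ⌈K' - (x.1 + 1).re⌉₊ + ∑ x' ∈ c.support.erase x, ⌈K' - x'.1.re⌉₊ := by
      by_cases hmem : (x.1 + 1, x.2) ∈ c.support.erase x
      · rw [Finset.insert_eq_of_mem hmem]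
        exact Nat.le_add_left _ _
      · rw [Finset.sum_insert hmem]
    have hdrop : ⌈K' - (x.1 + 1).re⌉₊ < ⌈K' - x.1.re⌉₊ := by
      rw [Complex.add_re, Complex.one_re, ← sub_sub, Nat.ceil_sub_one]
      omega
    beta_reduce at hsum hle
    omega

/-- If all remaining terms have high order, the smooth part is a good approximation. -/
theorem hasOrder_sub (hρ : IsDefiningFunction ρ) (h : HasExpansion ρ u n K v c) {t : ℝ}
    (ht : ∀ x ∈ c.support, t < x.1.re) (htK : t ≤ K) {e : OpenPartialHomeomorph M H3}
    (he : e ∈ smoothCharts M) :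
    HasOrder (chartDom e) (chartRho ρ e) t (fun y => coordRep e u y -
      (chartRho ρ e y : ℂ) ^ n • coordRep e (v : TensorField M B.a B.b) y) := by
  have hr := isHalfDomain_chart hρ he
  refine (((h.order e he).mono hr htK).add hr (HasOrder.sum hr fun x hx =>
    hasOrder_plog_smul hr (isOfClassOn_univ_iff.1 (IsSection.smooth (c x).2) e he) x.1
      (Polynomial.X ^ x.2) (ht x hx))).congr hr fun y hy => ?_
  rw [expTerm_apply]
  abel

end HasExpansion

/-- A field that agrees to arbitrarily high order with fields smooth up to the boundary is itself
smooth up to the boundary. -/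
theorem extendsSmoothly_of_hasOrder (hρ : IsDefiningFunction ρ)
    (happ : ∀ K : ℝ, ∃ v : sectionSpace B gbar, ∀ e ∈ smoothCharts M,
      HasOrder (chartDom e) (chartRho ρ e) K (fun y => coordRep e u y -
        (chartRho ρ e y : ℂ) ^ n • coordRep e (v : TensorField M B.a B.b) y)) :
    ExtendsSmoothly u := by
  classical
  choose v hv using happ
  -- The boundary values come from the approximation of order 1; any positive order would give the
  -- same ones. To see C^m regularity this field is compared with the approximation of order m + 2,
  -- from which u differs by a function whose extension by zero is C^m.
  refine ⟨fun x => if x ∈ int M then u x else (ρ x : ℂ) ^ n • (v 1 : TensorField M B.a B.b) x,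
    isOfClassOn_univ_iff.2 fun e he => contDiffOn_infty.2 fun m => ?_, fun x hx => if_pos hx⟩
  have hr := isHalfDomain_chart hρ he
  have hcont : ∀ K, ContDiffOn ℝ ∞ (fun y => (chartRho ρ e y : ℂ) ^ n •
      coordRep e (v K : TensorField M B.a B.b) y) (chartDom e) := fun K =>
    ((Complex.ofRealCLM.contDiff.comp_contDiffOn hr.smooth).pow n).smul
      (isOfClassOn_univ_iff.1 (IsSection.smooth (v K).2) e he)
  have hK : (m : ℝ) + 1 < m + 2 := by linarith
  refine (((hcont (m + 2)).of_le (by exact_mod_cast le_top)).add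
    ((hv (m + 2) e he).contDiffOn_indicator hr m hK)).congr fun y hy => ?_
  by_cases hy0 : 0 < y 0
  · rw [indicator_of_mem (show y ∈ inn (chartDom e) from ⟨hy, hy0⟩), coordRep,
      if_pos ((symm_mem_int he hy).2 hy0), add_sub_cancel]
    rfl
  · have hy0' : y 0 = 0 := le_antisymm (not_lt.1 hy0) (hr.nonneg hy)
    rw [indicator_of_notMem fun h => hy0 h.2, add_zero, coordRep,
      if_neg fun h => hy0 ((symm_mem_int he hy).1 h), map_smul]
    have := hr.neBot hy
    have hlim : ∀ K, 0 < K → Tendsto (fun z => coordRep e u z -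
        (chartRho ρ e z : ℂ) ^ n • coordRep e (v K : TensorField M B.a B.b) z)
        (𝓝[inn (chartDom e)] y) (𝓝 0) := fun K hK => by
      simpa using (hv K e he).tendsto_zero hr hy hy0' hK
    -- Both approximations differ from u by functions tending to 0, so their boundary values
    -- coincide.
    have h1 := (hlim (m + 2) (by positivity)).sub (hlim 1 one_pos)
    have h2 := (((hcont 1).continuousOn y hy).mono (s := inn (chartDom e)) inter_subset_left).sub
      (((hcont (m + 2)).continuousOn y hy).mono (s := inn (chartDom e)) inter_subset_left)
    rw [sub_zero] at h1
    refine sub_eq_zero.1 (tendsto_nhds_unique h2 (h1.congr fun z => ?_))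
    rw [Pi.sub_apply]
    abel

/-- Polyhomogeneous sections have expansions of arbitrarily high order. -/
theorem IsPolyhomogeneous.exists_hasExpansion (hρ : IsDefiningFunction ρ)
    (h : IsPolyhomogeneous B ρ gbar u) (n : ℕ) (K : ℝ) :
    ∃ c, HasExpansion (gbar := gbar) ρ u n K 0 c := by
  classical
  obtain ⟨s, p, ubar, -, -, hubar, hexp⟩ := h.expansion
  -- Order k in the weighted spaces corresponds to order k - r for components.
  obtain ⟨k, hk⟩ := exists_nat_gt (K + B.weight)
  obtain ⟨N, hN⟩ := hexp k
  refine ⟨∑ i ∈ Finset.range (N + 1), ∑ q ∈ (Finset.range (p i + 1)).attach,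
    Finsupp.single (s i - (B.weight : ℂ), q.1)
      ⟨ubar i q.1, hubar i q.1 (Nat.lt_succ_iff.1 (Finset.mem_range.1 q.2))⟩, ⟨fun e he => ?_⟩⟩
  have hr := isHalfDomain_chart hρ he
  refine (hN.hasOrder (K := K) (by linarith) he).congr hr fun y hy => ?_
  simp only [map_sum, expTerm_single]
  have h1 : coordRep e (fun x => u x - ∑ i ∈ Finset.range (N + 1), ∑ q ∈ Finset.range (p i + 1),
        powLog ρ (s i - (B.weight : ℂ)) q x • ubar i q x) y =
      coordRep e u y - ∑ i ∈ Finset.range (N + 1), ∑ q ∈ Finset.range (p i + 1),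
        plog (chartRho ρ e) (s i - (B.weight : ℂ)) (Polynomial.X ^ q) y •
          coordRep e (ubar i q) y := by
    rw [coordRep, map_sub, map_sum]
    simp only [map_sum, map_smul]
    congr 1
    refine Finset.sum_congr rfl fun i _ => Finset.sum_congr rfl fun q _ => ?_
    simp only [powLog, plog, Polynomial.eval_pow, Polynomial.eval_X]
    rfl
  have h2 : coordRep e ((0 : sectionSpace B gbar) : TensorField M B.a B.b) y = 0 :=
    (coordRepL e y).map_zero
  rw [h1, h2, smul_zero, zero_add]
  congr 1
  refine Finset.sum_congr rfl fun i _ => ?_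
  exact (Finset.sum_attach (Finset.range (p i + 1)) fun q =>
    plog (chartRho ρ e) (s i - (B.weight : ℂ)) (Polynomial.X ^ q) y • coordRep e (ubar i q) y)

end Smoothness

/-! ### Characteristic exponents -/

section Exponents

variable {M : Type*} [TopologicalSpace M] [ChartedSpace H3 M] [IsManifold (𝓡∂ 3) ∞ M]
  {B : TensorType} {gbar : SmoothMetric M} {ρ : M → ℝ}
  {P : TensorField M B.a B.b → TensorField M B.a B.b} {p : ℂ[X]}
  {A : ∀ q : M, B.fibre gbar q ≃ₗ[ℂ] B.fibre gbar q}

theorem IndicialValue.unique (hρ : IsDefiningFunction ρ) {s : ℂ} {ubar : TensorField M B.a B.b}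
    {q : M} {T T' : TensorAt B.a B.b q} (h : IndicialValue ρ P s ubar q T)
    (h' : IndicialValue ρ P s ubar q T') : T = T' := by
  have := neBot_nhdsWithin_int hρ q
  have he : chartAt H3 q ∈ smoothCharts M := IsManifold.chart_mem_maximalAtlas q
  have hq := mem_chart_source H3 q
  exact coordComp_injective he hq (tendsto_nhds_unique (h _ he hq) (h' _ he hq))

theorem HasIndicialMap.isRoot (hρ : IsDefiningFunction ρ) (hA : HasIndicialMap B gbar ρ P p A)
    {s : ℂ} (hs : s ∈ charExponents B ρ gbar P) : p.eval s = 0 := by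
  obtain ⟨q, hq, ubar, hubar, hne, h0⟩ := hs
  have h1 := (hA s q hq ubar hubar).unique hρ h0
  refine (smul_eq_zero.1 h1).resolve_right fun h2 => hne ?_
  have h3 := (A q).map_eq_zero_iff.1 (Subtype.ext h2 : A q ⟨ubar q, _⟩ = 0)
  exact congrArg Subtype.val h3

/-- One characteristic exponent supplies a boundary point and a section nonzero there. The same
section witnesses every root of p, so maximality among characteristic exponents bounds all the
roots. -/
theorem HasIndicialMap.mem_charExponents (hA : HasIndicialMap B gbar ρ P p A)
    (hne : (charExponents B ρ gbar P).Nonempty) {s : ℂ} (hs : p.eval s = 0) :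
    s ∈ charExponents B ρ gbar P := by
  obtain ⟨_, q, hq, ubar, hubar, hne, -⟩ := hne
  refine ⟨q, hq, ubar, hubar, hne, ?_⟩
  have h1 := hA s q hq ubar hubar
  rwa [hs, zero_smul] at h1

end Exponents

theorem eval_derivative_ne_zero_of_rootMultiplicity_eq_one {p : ℂ[X]} {s : ℂ}
    (h : p.rootMultiplicity s = 1) : (Polynomial.derivative p).eval s ≠ 0 := by
  have hp : p ≠ 0 := by
    rintro rfl
    simp at h
  intro h0
  have hroot : p.IsRoot s := (Polynomial.rootMultiplicity_pos hp).1 (by omega)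
  have := (Polynomial.one_lt_rootMultiplicity_iff_isRoot hp).2 ⟨hroot, h0⟩
  omega

end AsympHyp

/-! ### Conclusion: smoothness of the solution -/

theorem mainTheorem3
    {M : Type*} [TopologicalSpace M] [T2Space M] [CompactSpace M]
    [ChartedSpace AsympHyp.H3 M] [IsManifold (𝓡∂ 3) ∞ M]
    (ρ : M → ℝ) (hρ : AsympHyp.IsDefiningFunction ρ)
    (gbar : AsympHyp.SmoothMetric M) (hg : AsympHyp.IsAsymptoticallyHyperbolic ρ gbar)
    (B : AsympHyp.TensorType)
    (P : AsympHyp.TensorField M B.a B.b → AsympHyp.TensorField M B.a B.b)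
    (hP : AsympHyp.IsEllipticGeometric B ρ gbar P)
    (hL : AsympHyp.HasSimpleIntegerIndicialMap B ρ gbar P)
    (μ δ : ℝ)
    (hμ_mem : (μ : ℂ) ∈ AsympHyp.charExponents B ρ gbar P)
    (hμ_max : ∀ s ∈ AsympHyp.charExponents B ρ gbar P, s.re ≤ μ)
    (hμ : 0 ≤ μ) (hδ : μ < δ)
    (u : AsympHyp.TensorField M B.a B.b)
    (hu_phg : AsympHyp.IsPolyhomogeneous B ρ gbar u)
    (hu : AsympHyp.InB B ρ (μ + B.weight) u)
    (hPu_smooth : AsympHyp.ExtendsSmoothly (P u))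
    (hPu : AsympHyp.InB B ρ (δ + B.weight) (P u)) :
    AsympHyp.ExtendsSmoothly u := by
  obtain ⟨p, hp, A, hA⟩ := hL
  replace hA : AsympHyp.HasIndicialMap B gbar ρ P p A := hA
  have hpμ := hA.isRoot hρ hμ_mem
  obtain ⟨⟨z, hz⟩, hmult⟩ := hp _ hpμ
  have hz' : μ = z := by exact_mod_cast hz
  obtain ⟨n, rfl⟩ := Int.eq_ofNat_of_zero_le (show 0 ≤ z by exact_mod_cast hz' ▸ hμ)
  obtain rfl : μ = n := by simpa using hz'
  rw [Complex.ofReal_natCast] at hpμ hmult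
  -- A root with Re s ≥ n has Re s = n by maximality of μ, and roots are integers, hence real.
  have hroot : ∀ s : ℂ, p.eval s = 0 → (n : ℝ) ≤ s.re → s = n := by
    intro s hs hns
    have h1 := hμ_max s (hA.mem_charExponents ⟨_, hμ_mem⟩ hs)
    obtain ⟨⟨k, rfl⟩, -⟩ := hp s hs
    have h2 : ((k : ℤ) : ℝ) = n := le_antisymm (by simpa using h1) (by simpa using hns)
    exact_mod_cast h2
  -- Membership in 𝓑_δ gives only orders below δ; an intermediate value still exceeds n.
  obtain ⟨δ', hδ', hδ'δ⟩ := exists_between hδ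
  obtain ⟨N, α, hα, hloc⟩ := hP.geometric.exists_localOp hρ
  refine AsympHyp.extendsSmoothly_of_hasOrder (gbar := gbar) (n := n) hρ fun K => ?_
  -- Terms are eliminated up to exponent |K| + 1 > K. The remainder must stay negligible after P is
  -- applied, which costs N + 2 orders; one more makes the inequality strict.
  obtain ⟨c, hc⟩ := hu_phg.exists_hasExpansion hρ n (|K| + 1 + N + 3)
  have hN : (0 : ℝ) ≤ N := N.cast_nonneg
  obtain ⟨v, c', h, hc'⟩ := hc.exists_le_re hρ (K' := |K| + 1) fun v c h x hx hmin hxK hbad => by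
    rcases lt_or_ge x.1.re n with hxn | hxn
    · exact h.coeff_eq_zero_of_lt hρ hx hmin (by linarith) hxn fun t ht e he =>
        hu.hasOrder (by linarith) he
    · exact h.coeff_eq_zero_of_le hρ hP.geometric hA hpμ hroot
        (AsympHyp.eval_derivative_ne_zero_of_rootMultiplicity_eq_one hmult) hα hloc
        hu_phg.isSection hPu_smooth hδ' (fun e he => hPu.hasOrder (by linarith) he) hx hmin
        (by linarith) hxn hbad
  have hK := le_abs_self K
  exact ⟨v, fun e he => h.hasOrder_sub hρ (fun x hx => by linarith [hc' x hx]) (by linarith) he⟩
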